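/- Let $S\subset\mathbb R^2$ be a bounded domain, $I=[-\tfrac12,\tfrac12]$, $\Omega=S\times I$, $Y=[0,1)^2$, and write $x=(x',x_3)\in\Omega$. (No regularity of $\partial S$ is needed; in particular bounded Lipschitz domains with piecewise $C^1$ boundary are covered.) *Energy density.* Let $W:I\times\mathbb R^2\times\mathbb R^{3\times3}\to[0,\infty]$ be measurable and $Y$-periodic in $y$, and let $c_1,c_2,\rho>0$ be such that for a.e. $(x_3,y)$ the map $F\mapsto W(x_3,y,F)$ is continuous and satisfies $W(x_3,y,RF)=W(x_3,y,F)$ for all $F$ and all $R\in SO(3)$; $W(x_3,y,F)\ge c_1\,\mathrm{dist}^2(F,SO(3))$ for all $F$; and $W(x_3,y,F)\le c_2\,\mathrm{dist}^2(F,SO(3))$ whenever $\mathrm{dist}^2(F,SO(3))\le\rho$. Let $Q(x_3,y,\cdot)$ be quadratic forms on $\mathbb R^{3\times3}$ such that for a.e. $x_3\in I$ $$\lim_{G\to0}\ \operatorname*{ess\,sup}_{y\in Y}\frac{|W(x_3,y,\mathrm{Id}+G)-Q(x_3,y,G)|}{|G|^2}=0 .$$ *Scaling.* Let $\varepsilon:(0,\infty)\to(0,\infty)$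 be nondecreasing with $\varepsilon(h)\to0$, $h/\varepsilon(h)\to0$ and $\varepsilon(h)^2/h\to0$ as $h\to0$. For $w\in H^1(\Omega,\mathbb R^3)$ put $\nabla_hw=(\partial_1w,\partial_2w,\tfrac1h\partial_3w)$ and $\mathcal E^{h,\varepsilon}(w)=\int_\Omega W(x_3,\tfrac{x'}{\varepsilon},\nabla_hw(x))\,dx$. *Data.* Let $u\in H^2(S,\mathbb R^3)\cap W^{2,\infty}(S,\mathbb R^3)$ satisfy $\partial_\alpha u\cdot\partial_\beta u=\delta_{\alpha\beta}$ a.e. in $S$, and let $V\in W^{2,\infty}(S,\mathbb R^3)$. Put $n=\partial_1u\wedge\partial_2u$, $R=(\nabla'u,n)$, $\Pi_{\alpha\beta}=\partial_\alpha u\cdot\partial_\beta n$, $q_V=\mathrm{sym}\big((\nabla'u)^T\nabla'V\big)$ and $\mu=(I-n\otimes n)(\partial_1V\wedge\partial_2u+\partial_1u\wedge\partial_2V)$. Let $\mathcal Y$ denote the torus $\mathbb R^2/\mathbb Z^2$ and let $\zeta\in C_c^\infty(S,C^\infty(\mathcal Y,\mathbb R^2))$, $\varphi\in C_c^\infty(S,C^\infty(\mathcal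 Y))$ and $\bar g\in C_c^\infty(S,C^\infty(I\times\mathcal Y,\mathbb R^3))$; their means over the cell need not vanish. Put $g=(\tfrac12\bar g_1,\tfrac12\bar g_2,\bar g_3)$. For a $2\times2$ matrix $A$ let $\iota(A)$ be the $3\times3$ matrix with upper left block $A$ and all other entries $0$, and let $$\mathcal U(\zeta,\varphi,g)=\begin{pmatrix}\mathrm{sym}\nabla_y\zeta+x_3\nabla_y^2\varphi&\begin{matrix}g_1\\g_2\end{matrix}\\(g_1,\ g_2)&g_3\end{pmatrix}.$$ *Claim.* For $h>0$, with $\varepsilon=\varepsilon(h)$, let $$\begin{aligned}u^h(x)={}&u+hx_3n+h(V+hx_3\mu)-\varepsilon^2\,\varphi\,n+h\varepsilon^2x_3\,R\begin{pmatrix}\partial_{x_1}\varphi+\tfrac1\varepsilon\partial_{y_1}\varphi\\ \partial_{x_2}\varphi+\tfrac1\varepsilon\partial_{y_2}\varphi\\0\end{pmatrix}\\&+h\varepsilon\,R\begin{pmatrix}\zeta\\0\end{pmatrix}+h^2\int_{-1/2}^{x_3}R\,\bar g(x',t,\tfrac{x'}\varepsilon)\,dt,\end{aligned}$$ where $u,V,n,\mu,R$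 are evaluated at $x'$ and $\varphi,\zeta$ and their derivatives at $(x',\tfrac{x'}\varepsilon)$. Then $u^h\in H^1(\Omega,\mathbb R^3)$ for every $h>0$; as $h\to0$, $u^h\to u$ and $\nabla_hu^h\to(\nabla'u,n)$ uniformly in $\Omega$ (that is, in $L^\infty(\Omega)$); and $$\lim_{h\to0}\frac1{h^2}\mathcal E^{h,\varepsilon(h)}(u^h)=\int_S\int_I\int_YQ\Big(x_3,y,\ \iota\big(x_3\Pi(x')+q_V(x')\big)+\mathcal U\big(\zeta(x',\cdot),\varphi(x',\cdot),g(x',\cdot,\cdot)\big)(x_3,y)\Big)\,dy\,dx_3\,dx'.$$ -/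

import Mathlib

open Set Filter Topology MeasureTheory
open scoped ContDiff Matrix

noncomputable section

namespace BendingPlate

/-- In-plane points, with Lebesgue measure as `volume`. -/
abbrev R2 := Fin 2 → ℝ

/-- Vectors of the target space. -/
abbrev R3 := Fin 3 → ℝ

/-- Real `2 × 2` matrices. -/
abbrev M2 := Matrix (Fin 2) (Fin 2) ℝ

/-- Real `3 × 3` matrices. -/
abbrev M3 := Matrix (Fin 3) (Fin 3) ℝ

/-- The standard basis vectors of the plane. -/
def e (α : Fin 2) : R2 := Pi.single α 1

/-- The thickness interval `I = [-1/2, 1/2]`. -/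
def I : Set ℝ := Icc (-1 / 2) (1 / 2)

/-- The unit cell `Y = [0, 1)²`. -/
def Y : Set R2 := {y | ∀ i, y i ∈ Ico (0 : ℝ) 1}

/-- The rescaled plate `Ω = S × I`. -/
def plate (S : Set R2) : Set (R2 × ℝ) := S ×ˢ I

/-- The interior `S × (-1/2, 1/2)` of the rescaled plate (for open `S`), on which Sobolev functions
and weak derivatives are considered. -/
def openPlate (S : Set R2) : Set (R2 × ℝ) := S ×ˢ Ioo (-1 / 2 : ℝ) (1 / 2)

/-! ### Weak derivatives and Sobolev spaces -/

section Sobolev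

variable {E : Type*} [NormedAddCommGroup E] [NormedSpace ℝ E] [MeasureSpace E]

/-- `g` is a weak derivative of `f` in the direction `v` on the open set `U`. -/
def HasWeakDeriv (U : Set E) (v : E) (f g : E → ℝ) : Prop :=
  LocallyIntegrableOn f U ∧ LocallyIntegrableOn g U ∧
    ∀ ψ : E → ℝ, ContDiff ℝ ∞ ψ → HasCompactSupport ψ → tsupport ψ ⊆ U →
      ∫ x in U, f x * fderiv ℝ ψ x v = -∫ x in U, g x * ψ x

open Classical in
/-- A representative of the weak derivative of `f` in the direction `v` on `U` (unique up to null
subsets of `U`) if there is one, and `0` otherwise. -/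
def weakDeriv (U : Set E) (v : E) (f : E → ℝ) : E → ℝ :=
  if h : ∃ g, HasWeakDeriv U v f g then h.choose else 0

/-- The Sobolev space `W^{k,p}(U)` of real functions: all weak derivatives of order at most `k`
exist and lie in `L^p(U)`. (Having weak derivatives in all directions is the same as having weak
partial derivatives.) -/
def MemW (p : ENNReal) (U : Set E) : ℕ → (E → ℝ) → Prop
  | 0, f => MemLp f p (volume.restrict U)
  | k + 1, f => MemLp f p (volume.restrict U) ∧
      ∀ v : E, ∃ g, HasWeakDeriv U v f g ∧ MemW p U k g

/-- The Sobolev space `W^{k,p}(U, ℝ³)`. -/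
def MemWVec (p : ENNReal) (U : Set E) (k : ℕ) (f : E → R3) : Prop :=
  ∀ i, MemW p U k (fun x => f x i)

/-- The (componentwise) weak derivative of a map into `ℝ³` in the direction `v` on `U`. -/
def weakDerivVec (U : Set E) (v : E) (f : E → R3) (x : E) : R3 :=
  fun i => weakDeriv U v (fun z => f z i) x

end Sobolev

/-! ### Isometries, normals and second fundamental forms -/

/-- The weak partial derivative `∂_α u` on `S` of a map `u : S → ℝ³`. -/
def pd (S : Set R2) (α : Fin 2) (u : R2 → R3) : R2 → R3 := weakDerivVec S (e α) u

/-- `H²_δ(S, ℝ³)`: the `H²` maps with `∂_α u · ∂_β u = δ_{αβ}` a.e. in `S`. -/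
def IsometryH2 (S : Set R2) (u : R2 → R3) : Prop :=
  MemWVec 2 S 2 u ∧
    ∀ᵐ x ∂(volume.restrict S), ∀ α β : Fin 2,
      pd S α u x ⬝ᵥ pd S β u x = if α = β then 1 else 0

/-- The normal `n = ∂₁u ∧ ∂₂u`. -/
def normal (S : Set R2) (u : R2 → R3) (x : R2) : R3 :=
  crossProduct (pd S 0 u x) (pd S 1 u x)

/-- The second fundamental form `Π_{αβ} = ∂_α u · ∂_β n`. -/
def secondFF (S : Set R2) (u : R2 → R3) (x : R2) : M2 :=
  Matrix.of fun α β => pd S α u x ⬝ᵥ pd S β (normal S u) x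

/-- The `3 × 2` matrix `∇'u = (∂₁u, ∂₂u)`. -/
def planeGrad (S : Set R2) (u : R2 → R3) (x : R2) : Matrix (Fin 3) (Fin 2) ℝ :=
  Matrix.of fun i α => pd S α u x i

/-- The frame `R = (∇'u, n) = (∂₁u, ∂₂u, n)`, the three vectors being the columns. -/
def frame (S : Set R2) (u : R2 → R3) (x : R2) : M3 :=
  (Matrix.of ![pd S 0 u x, pd S 1 u x, normal S u x])ᵀ

/-- The symmetric part of a matrix. -/
def symPart {d : ℕ} (A : Matrix (Fin d) (Fin d) ℝ) : Matrix (Fin d) (Fin d) ℝ :=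
  (1 / 2 : ℝ) • (A + Aᵀ)

/-- `q_V = sym ((∇'u)ᵀ ∇'V)`. -/
def qV (S : Set R2) (u V : R2 → R3) (x : R2) : M2 :=
  symPart ((planeGrad S u x)ᵀ * planeGrad S V x)

/-- `μ = (I - n ⊗ n)(∂₁V ∧ ∂₂u + ∂₁u ∧ ∂₂V)`. -/
def muField (S : Set R2) (u V : R2 → R3) (x : R2) : R3 :=
  ((1 : M3) - Matrix.vecMulVec (normal S u x) (normal S u x)) *ᵥ
    (crossProduct (pd S 0 V x) (pd S 1 u x) + crossProduct (pd S 0 u x) (pd S 1 V x))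

/-! ### The stored energy -/

/-- The square `|A|²` of the Frobenius norm. -/
def frobSq (A : M3) : ℝ := ∑ i, ∑ j, A i j ^ 2

/-- `dist²(F, SO(3))`. -/
def distSqSO3 (F : M3) : ℝ :=
  ⨅ R : Matrix.specialOrthogonalGroup (Fin 3) ℝ, frobSq (F - (R : M3))

/-- `W : I × ℝ² × M³ → [0, ∞]` is an admissible energy density with constants `c₁, c₂, ρ`, and
`Q(x₃, y, ·)` is the quadratic form of its expansion at the identity. Only the values of `W`
for `x₃ ∈ I`, and those of `Q` for `x₃ ∈ I` and `y ∈ Y`, play a role. -/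
structure IsEnergyDensity (c₁ c₂ ρ : ℝ) (W : ℝ → R2 → M3 → ENNReal)
    (Q : ℝ → R2 → QuadraticForm ℝ M3) : Prop where
  c₁_pos : 0 < c₁
  c₂_pos : 0 < c₂
  ρ_pos : 0 < ρ
  /-- `W` is measurable. -/
  measurable : Measurable fun p : I × R2 × (Fin 3 → Fin 3 → ℝ) =>
    W p.1 p.2.1 (Matrix.of p.2.2)
  /-- `W` is `[0,1)²`-periodic in `y`. -/
  periodic : ∀ x₃ ∈ I, ∀ (y : R2) (k : Fin 2 → ℤ) (F : M3),
    W x₃ (y + fun i => (k i : ℝ)) F = W x₃ y F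
  /-- Continuity in `F`. -/
  continuous : ∀ᵐ p : ℝ × R2 ∂(volume.restrict (I ×ˢ univ)), Continuous (W p.1 p.2)
  /-- (FI) frame indifference. -/
  frame_indifferent : ∀ᵐ p : ℝ × R2 ∂(volume.restrict (I ×ˢ univ)),
    ∀ (F : M3) (R : Matrix.specialOrthogonalGroup (Fin 3) ℝ),
      W p.1 p.2 ((R : M3) * F) = W p.1 p.2 F
  /-- (ND) non degeneracy, lower bound. -/
  lower_bound : ∀ᵐ p : ℝ × R2 ∂(volume.restrict (I ×ˢ univ)),
    ∀ F : M3, ENNReal.ofReal (c₁ * distSqSO3 F) ≤ W p.1 p.2 F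
  /-- (ND) non degeneracy, upper bound close to `SO(3)`. -/
  upper_bound : ∀ᵐ p : ℝ × R2 ∂(volume.restrict (I ×ˢ univ)),
    ∀ F : M3, distSqSO3 F ≤ ρ → W p.1 p.2 F ≤ ENNReal.ofReal (c₂ * distSqSO3 F)
  /-- (QE) quadratic expansion at the identity, uniform in `y`. -/
  expansion : ∀ᵐ x₃ ∂((volume : Measure ℝ).restrict I),
    Tendsto
      (fun G : M3 => essSup
        (fun y => EReal.abs ((W x₃ y (1 + G) : EReal) - ((Q x₃ y G : ℝ) : EReal)) /
          ENNReal.ofReal (frobSq G))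
        (volume.restrict Y))
      (𝓝[≠] 0) (𝓝 0)

/-- The scaling assumption: `ε : (0,∞) → (0,∞)` is nondecreasing, `ε(h) → 0` and
`ε(h)² ≪ h ≪ ε(h)` as `h → 0`. -/
structure IsScaling (ε : ℝ → ℝ) : Prop where
  pos : ∀ h, 0 < h → 0 < ε h
  monotone : MonotoneOn ε (Ioi 0)
  tendsto_zero : Tendsto ε (𝓝[>] 0) (𝓝 0)
  h_div : Tendsto (fun h => h / ε h) (𝓝[>] 0) (𝓝 0)
  sq_div : Tendsto (fun h => ε h ^ 2 / h) (𝓝[>] 0) (𝓝 0)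

/-- The scaled gradient `∇_h w = (∂₁w, ∂₂w, h⁻¹ ∂₃w)` of `w : Ω → ℝ³`, the three vectors being the
columns. -/
def scaledGrad (S : Set R2) (h : ℝ) (w : R2 × ℝ → R3) (x : R2 × ℝ) : M3 :=
  (Matrix.of ![weakDerivVec (openPlate S) (e 0, 0) w x,
    weakDerivVec (openPlate S) (e 1, 0) w x,
    h⁻¹ • weakDerivVec (openPlate S) (0, 1) w x])ᵀ

/-- The rescaled elastic energy `∫_Ω W(x₃, x'/ε, ∇_h w(x)) dx`. -/
def energy (W : ℝ → R2 → M3 → ENNReal) (S : Set R2) (h ε : ℝ) (w : R2 × ℝ → R3) : ENNReal :=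
  ∫⁻ x in plate S, W x.2 (ε⁻¹ • x.1) (scaledGrad S h w x)

/-! ### Periodic correctors and the relaxation field -/

/-- `Y`-periodicity. -/
def PeriodicY {F : Type*} (f : R2 → F) : Prop :=
  ∀ (y : R2) (k : Fin 2 → ℤ), f (y + fun i => (k i : ℝ)) = f y

/-- `C_c^∞(S, C^∞(𝒴, F))`. -/
def IsCorrector {F : Type*} [NormedAddCommGroup F] [NormedSpace ℝ F] (S : Set R2)
    (f : R2 → R2 → F) : Prop :=
  ContDiff ℝ ∞ (fun p : R2 × R2 => f p.1 p.2) ∧ (∀ x, PeriodicY (f x)) ∧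
    ∃ K ⊆ S, IsCompact K ∧ ∀ x ∉ K, ∀ y, f x y = 0

/-- `C_c^∞(S, C^∞(I × 𝒴, F))`, smoothness being understood up to the boundary of `I`. -/
def IsThickCorrector {F : Type*} [NormedAddCommGroup F] [NormedSpace ℝ F] (S : Set R2)
    (f : R2 → ℝ → R2 → F) : Prop :=
  ContDiffOn ℝ ∞ (fun p : R2 × ℝ × R2 => f p.1 p.2.1 p.2.2) (univ ×ˢ (I ×ˢ univ)) ∧
    (∀ x, ∀ t ∈ I, PeriodicY (f x t)) ∧
    ∃ K ⊆ S, IsCompact K ∧ ∀ x ∉ K, ∀ t ∈ I, ∀ y, f x t y = 0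

/-- The embedding `ι` of `2 × 2` matrices into `3 × 3` matrices. -/
def iota (A : M2) : M3 := !![A 0 0, A 0 1, 0; A 1 0, A 1 1, 0; 0, 0, 0]

/-- The Jacobian matrix `(∇ζ)_{αβ} = ∂_β ζ_α`. -/
def jac (ζ : R2 → R2) (y : R2) : M2 := Matrix.of fun α β => fderiv ℝ ζ y (e β) α

/-- The Hessian matrix. -/
def hess (φ : R2 → ℝ) (y : R2) : M2 :=
  Matrix.of fun α β => fderiv ℝ (fun w => fderiv ℝ φ w (e β)) y (e α)

/-- The relaxation field `𝒰(ζ, φ, g)(x₃, y)` for smooth `ζ`, `φ`: the upper left `2 × 2` block is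
`sym ∇_y ζ + x₃ ∇²_y φ`, the last row and the last column are `(g₁, g₂, g₃)`. -/
def relaxField (ζ : R2 → R2) (φ : R2 → ℝ) (g : ℝ → R2 → R3) (x₃ : ℝ) (y : R2) : M3 :=
  let A : M2 := symPart (jac ζ y) + x₃ • hess φ y
  !![A 0 0, A 0 1, g x₃ y 0; A 1 0, A 1 1, g x₃ y 1; g x₃ y 0, g x₃ y 1, g x₃ y 2]

/-- `g = (½ ḡ₁, ½ ḡ₂, ḡ₃)`. -/
def halfShear (gbar : R2 → ℝ → R2 → R3) (x : R2) (t : ℝ) (y : R2) : R3 :=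
  ![gbar x t y 0 / 2, gbar x t y 1 / 2, gbar x t y 2]

/-! ### The recovery sequence -/

/-- The Kirchhoff–Love ansatz `v^h = u + h x₃ n + h (V + h x₃ μ)`. -/
def kirchhoffLove (S : Set R2) (u V : R2 → R3) (h : ℝ) (x : R2 × ℝ) : R3 :=
  u x.1 + (h * x.2) • normal S u x.1 + h • (V x.1 + (h * x.2) • muField S u V x.1)

/-- `∂_{x_α} φ(x', y) + ε⁻¹ ∂_{y_α} φ(x', y)`. -/
def twoScaleD (φ : R2 → R2 → ℝ) (ε : ℝ) (α : Fin 2) (x y : R2) : ℝ :=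
  fderiv ℝ (fun z => φ z y) x (e α) + ε⁻¹ * fderiv ℝ (fun w => φ x w) y (e α)

/-- The recovery sequence: with `R = (∇'u, n)` and `y = x'/ε`,
`u^h(x) = v^h(x) - ε² φ(x', y) n + h ε² x₃ R (∂_{x₁}φ + ε⁻¹ ∂_{y₁}φ, ∂_{x₂}φ + ε⁻¹ ∂_{y₂}φ, 0)ᵀ
  + h ε R (ζ(x', y), 0)ᵀ + h² ∫_{-1/2}^{x₃} R ḡ(x', t, y) dt`. -/
def recovery (S : Set R2) (u V : R2 → R3) (ζ : R2 → R2 → R2) (φ : R2 → R2 → ℝ)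
    (gbar : R2 → ℝ → R2 → R3) (h ε : ℝ) (x : R2 × ℝ) : R3 :=
  let y : R2 := ε⁻¹ • x.1
  let R : M3 := frame S u x.1
  kirchhoffLove S u V h x
    - (ε ^ 2 * φ x.1 y) • normal S u x.1
    + (h * ε ^ 2 * x.2) • (R *ᵥ ![twoScaleD φ ε 0 x.1 y, twoScaleD φ ε 1 x.1 y, 0])
    + (h * ε) • (R *ᵥ ![ζ x.1 y 0, ζ x.1 y 1, 0])
    + h ^ 2 • ∫ t in (-1 / 2 : ℝ)..x.2, R *ᵥ gbar x.1 t y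

end BendingPlate

end

/-! Almost everywhere the scaled gradient of the recovery sequence has the form R (Id + S + h G +
E). Here R = (∇'u, n) is a rotation, because u is an isometry. The matrix S = `skew` has order ε:
the term -ε²φn produces its last row, and the term with hε²x₃ is there to produce the opposite last
column. G = `lead` + `corr` is the bounded strain, and E is of size ε² + hε + h²/ε, which the
scaling assumptions make o(h).

Although S may be much larger than hG, it is an infinitesimal rotation. The Cayley transform of S/2
removes it up to an error quadratic in S, that is of order ε², which is o(h)
(`exists_rotation_mul_eq`). Frame indifference then turns the energy density into W(Id + hG') with
G' uniformly close to G, and the expansion at the identity gives h⁻²W → Q(G)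
(`SliceDensity.ae_close`).

Regularity: u and V are W^{2,∞}, so they and their first derivatives have bounded representatives
that are locally Lipschitz with a uniform constant (`MemW.exists_blip_deriv`). No better is
available, since the boundary of S is arbitrary. By Rademacher's theorem the weak derivatives of all
fields involved are classical ones almost everywhere (`BLip.weakDeriv_ae_eq`), so the gradient can
be computed by the product rule (`Fields.Admissible.fderiv_rep_plane`).

Limit: the expansion is uniform in y only at almost every fixed height x₃, so the argument runs
slice by slice. On a slice, ∫ Q(x'/ε, G(x', x'/ε)) converges to its cell average by shifting x' by
εz and averaging over z in Y (`tendsto_integral_two_scale`). The upper bound on W near SO(3)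
dominates the slice energies, and dominated convergence integrates them over I
(`Fields.Admissible.tendsto_energy_seq`).

Identification: frame indifference forces Q to depend only on the symmetric part of its argument
(`SliceDensity.ae_eq_of_symm`), and G has the same symmetric part as the strain in the claim
(`Fields.Admissible.ae_symm`). Since Q is not assumed measurable, the proof works with
`scaledLimit`, a measurable and periodic function built from W that agrees with Q almost everywhere
on the cell. -/

namespace BendingPlate

/-! ### Bounded, uniformly locally Lipschitz functions -/

/-- `f` is bounded on `U` and locally Lipschitz there with a uniform constant. -/
def BLip {E : Type*} [NormedAddCommGroup E] (U : Set E) (f : E → ℝ) : Prop :=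
  ∃ M : NNReal, (∀ x ∈ U, |f x| ≤ M) ∧ ∀ x ∈ U, ∃ t ∈ 𝓝 x, LipschitzOnWith M f t

namespace BLip

variable {E : Type*} [NormedAddCommGroup E] {U : Set E} {f g : E → ℝ}

theorem const (c : ℝ) : BLip U (fun _ => c) :=
  ⟨‖c‖₊, fun _ _ => by simp, fun _ _ => ⟨univ, univ_mem, (LipschitzWith.const c).lipschitzOnWith.weaken (by simp)⟩⟩

theorem of_lipschitzWith {K : NNReal} {C : ℝ} (hf : LipschitzWith K f) (hb : ∀ x ∈ U, |f x| ≤ C) :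
    BLip U f :=
  ⟨max K C.toNNReal, fun x hx => (hb x hx).trans ((Real.le_coe_toNNReal C).trans (by
      exact_mod_cast le_max_right _ _)),
    fun _ _ => ⟨univ, univ_mem, hf.lipschitzOnWith.weaken (le_max_left _ _)⟩⟩

theorem add (hf : BLip U f) (hg : BLip U g) : BLip U (fun x => f x + g x) := by
  obtain ⟨M, hM, hMl⟩ := hf
  obtain ⟨N, hN, hNl⟩ := hg
  refine ⟨M + N, fun x hx => ?_, fun x hx => ?_⟩
  · push_cast
    exact (abs_add_le _ _).trans (add_le_add (hM x hx) (hN x hx))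
  · obtain ⟨t, ht, hft⟩ := hMl x hx
    obtain ⟨s, hs, hgs⟩ := hNl x hx
    exact ⟨t ∩ s, inter_mem ht hs,
      (hft.mono inter_subset_left).add (hgs.mono inter_subset_right)⟩

theorem continuousAt (hf : BLip U f) {x : E} (hx : x ∈ U) : ContinuousAt f x := by
  obtain ⟨M, -, hMl⟩ := hf
  obtain ⟨t, ht, hft⟩ := hMl x hx
  exact hft.continuousOn.continuousAt ht

theorem continuousOn (hf : BLip U f) : ContinuousOn f U :=
  fun _ hx => (hf.continuousAt hx).continuousWithinAt

/-- A product of Lipschitz functions is Lipschitz only if both factors are bounded; this is why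
`BLip` carries a sup bound. The bounds hold on U only, so the neighbourhoods are cut down to U. -/
theorem mul (hU : IsOpen U) (hf : BLip U f) (hg : BLip U g) : BLip U (fun x => f x * g x) := by
  obtain ⟨M, hM, hMl⟩ := hf
  obtain ⟨N, hN, hNl⟩ := hg
  refine ⟨M * N + M * N, fun x hx => ?_, fun x hx => ?_⟩
  · rw [abs_mul]
    push_cast
    have := mul_le_mul (hM x hx) (hN x hx) (abs_nonneg _) M.2
    have h0 : (0 : ℝ) ≤ M * N := by positivity
    linarith
  · obtain ⟨t, ht, hft⟩ := hMl x hx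
    obtain ⟨s, hs, hgs⟩ := hNl x hx
    refine ⟨t ∩ s ∩ U, inter_mem (inter_mem ht hs) (hU.mem_nhds hx), ?_⟩
    refine LipschitzOnWith.of_dist_le_mul fun y hy z hz => ?_
    have h1 := hft.dist_le_mul y hy.1.1 z hz.1.1
    have h2 := hgs.dist_le_mul y hy.1.2 z hz.1.2
    rw [Real.dist_eq] at *
    have h3 := hM y hy.2
    have h4 := hN z hz.2
    calc |f y * g y - f z * g z| = |f y * (g y - g z) + (f y - f z) * g z| := by ring_nf
      _ ≤ |f y| * |g y - g z| + |f y - f z| * |g z| := by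
          rw [← abs_mul, ← abs_mul]; exact abs_add_le _ _
      _ ≤ M * (N * dist y z) + (M * dist y z) * N := by gcongr
      _ = _ := by push_cast; ring

theorem const_mul (c : ℝ) (hU : IsOpen U) (hf : BLip U f) : BLip U (fun x => c * f x) :=
  (BLip.const c).mul hU hf

theorem neg (hU : IsOpen U) (hf : BLip U f) : BLip U (fun x => - f x) := by
  simpa using hf.const_mul (-1) hU

theorem sub (hU : IsOpen U) (hf : BLip U f) (hg : BLip U g) : BLip U (fun x => f x - g x) := by
  simpa [sub_eq_add_neg] using hf.add (hg.neg hU)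

theorem sum {ι : Type*} (s : Finset ι) {F : ι → E → ℝ} (h : ∀ i ∈ s, BLip U (F i)) :
    BLip U (fun x => ∑ i ∈ s, F i x) := by
  classical
  induction s using Finset.induction_on with
  | empty => simpa using BLip.const (U := U) 0
  | insert a s ha ih =>
    simp only [Finset.sum_insert ha]
    exact (h a (by simp)).add (ih fun i hi => h i (by simp [hi]))

theorem comp_fst {T : Type*} [NormedAddCommGroup T] {A : Set T} (hf : BLip U f) :
    BLip (U ×ˢ A) (fun x : E × T => f x.1) := by
  obtain ⟨M, hM, hMl⟩ := hf
  refine ⟨M, fun x hx => hM _ hx.1, fun x hx => ?_⟩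
  obtain ⟨t, ht, hft⟩ := hMl x.1 hx.1
  refine ⟨Prod.fst ⁻¹' t, continuous_fst.continuousAt.preimage_mem_nhds ht, ?_⟩
  refine LipschitzOnWith.of_dist_le_mul fun y hy z hz => ?_
  exact (hft.dist_le_mul _ hy _ hz).trans (by
    gcongr
    exact le_max_left _ _)

theorem exists_bound (hf : BLip U f) : ∃ M, 0 ≤ M ∧ ∀ x ∈ U, |f x| ≤ M := by
  obtain ⟨M, hM, -⟩ := hf
  exact ⟨M, M.2, hM⟩

variable [NormedSpace ℝ E]

theorem exists_fderiv_bound (hf : BLip U f) :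
    ∃ M, 0 ≤ M ∧ ∀ x ∈ U, ∀ v, |fderiv ℝ f x v| ≤ M * ‖v‖ := by
  obtain ⟨M, -, hMl⟩ := hf
  refine ⟨M, M.2, fun x hx v => ?_⟩
  obtain ⟨t, ht, hft⟩ := hMl x hx
  exact ((fderiv ℝ f x).le_opNorm v).trans (by
    gcongr
    exact norm_fderiv_le_of_lipschitzOn ℝ ht hft)

variable [MeasureSpace E] [BorelSpace E] [FiniteDimensional ℝ E]
  [(volume : Measure E).IsAddHaarMeasure]

/-- Rademacher's theorem on an open set. -/
theorem ae_differentiableAt (hU : IsOpen U) (hf : BLip U f) :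
    ∀ᵐ x ∂(volume.restrict U), DifferentiableAt ℝ f x := by
  rw [ae_restrict_iff' hU.measurableSet, ae_iff]
  have : ProperSpace E := FiniteDimensional.proper ℝ E
  -- Rademacher's theorem applies on a small open set around each point, and a locally null set is
  -- null.
  refine measure_null_of_locally_null _ fun x hx => ?_
  simp only [mem_ofPred_eq, Classical.not_imp] at hx
  obtain ⟨M, -, hMl⟩ := hf
  obtain ⟨t, ht, hft⟩ := hMl x hx.1
  obtain ⟨o, hot, ho, hxo⟩ := mem_nhds_iff.1 ht
  have h1 := (hft.mono hot).ae_differentiableWithinAt (μ := volume) ho.measurableSet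
  rw [ae_restrict_iff' ho.measurableSet, ae_iff] at h1
  refine ⟨{a | ¬ (a ∈ U → DifferentiableAt ℝ f a)} ∩ o,
    inter_mem self_mem_nhdsWithin (mem_nhdsWithin_of_mem_nhds (ho.mem_nhds hxo)),
    measure_mono_null (fun y hy => ?_) h1⟩
  simp only [mem_ofPred_eq, Classical.not_imp]
  refine ⟨hy.2, fun h => hy.1 fun _ => h.differentiableAt (ho.mem_nhds hy.2)⟩

/-- Integration by parts is known for globally Lipschitz functions. On a compact neighbourhood K of
the support of the test function, f is Lipschitz by compactness; it is extended from K to the whole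
space, and the extension agrees with f near the support, where alone the integrands live. -/
theorem hasWeakDeriv (hU : IsOpen U) (hf : BLip U f) (v : E) :
    HasWeakDeriv U v f (fun x => fderiv ℝ f x v) := by
  have : ProperSpace E := FiniteDimensional.proper ℝ E
  obtain ⟨N, hN0, hN⟩ := hf.exists_fderiv_bound
  refine ⟨hf.continuousOn.locallyIntegrableOn hU.measurableSet, ?_, fun ψ hψ hψc hψU => ?_⟩
  · have hb : LocallyIntegrableOn (fun _ : E => N * ‖v‖) U :=
      (locallyIntegrable_const _).locallyIntegrableOn U
    intro x hx
    obtain ⟨s, hs, hi⟩ := hb x hx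
    refine ⟨s ∩ U, inter_mem hs self_mem_nhdsWithin, ?_⟩
    refine Integrable.mono' (hi.mono_set inter_subset_left)
      (measurable_fderiv_apply_const ℝ f v).aestronglyMeasurable ?_
    refine ae_mono (Measure.restrict_mono_set _ inter_subset_right) ?_
    exact ae_restrict_of_forall_mem hU.measurableSet fun y hy => hN y hy v
  · obtain ⟨δ, hδ, hδU⟩ := hψc.isCompact.exists_cthickening_subset_open hU hψU
    set K := Metric.cthickening δ (tsupport ψ) with hK
    have hKc : IsCompact K := hψc.isCompact.cthickening
    have hloc : LocallyLipschitzOn K f := fun x hx => by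
      obtain ⟨M, -, hMl⟩ := hf
      obtain ⟨t, ht, hft⟩ := hMl x (hδU hx)
      exact ⟨M, t, mem_nhdsWithin_of_mem_nhds ht, hft⟩
    obtain ⟨C, hC⟩ := hloc.exists_lipschitzOnWith_of_compact hKc
    obtain ⟨F, hF, hFf⟩ := hC.extend_real
    obtain ⟨D, hD⟩ := ContDiff.lipschitzWith_of_hasCompactSupport hψc hψ (by simp)
    have key := LipschitzWith.integral_lineDeriv_mul_eq (μ := volume) hF hD hψc v
    have hnhd : ∀ x ∈ tsupport ψ, F =ᶠ[𝓝 x] f := fun x hx => by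
      have : K ∈ 𝓝 x := mem_of_superset
        ((Metric.isOpen_thickening (δ := δ)).mem_nhds (Metric.self_subset_thickening hδ _ hx))
        (Metric.thickening_subset_cthickening δ _)
      filter_upwards [this] with y hy using (hFf hy).symm
    have hdiff := hf.ae_differentiableAt hU
    rw [ae_restrict_iff' hU.measurableSet] at hdiff
    rw [setIntegral_eq_integral_of_forall_compl_eq_zero, setIntegral_eq_integral_of_forall_compl_eq_zero]
    · have e1 : ∫ x, lineDeriv ℝ F x v * ψ x = ∫ x, fderiv ℝ f x v * ψ x := by
        refine integral_congr_ae ?_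
        filter_upwards [hdiff] with x hx
        by_cases hxs : x ∈ tsupport ψ
        · have h1 := (hnhd x hxs)
          rw [h1.lineDeriv_eq, (hx (hψU hxs)).lineDeriv_eq_fderiv]
        · simp [image_eq_zero_of_notMem_tsupport hxs]
      have e2 : ∫ x, lineDeriv ℝ ψ x (-v) * F x = - ∫ x, f x * fderiv ℝ ψ x v := by
        rw [← integral_neg]
        refine integral_congr_ae (ae_of_all _ fun x => ?_)
        have hd : DifferentiableAt ℝ ψ x := hψ.contDiffAt.differentiableAt (by simp)
        simp only [hd.lineDeriv_eq_fderiv, map_neg]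
        by_cases hxs : x ∈ tsupport ψ
        · rw [(hnhd x hxs).self_of_nhds]; ring
        · have : fderiv ℝ ψ x = 0 := by
            by_contra h
            exact hxs (tsupport_fderiv_subset ℝ (subset_tsupport _ h))
          simp [this]
      rw [← e1, key, e2, neg_neg]
    · intro x hx
      rw [image_eq_zero_of_notMem_tsupport fun h => hx (hψU h), mul_zero]
    · intro x hx
      have : fderiv ℝ ψ x = 0 := by
        by_contra h
        exact hx (hψU (tsupport_fderiv_subset ℝ (subset_tsupport _ h)))
      simp [this]

end BLip

/-! ### Weak derivatives -/

section Weak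

variable {E : Type*} [NormedAddCommGroup E] [NormedSpace ℝ E] [MeasureSpace E] {U : Set E} {v : E}
  {f g g' : E → ℝ}

theorem HasWeakDeriv.congr_left [OpensMeasurableSpace E]
    (h : HasWeakDeriv U v f g) {f' : E → ℝ}
    (hff : f =ᵐ[volume.restrict U] f') : HasWeakDeriv U v f' g := by
  refine ⟨fun x hx => ?_, h.2.1, fun ψ h1 h2 h3 => ?_⟩
  · obtain ⟨s, hs, hi⟩ := h.1 x hx
    refine ⟨s ∩ U, inter_mem hs self_mem_nhdsWithin, ?_⟩
    exact (hi.mono_set inter_subset_left).congr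
      (ae_mono (Measure.restrict_mono_set _ inter_subset_right) hff)
  · rw [← h.2.2 ψ h1 h2 h3]
    refine integral_congr_ae ?_
    filter_upwards [hff] with x hx
    rw [hx]

variable [BorelSpace E] [FiniteDimensional ℝ E]

/-- The fundamental lemma of the calculus of variations, applied to g - g'. Every representative
chosen by `weakDeriv` can thus be replaced by a computed one. -/
theorem HasWeakDeriv.ae_unique (hU : IsOpen U) (h : HasWeakDeriv U v f g)
    (h' : HasWeakDeriv U v f g') : g =ᵐ[volume.restrict U] g' := by
  have : ProperSpace E := FiniteDimensional.proper ℝ E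
  have key := hU.ae_eq_zero_of_integral_contDiff_smul_eq_zero (μ := volume)
    (f := fun x => g x - g' x) (h.2.1.sub h'.2.1) fun ψ h1 h2 h3 => by
      have hz : ∀ x ∉ U, ψ x = 0 := fun x hx => image_eq_zero_of_notMem_tsupport fun h => hx (h3 h)
      have hi : ∀ k : E → ℝ, LocallyIntegrableOn k U → IntegrableOn (fun x => k x * ψ x) U := by
        intro k hk
        have hk' : IntegrableOn k (tsupport ψ) := hk.integrableOn_compact_subset h3 h2.isCompact
        have : IntegrableOn (fun x => k x * ψ x) (tsupport ψ) :=
          hk'.mul_continuousOn h1.continuous.continuousOn h2.isCompact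
        exact this.of_forall_sdiff_eq_zero hU.measurableSet fun x hx => by
          simp [image_eq_zero_of_notMem_tsupport hx.2]
      have e : ∫ x in U, g x * ψ x = ∫ x in U, g' x * ψ x := by
        have := (h.2.2 ψ h1 h2 h3).symm.trans (h'.2.2 ψ h1 h2 h3)
        linarith
      rw [← setIntegral_eq_integral_of_forall_compl_eq_zero (s := U) fun x hx => by simp [hz x hx]]
      have : ∀ x, ψ x • (g x - g' x) = g x * ψ x - g' x * ψ x := fun x => by
        simp only [smul_eq_mul]; ring
      simp_rw [this]
      rw [integral_sub (hi _ h.2.1) (hi _ h'.2.1), e, sub_self]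
  rw [Filter.EventuallyEq, ae_restrict_iff' hU.measurableSet]
  filter_upwards [key] with x hx hxU
  linarith [hx hxU]

theorem weakDeriv_ae_eq (hU : IsOpen U) (h : HasWeakDeriv U v f g) :
    weakDeriv U v f =ᵐ[volume.restrict U] g := by
  have hex : ∃ g, HasWeakDeriv U v f g := ⟨g, h⟩
  rw [weakDeriv, dif_pos hex]
  exact hex.choose_spec.ae_unique hU h

variable [(volume : Measure E).IsAddHaarMeasure]

theorem BLip.weakDeriv_ae_eq (hU : IsOpen U) (hg : BLip U g) (hfg : f =ᵐ[volume.restrict U] g)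
    (v : E) : weakDeriv U v f =ᵐ[volume.restrict U] fun x => fderiv ℝ g x v :=
  BendingPlate.weakDeriv_ae_eq hU ((hg.hasWeakDeriv hU v).congr_left hfg.symm)

theorem BLip.memW (hU : IsOpen U) (hvol : volume U ≠ ⊤) (hg : BLip U g)
    (hfg : f =ᵐ[volume.restrict U] g) (p : ENNReal) : MemW p U 1 f := by
  have : IsFiniteMeasure (volume.restrict U) := ⟨by simpa using hvol.lt_top⟩
  obtain ⟨N, hN0, hN⟩ := hg.exists_fderiv_bound
  obtain ⟨B, -, hB⟩ := hg.exists_bound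
  refine ⟨?_, fun v => ⟨fun x => fderiv ℝ g x v,
    (hg.hasWeakDeriv hU v).congr_left hfg.symm, ?_⟩⟩
  · refine MemLp.ae_eq hfg.symm (MemLp.of_bound
      (hg.continuousOn.aestronglyMeasurable hU.measurableSet) B ?_)
    exact ae_restrict_of_forall_mem hU.measurableSet hB
  · refine MemLp.of_bound (measurable_fderiv_apply_const ℝ g v).aestronglyMeasurable (N * ‖v‖) ?_
    exact ae_restrict_of_forall_mem hU.measurableSet fun x hx => hN x hx v

end Weak

end BendingPlate

namespace BendingPlate

/-! ### Lipschitz representatives by mollification -/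

section Mollify

variable {E : Type*} [NormedAddCommGroup E] [NormedSpace ℝ E] [MeasureSpace E]
  [FiniteDimensional ℝ E] {U : Set E} {f : E → ℝ}

/-- The mollification of the extension by zero of `f : U → ℝ`. -/
noncomputable def mollify (U : Set E) (b : ContDiffBump (0 : E)) (f : E → ℝ) : E → ℝ :=
  convolution (U.indicator f) (b.normed volume) (ContinuousLinearMap.lsmul ℝ ℝ).flip volume

theorem mollify_apply (b : ContDiffBump (0 : E)) (f : E → ℝ) (x : E) :
    mollify U b f x = ∫ t, b.normed volume (x - t) * U.indicator f t := by
  simp [mollify, convolution_def]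

variable [BorelSpace E] [(volume : Measure E).IsAddHaarMeasure]

theorem continuous_mollify (b : ContDiffBump (0 : E))
    (hf : LocallyIntegrable (U.indicator f)) : Continuous (mollify U b f) :=
  b.hasCompactSupport_normed.continuous_convolution_right _ hf
    (b.contDiff_normed (n := 0)).continuous

theorem integral_normed_sub (b : ContDiffBump (0 : E)) (x : E) :
    ∫ t, b.normed volume (x - t) = 1 := by
  rw [integral_sub_left_eq_self (fun t => b.normed volume t) volume x, b.integral_normed]

theorem integrable_normed_sub (b : ContDiffBump (0 : E)) (x : E) :
    Integrable fun t => b.normed volume (x - t) :=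
  (((b.contDiff_normed (n := 0)).continuous.integrable_of_hasCompactSupport
    b.hasCompactSupport_normed)).comp_sub_left x

theorem abs_mollify_le (hU : MeasurableSet U) (b : ContDiffBump (0 : E)) {B : ℝ} (hB : 0 ≤ B)
    (hb : ∀ᵐ x ∂(volume.restrict U), |f x| ≤ B) (x : E) : |mollify U b f x| ≤ B := by
  rw [mollify_apply, ← Real.norm_eq_abs]
  have hb' : ∀ᵐ t, |U.indicator f t| ≤ B := by
    rw [ae_restrict_iff' hU] at hb
    filter_upwards [hb] with t ht
    by_cases h : t ∈ U
    · simpa [h] using ht h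
    · simpa [h] using hB
  refine (norm_integral_le_of_norm_le ((integrable_normed_sub b x).mul_const B) ?_).trans ?_
  · filter_upwards [hb'] with t ht
    rw [norm_mul, Real.norm_eq_abs, Real.norm_eq_abs, abs_of_nonneg (b.nonneg_normed _)]
    exact mul_le_mul_of_nonneg_left ht (b.nonneg_normed _)
  · rw [integral_mul_const, integral_normed_sub, one_mul]

theorem differentiable_mollify (b : ContDiffBump (0 : E))
    (hf : LocallyIntegrable (U.indicator f)) : Differentiable ℝ (mollify U b f) := fun x =>
  (b.hasCompactSupport_normed.hasFDerivAt_convolution_right _ hf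
    (b.contDiff_normed (n := 1)) x).differentiableAt

theorem fderiv_mollify_apply (b : ContDiffBump (0 : E))
    (hf : LocallyIntegrable (U.indicator f)) (x v : E) :
    fderiv ℝ (mollify U b f) x v =
      ∫ t, fderiv ℝ (b.normed volume) (x - t) v * U.indicator f t := by
  have h1 : ContDiff ℝ 1 (b.normed (volume : Measure E)) := b.contDiff_normed (n := 1)
  have h := b.hasCompactSupport_normed.hasFDerivAt_convolution_right
    (ContinuousLinearMap.lsmul ℝ ℝ).flip hf h1 x
  have h' : fderiv ℝ (mollify U b f) x = _ := h.fderiv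
  rw [h', convolution_precompR_apply _ hf (b.hasCompactSupport_normed.fderiv ℝ)
    (h1.continuous_fderiv (by simp))]
  simp [convolution_def]

/-- If the support of the kernel centred at x stays inside U, the translated kernel is an admissible
test function. The derivative of the mollification is then the mollification of the weak derivative,
an average of values bounded by N. -/
theorem abs_fderiv_mollify_le (hU : MeasurableSet U) (b : ContDiffBump (0 : E))
    (hf : LocallyIntegrable (U.indicator f)) {v : E} {g : E → ℝ} (hg : HasWeakDeriv U v f g)
    {N : ℝ} (hN0 : 0 ≤ N) (hN : ∀ᵐ x ∂(volume.restrict U), |g x| ≤ N) {x : E}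
    (hx : Metric.closedBall x b.rOut ⊆ U) : |fderiv ℝ (mollify U b f) x v| ≤ N := by
  have hs : ContDiff ℝ ∞ (b.normed (volume : Measure E)) := b.contDiff_normed (n := ⊤)
  have hψ : ContDiff ℝ ∞ fun t => b.normed (volume : Measure E) (x - t) :=
    hs.comp (contDiff_const.sub contDiff_id)
  have hsupp : tsupport (fun t => b.normed (volume : Measure E) (x - t)) ⊆
      Metric.closedBall x b.rOut := by
    refine closure_minimal (fun t ht => ?_) Metric.isClosed_closedBall
    have : x - t ∈ Function.support (b.normed (volume : Measure E)) := ht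
    rw [b.support_normed_eq] at this
    rw [Metric.mem_closedBall, dist_comm, dist_eq_norm]
    simpa using (mem_ball_zero_iff.1 this).le
  have : ProperSpace E := FiniteDimensional.proper ℝ E
  have hc : HasCompactSupport fun t => b.normed (volume : Measure E) (x - t) :=
    (isCompact_closedBall x b.rOut).of_isClosed_subset (isClosed_tsupport _) hsupp
  have hd : ∀ t, fderiv ℝ (fun t => b.normed (volume : Measure E) (x - t)) t v =
      - fderiv ℝ (b.normed volume) (x - t) v := fun t => by
    have h1 : DifferentiableAt ℝ (b.normed (volume : Measure E)) (x - t) :=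
      (hs.differentiable (by simp)).differentiableAt
    have h2 : HasFDerivAt (fun t : E => x - t) (-ContinuousLinearMap.id ℝ E) t :=
      (hasFDerivAt_id t).const_sub x
    have h3 : fderiv ℝ (fun t => b.normed (volume : Measure E) (x - t)) t = _ :=
      (h1.hasFDerivAt.comp t h2).fderiv
    rw [h3]
    simp
  have key := hg.2.2 _ hψ hc (hsupp.trans hx)
  rw [fderiv_mollify_apply b hf]
  have e : ∫ t, fderiv ℝ (b.normed volume) (x - t) v * U.indicator f t =
      ∫ t in U, g t * b.normed volume (x - t) := by
    rw [eq_comm, ← neg_eq_iff_eq_neg.2 key, ← integral_neg, ← integral_indicator hU]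
    refine integral_congr_ae (ae_of_all _ fun t => ?_)
    by_cases h : t ∈ U
    · simp only [h, indicator_of_mem, hd]; ring
    · simp [h]
  rw [e, ← Real.norm_eq_abs]
  refine (norm_integral_le_of_norm_le ((integrable_normed_sub b x).integrableOn.const_mul N)
    ?_).trans ?_
  · filter_upwards [hN] with t ht
    rw [norm_mul, Real.norm_eq_abs, Real.norm_eq_abs, abs_of_nonneg (b.nonneg_normed _)]
    exact mul_le_mul_of_nonneg_right ht (b.nonneg_normed _)
  · rw [integral_const_mul]
    refine mul_le_of_le_one_right hN0 ?_
    rw [← integral_normed_sub b x]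
    exact setIntegral_le_integral (integrable_normed_sub b x)
      (ae_of_all _ fun t => b.nonneg_normed _)

/-- The limsup gives a candidate limit defined at every point, and both bounds pass to it. No
convergence of the sequence is needed. -/
theorem blip_limsup {F : Type*} [NormedAddCommGroup F] {U : Set F} {B N : ℝ} (hB : 0 ≤ B)
    (hN : 0 ≤ N) (u : ℕ → F → ℝ) (hbd : ∀ n x, |u n x| ≤ B)
    (hL : ∀ x ∈ U, ∃ t ∈ 𝓝 x, ∀ᶠ n in atTop, ∀ y ∈ t, ∀ z ∈ t, |u n y - u n z| ≤ N * dist y z) :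
    BLip U fun x => limsup (fun n => u n x) atTop := by
  have hup : ∀ x, IsBoundedUnder (· ≤ ·) atTop fun n => u n x := fun x =>
    isBoundedUnder_of ⟨B, fun n => (abs_le.1 (hbd n x)).2⟩
  have hlo : ∀ x, IsBoundedUnder (· ≥ ·) atTop fun n => u n x := fun x =>
    isBoundedUnder_of ⟨-B, fun n => (abs_le.1 (hbd n x)).1⟩
  -- `BLip` asks for one constant serving as sup bound and as Lipschitz constant; B + N serves both.
  refine ⟨⟨B + N, by positivity⟩, fun x _ => ?_, fun x hx => ?_⟩
  · have h1 : -B ≤ limsup (fun n => u n x) atTop := le_limsup_of_frequently_le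
      (Frequently.of_forall fun n => (abs_le.1 (hbd n x)).1) (hup x)
    have h2 : limsup (fun n => u n x) atTop ≤ B := limsup_le_of_le (hlo x).isCoboundedUnder_le
      (Eventually.of_forall fun n => (abs_le.1 (hbd n x)).2)
    change _ ≤ B + N
    rw [abs_le]
    constructor <;> linarith
  · obtain ⟨t, ht, hLt⟩ := hL x hx
    refine ⟨t, ht, ?_⟩
    have hle : ∀ y ∈ t, ∀ z ∈ t, limsup (fun n => u n y) atTop ≤
        limsup (fun n => u n z) atTop + N * dist y z := by
      intro y hy z hz
      rw [← limsup_add_const atTop _ _ (hup z) (hlo z).isCoboundedUnder_le]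
      refine limsup_le_limsup ?_ (hlo y).isCoboundedUnder_le ?_
      · filter_upwards [hLt] with n hn
        have := (abs_le.1 (hn y hy z hz)).2
        linarith
      · refine isBoundedUnder_of ⟨B + N * dist y z, fun n => ?_⟩
        have := (abs_le.1 (hbd n z)).2
        linarith
    refine LipschitzOnWith.of_dist_le_mul fun y hy z hz => ?_
    rw [Real.dist_eq, abs_le]
    have h1 := hle y hy z hz
    have h2 := hle z hz y hy
    rw [dist_comm z y] at h2
    change -((B + N) * dist y z) ≤ _ ∧ _ ≤ (B + N) * dist y z
    have : 0 ≤ B * dist y z := by positivity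
    constructor <;> linarith

/-- A bounded function with bounded weak derivatives has a Lipschitz representative. -/
theorem exists_blip_ae_eq (hU : IsOpen U) {B : ℝ} (hB : 0 ≤ B)
    (hm : AEStronglyMeasurable f (volume.restrict U))
    (hb : ∀ᵐ x ∂(volume.restrict U), |f x| ≤ B) {N : ℝ} (hN0 : 0 ≤ N)
    (hN : ∀ b : ContDiffBump (0 : E), ∀ x, Metric.closedBall x b.rOut ⊆ U →
      ∀ v, |fderiv ℝ (mollify U b f) x v| ≤ N * ‖v‖) :
    ∃ f' : E → ℝ, BLip U f' ∧ Measurable f' ∧ f =ᵐ[volume.restrict U] f' := by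
  have hmem : MemLp f ⊤ (volume.restrict U) := memLp_top_of_bound hm B hb
  have hli : LocallyIntegrable (U.indicator f) :=
    ((memLp_indicator_iff_restrict hU.measurableSet).2 hmem).locallyIntegrable le_top
  obtain ⟨b, hbo, hbi⟩ : ∃ b : ℕ → ContDiffBump (0 : E),
      Tendsto (fun n => (b n).rOut) atTop (𝓝 0) ∧ ∀ n, (b n).rOut ≤ 2 * (b n).rIn := by
    refine ⟨fun n => ⟨1 / (n + 1), 2 * (1 / (n + 1)), by positivity, ?_⟩, ?_, fun n => le_rfl⟩
    · have : (0 : ℝ) < 1 / (n + 1) := by positivity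
      linarith
    · have := (tendsto_one_div_add_atTop_nhds_zero_nat (𝕜 := ℝ)).const_mul 2
      rwa [mul_zero] at this
  have hae := ContDiffBump.ae_convolution_tendsto_right_of_locallyIntegrable (φ := b) (K := 2)
    hbo (Eventually.of_forall hbi) hli
  have hconv : ∀ n x, convolution ((b n).normed volume) (U.indicator f)
      (ContinuousLinearMap.lsmul ℝ ℝ) volume x = mollify U (b n) f x := fun n x => by
    rw [mollify, convolution_flip]
  simp_rw [hconv] at hae
  -- The mollifications converge to f almost everywhere, so their limsup is a representative of f;
  -- it is measurable as a limsup of continuous functions.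
  refine ⟨fun x => limsup (fun n => mollify U (b n) f x) atTop,
    blip_limsup hB hN0 _ (fun n => abs_mollify_le hU.measurableSet (b n) hB hb) fun x hx => ?_,
    Measurable.limsup fun n => (continuous_mollify (b n) hli).measurable, ?_⟩
  · obtain ⟨r, hr, hrU⟩ := Metric.isOpen_iff.1 hU x hx
    refine ⟨Metric.ball x (r / 2), Metric.ball_mem_nhds _ (by positivity), ?_⟩
    filter_upwards [hbo.eventually_lt_const (show 0 < r / 2 by positivity)] with n hn y hy z hz
    have hsub : ∀ w ∈ Metric.ball x (r / 2), Metric.closedBall w (b n).rOut ⊆ U :=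
      fun w hw => (Metric.closedBall_subset_ball' (by
        have := Metric.mem_ball.1 hw; linarith)).trans hrU
    have := (convex_ball x (r / 2)).norm_image_sub_le_of_norm_hasFDerivWithin_le
      (C := N) (f := mollify U (b n) f)
      (fun w _ => (differentiable_mollify (b n) hli w).hasFDerivAt.hasFDerivWithinAt)
      (fun w hw => ContinuousLinearMap.opNorm_le_bound _ hN0 fun v =>
        hN _ w (hsub w hw) v) hz hy
    rwa [← dist_eq_norm y z, Real.norm_eq_abs] at this
  · rw [Filter.EventuallyEq, ae_restrict_iff' hU.measurableSet]
    filter_upwards [hae] with x hx hxU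
    rw [hx.limsup_eq, indicator_of_mem hxU]

end Mollify

theorem ae_abs_le_of_memLp_top {α : Type*} [MeasurableSpace α] {μ : Measure α} {f : α → ℝ}
    (hf : MemLp f ⊤ μ) : ∃ B, 0 ≤ B ∧ ∀ᵐ x ∂μ, |f x| ≤ B := by
  refine ⟨(eLpNormEssSup f μ).toReal, ENNReal.toReal_nonneg, ?_⟩
  have hfin : eLpNormEssSup f μ ≠ ⊤ := by
    have := hf.2.ne
    rwa [eLpNorm_exponent_top] at this
  filter_upwards [ae_le_eLpNormEssSup (f := f) (μ := μ)] with x hx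
  rw [← Real.norm_eq_abs, ← toReal_enorm]
  exact ENNReal.toReal_mono hfin hx

theorem eq_sum_e (v : R2) : v = v 0 • e 0 + v 1 • e 1 := by
  ext i
  fin_cases i <;> simp [e]

/-- A `W^{1,∞}` function has a Lipschitz representative. -/
theorem MemW.exists_blip {S : Set R2} (hS : IsOpen S) {f : R2 → ℝ} (hf : MemW ⊤ S 1 f) :
    ∃ f' : R2 → ℝ, BLip S f' ∧ Measurable f' ∧ f =ᵐ[volume.restrict S] f' := by
  obtain ⟨hf0, hfd⟩ := hf
  obtain ⟨B, hB0, hB⟩ := ae_abs_le_of_memLp_top hf0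
  obtain ⟨g0, hg0, hg0'⟩ := hfd (e 0)
  obtain ⟨g1, hg1, hg1'⟩ := hfd (e 1)
  obtain ⟨N0, hN0, hN0'⟩ := ae_abs_le_of_memLp_top hg0'
  obtain ⟨N1, hN1, hN1'⟩ := ae_abs_le_of_memLp_top hg1'
  have hli : LocallyIntegrable (S.indicator f) :=
    ((memLp_indicator_iff_restrict hS.measurableSet).2 hf0).locallyIntegrable le_top
  refine exists_blip_ae_eq hS hB0 hf0.1 hB (add_nonneg hN0 hN1) fun b x hx v => ?_
  have h0 := abs_fderiv_mollify_le hS.measurableSet b hli hg0 hN0 hN0' hx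
  have h1 := abs_fderiv_mollify_le hS.measurableSet b hli hg1 hN1 hN1' hx
  rw [eq_sum_e v, map_add, map_smul, map_smul, ← eq_sum_e, smul_eq_mul, smul_eq_mul]
  have hv0 : |v 0| ≤ ‖v‖ := norm_le_pi_norm v 0
  have hv1 : |v 1| ≤ ‖v‖ := norm_le_pi_norm v 1
  refine (abs_add_le _ _).trans ?_
  rw [abs_mul, abs_mul, add_mul, mul_comm N0, mul_comm N1]
  gcongr

/-- A `W^{2,∞}` function together with Lipschitz representatives of its first derivatives. -/
theorem MemW.exists_blip_deriv {S : Set R2} (hS : IsOpen S) {f : R2 → ℝ} (hf : MemW ⊤ S 2 f) :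
    ∃ f' : R2 → ℝ, ∃ p : Fin 2 → R2 → ℝ, (BLip S f' ∧ Measurable f' ∧ f =ᵐ[volume.restrict S] f') ∧
      ∀ α, BLip S (p α) ∧ Measurable (p α) ∧
        weakDeriv S (e α) f =ᵐ[volume.restrict S] p α ∧
        (fun x => fderiv ℝ f' x (e α)) =ᵐ[volume.restrict S] p α := by
  obtain ⟨hf0, hfd⟩ := hf
  obtain ⟨f', hf', hm, hff⟩ := MemW.exists_blip hS (f := f)
    ⟨hf0, fun v => (hfd v).imp fun g hg => ⟨hg.1, hg.2.1⟩⟩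
  choose g hg hgW using fun α => hfd (e α)
  choose p hp hpm hgp using fun α => MemW.exists_blip hS (hgW α)
  refine ⟨f', p, ⟨hf', hm, hff⟩, fun α => ⟨hp α, hpm α, ?_, ?_⟩⟩
  · exact (weakDeriv_ae_eq hS (hg α)).trans (hgp α)
  -- The classical derivative of the representative and the assumed weak derivative are both weak
  -- derivatives of f, hence agree almost everywhere.
  · exact ((hf'.weakDeriv_ae_eq hS hff (e α)).symm.trans (weakDeriv_ae_eq hS (hg α))).trans (hgp α)

end BendingPlate

namespace BendingPlate

/-! ### Matrix estimates and rotations close to the identity -/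

section MatrixEstimates

attribute [local instance] Matrix.normedAddCommGroup Matrix.normedSpace

theorem abs_entry_le_norm {m n : ℕ} (A : Matrix (Fin m) (Fin n) ℝ) (i : Fin m) (j : Fin n) :
    |A i j| ≤ ‖A‖ :=
  Matrix.norm_entry_le_entrywise_sup_norm A

theorem norm_mul_le_three (A B : M3) : ‖A * B‖ ≤ 3 * (‖A‖ * ‖B‖) := by
  refine (Matrix.norm_le_iff (by positivity)).2 fun i j => ?_
  rw [Matrix.mul_apply, Real.norm_eq_abs]
  refine (Finset.abs_sum_le_sum_abs _ _).trans ?_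
  have : ∀ k ∈ Finset.univ, |A i k * B k j| ≤ ‖A‖ * ‖B‖ := fun k _ => by
    rw [abs_mul]
    exact mul_le_mul (abs_entry_le_norm A i k) (abs_entry_le_norm B k j) (abs_nonneg _)
      (norm_nonneg _)
  refine (Finset.sum_le_card_nsmul _ _ _ this).trans ?_
  simp

theorem frobSq_nonneg (A : M3) : 0 ≤ frobSq A := by unfold frobSq; positivity

theorem norm_sq_le_frobSq (A : M3) : ‖A‖ ^ 2 ≤ frobSq A := by
  have h : ‖A‖ ≤ Real.sqrt (frobSq A) := by
    refine (Matrix.norm_le_iff (Real.sqrt_nonneg _)).2 fun i j => Real.abs_le_sqrt ?_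
    calc A i j ^ 2 ≤ ∑ j, A i j ^ 2 :=
          Finset.single_le_sum (f := fun j => A i j ^ 2) (fun _ _ => sq_nonneg _)
            (Finset.mem_univ j)
      _ ≤ _ := Finset.single_le_sum (f := fun i => ∑ j, A i j ^ 2)
            (fun _ _ => Finset.sum_nonneg fun _ _ => sq_nonneg _) (Finset.mem_univ i)
  calc ‖A‖ ^ 2 ≤ Real.sqrt (frobSq A) ^ 2 := by gcongr
    _ = _ := Real.sq_sqrt (frobSq_nonneg A)

theorem frobSq_le_norm_sq (A : M3) : frobSq A ≤ 9 * ‖A‖ ^ 2 := by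
  have h : ∀ i j, A i j ^ 2 ≤ ‖A‖ ^ 2 := fun i j => by
    rw [← sq_abs]
    have := abs_entry_le_norm A i j
    gcongr
  have h2 : ∑ i : Fin 3, ∑ j : Fin 3, A i j ^ 2 ≤ ∑ _i : Fin 3, ∑ _j : Fin 3, ‖A‖ ^ 2 :=
    Finset.sum_le_sum fun i _ => Finset.sum_le_sum fun j _ => h i j
  unfold frobSq
  refine h2.trans (le_of_eq ?_)
  simp
  ring

theorem frobSq_smul (c : ℝ) (A : M3) : frobSq (c • A) = c ^ 2 * frobSq A := by
  simp [frobSq, mul_pow, Finset.mul_sum]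

theorem frobSq_eq_zero_iff {A : M3} : frobSq A = 0 ↔ A = 0 := by
  refine ⟨fun h => ?_, fun h => by simp [h, frobSq]⟩
  have := norm_sq_le_frobSq A
  rw [h] at this
  have h0 : ‖A‖ = 0 := by nlinarith [norm_nonneg A]
  exact norm_eq_zero.1 h0

theorem continuous_frobSq : Continuous frobSq := by
  unfold frobSq
  fun_prop

theorem distSqSO3_one_add_le (G : M3) : distSqSO3 (1 + G) ≤ frobSq G := by
  refine (ciInf_le ⟨0, ?_⟩ (1 : Matrix.specialOrthogonalGroup (Fin 3) ℝ)).trans (le_of_eq ?_)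
  · rintro _ ⟨R, rfl⟩
    exact frobSq_nonneg _
  · simp

variable {A : M3}

theorem skew_entries (hA : Aᵀ = -A) :
    A 0 0 = 0 ∧ A 1 1 = 0 ∧ A 2 2 = 0 ∧ A 1 0 = -A 0 1 ∧ A 2 0 = -A 0 2 ∧ A 2 1 = -A 1 2 := by
  have h : ∀ i j, A j i = -A i j := fun i j => by
    have := congrFun (congrFun hA i) j
    simpa using this
  refine ⟨?_, ?_, ?_, h 0 1, h 0 2, h 1 2⟩ <;>
  [have := h 0 0; have := h 1 1; have := h 2 2] <;> linarith

theorem det_one_add_skew_ne_zero (hA : Aᵀ = -A) : (1 + A).det ≠ 0 := by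
  obtain ⟨h0, h1, h2, h3, h4, h5⟩ := skew_entries hA
  have : (1 + A).det = 1 + A 0 1 ^ 2 + A 0 2 ^ 2 + A 1 2 ^ 2 := by
    rw [Matrix.det_fin_three]
    simp [h0, h1, h2, h3, h4, h5]
    ring
  rw [this]
  positivity

/-- For skew A the cross term X · AX vanishes, so |(1+A)X|² = |X|² + |AX|². Hence (1+A)⁻¹ does not
increase the Frobenius norm, with no smallness of A required. -/
theorem frobSq_le_frobSq_one_add_skew_mul (hA : Aᵀ = -A) (X : M3) :
    frobSq X ≤ frobSq ((1 + A) * X) := by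
  obtain ⟨h0, h1, h2, h3, h4, h5⟩ := skew_entries hA
  have key : frobSq ((1 + A) * X) = frobSq X + frobSq (A * X) := by
    have e1 : (1 + A) * X = X + A * X := by rw [add_mul, one_mul]
    rw [e1]
    simp only [frobSq, Matrix.add_apply, Matrix.mul_apply, Fin.sum_univ_three, h0, h1, h2, h3, h4, h5]
    ring
  linarith [frobSq_nonneg (A * X)]

/-- The Cayley transform of a skew symmetric matrix. -/
theorem exists_cayley (hA : Aᵀ = -A) :
    ∃ C ∈ Matrix.specialOrthogonalGroup (Fin 3) ℝ, (1 + A) * C = 1 - A := by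
  have hu : IsUnit (1 + A).det := isUnit_iff_ne_zero.2 (det_one_add_skew_ne_zero hA)
  have ht : (1 + A)ᵀ = 1 - A := by
    rw [Matrix.transpose_add, hA, Matrix.transpose_one, sub_eq_add_neg]
  have hu' : IsUnit (1 - A).det := by rwa [← ht, Matrix.det_transpose]
  -- The factors 1 + A and 1 - A commute and are transposes of each other: this makes (1+A)⁻¹(1-A)
  -- orthogonal, and equality of their determinants makes it special.
  have hcomm : (1 - A) * (1 + A) = (1 + A) * (1 - A) := by noncomm_ring
  refine ⟨(1 + A)⁻¹ * (1 - A), ?_, ?_⟩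
  · rw [Matrix.mem_specialOrthogonalGroup_iff, Matrix.mem_orthogonalGroup_iff]
    constructor
    · rw [Matrix.transpose_mul, Matrix.transpose_nonsing_inv, ht,
        show (1 - A)ᵀ = 1 + A by rw [← ht, Matrix.transpose_transpose]]
      calc (1 + A)⁻¹ * (1 - A) * ((1 + A) * (1 - A)⁻¹)
          = (1 + A)⁻¹ * ((1 - A) * (1 + A)) * (1 - A)⁻¹ := by simp only [mul_assoc]
        _ = (1 + A)⁻¹ * (1 + A) * ((1 - A) * (1 - A)⁻¹) := by rw [hcomm]; simp only [mul_assoc]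
        _ = 1 := by rw [Matrix.nonsing_inv_mul _ hu, Matrix.mul_nonsing_inv _ hu', one_mul]
    · have hd : (1 - A).det = (1 + A).det := by rw [← ht, Matrix.det_transpose]
      rw [Matrix.det_mul, hd, ← Matrix.det_mul, Matrix.nonsing_inv_mul _ hu, Matrix.det_one]
  · rw [← mul_assoc, Matrix.mul_nonsing_inv _ hu, one_mul]

/-- An infinitesimal rotation can be removed by a rotation up to quadratic errors. -/
theorem exists_rotation_mul_eq (S G E : M3) (h : ℝ) (hS : Sᵀ = -S) :
    ∃ C ∈ Matrix.specialOrthogonalGroup (Fin 3) ℝ, ∃ E' : M3,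
      C * (1 + S + h • G + E) = 1 + h • G + E' ∧
      ‖E'‖ ≤ 9 * (‖S‖ ^ 2 + |h| * (‖S‖ * ‖G‖) + (1 + ‖S‖) * ‖E‖) := by
  -- The factor ½ is the one for which (1 - A)(1 + S) and 1 + A agree to first order, so that the
  -- Cayley transform cancels S.
  set A : M3 := (1 / 2 : ℝ) • S with hAdef
  have hSA : S = A + A := by rw [hAdef, ← add_smul]; norm_num
  have hA : Aᵀ = -A := by rw [hAdef, Matrix.transpose_smul, hS, smul_neg]
  obtain ⟨C, hC, hCA⟩ := exists_cayley hA
  refine ⟨C, hC, C * (1 + S + h • G + E) - (1 + h • G), by abel, ?_⟩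
  set E' := C * (1 + S + h • G + E) - (1 + h • G) with hE'
  -- T is (1 + A)E' expanded. All terms of first order in S cancel, leaving S², hSG and the terms
  -- containing E.
  set T : M3 := -((1 / 2 : ℝ) • (S * S)) - h • (S * G) + E - (1 / 2 : ℝ) • (S * E) with hT
  have hEq : (1 + A) * E' = T := by
    rw [hE', mul_sub, ← mul_assoc, hCA, hT]
    have e1 : (1 / 2 : ℝ) • (S * S) = A * A + A * A := by
      rw [← smul_mul_assoc, ← hAdef, hSA, mul_add]
    have e2 : (1 / 2 : ℝ) • (S * E) = A * E := by rw [← smul_mul_assoc]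
    rw [e1, e2, hSA]
    simp only [sub_mul, add_mul, mul_add, one_mul, mul_one, mul_smul_comm, smul_add, smul_sub]
    abel
  have hTn : ‖T‖ ≤ 3 * (‖S‖ ^ 2 + |h| * (‖S‖ * ‖G‖) + (1 + ‖S‖) * ‖E‖) := by
    have b1 := norm_mul_le_three S S
    have b2 := norm_mul_le_three S G
    have b3 := norm_mul_le_three S E
    have n1 : ‖(1 / 2 : ℝ) • (S * S)‖ = 1 / 2 * ‖S * S‖ := by rw [norm_smul]; norm_num
    have n3 : ‖(1 / 2 : ℝ) • (S * E)‖ = 1 / 2 * ‖S * E‖ := by rw [norm_smul]; norm_num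
    have n2 : ‖h • (S * G)‖ = |h| * ‖S * G‖ := by rw [norm_smul, Real.norm_eq_abs]
    have n2' : |h| * ‖S * G‖ ≤ |h| * (3 * (‖S‖ * ‖G‖)) := by gcongr
    have t : ‖T‖ ≤ ‖(1 / 2 : ℝ) • (S * S)‖ + ‖h • (S * G)‖ + ‖E‖ + ‖(1 / 2 : ℝ) • (S * E)‖ := by
      rw [hT]
      refine (norm_sub_le _ _).trans (add_le_add_left ((norm_add_le _ _).trans
        (add_le_add_left ((norm_sub_le _ _).trans ?_) _)) _)
      rw [norm_neg]
    rw [n1, n2, n3] at t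
    have hp1 : 0 ≤ ‖S‖ * ‖E‖ := by positivity
    have hp2 : 0 ≤ |h| * (‖S‖ * ‖G‖) := by positivity
    nlinarith [norm_nonneg E, norm_nonneg S]
  -- The factor 3 is the price of passing from the entrywise sup norm to the Frobenius norm, where
  -- (1 + A)⁻¹ is a contraction.
  have h1 : ‖E'‖ ^ 2 ≤ (3 * ‖T‖) ^ 2 := by
    calc ‖E'‖ ^ 2 ≤ frobSq E' := norm_sq_le_frobSq E'
      _ ≤ frobSq T := by rw [← hEq]; exact frobSq_le_frobSq_one_add_skew_mul hA E'
      _ ≤ 9 * ‖T‖ ^ 2 := frobSq_le_norm_sq T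
      _ = _ := by ring
  have h2 : ‖E'‖ ≤ 3 * ‖T‖ := le_of_sq_le_sq h1 (by positivity)
  linarith

/-! ### Bounded nonnegative quadratic forms -/

theorem continuous_quadraticForm (B : QuadraticForm ℝ M3) : Continuous B := by
  have h : ∀ G, B G = QuadraticMap.associated (R := ℝ) B G G := fun G =>
    (QuadraticMap.associated_eq_self_apply ℝ B G).symm
  have h2 : Continuous fun G : M3 => QuadraticMap.associated (R := ℝ) B G G := by
    have : FiniteDimensional ℝ M3 := inferInstance
    let L : M3 →ₗ[ℝ] (M3 →L[ℝ] ℝ) :=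
      (LinearMap.toContinuousLinearMap : (M3 →ₗ[ℝ] ℝ) ≃ₗ[ℝ] (M3 →L[ℝ] ℝ)).toLinearMap ∘ₗ
        (QuadraticMap.associated (R := ℝ) B : M3 →ₗ[ℝ] M3 →ₗ[ℝ] ℝ)
    have hL : Continuous L := L.continuous_of_finiteDimensional
    exact hL.clm_apply continuous_id
  exact h2.congr fun G => (h G).symm

/-- With D = G - H one has B(G) - B(H) = B(D) + polar(H, D); the polar term is controlled by
nonnegativity of B on the line through H in direction D, as in the Cauchy–Schwarz inequality. Each
of the two terms is at most 18 c a ‖D‖. -/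
theorem quadraticForm_sub_le (B : QuadraticForm ℝ M3) {c : ℝ} (h0 : ∀ G, 0 ≤ B G)
    (hc : ∀ G, B G ≤ c * frobSq G) {a : ℝ} (G H : M3) (hGa : ‖G‖ ≤ a) (hHa : ‖H‖ ≤ a) :
    |B G - B H| ≤ 36 * c * a * ‖G - H‖ := by
  rcases eq_or_ne G H with rfl | hne
  · simp
  set D := G - H with hD
  have hd : 0 < ‖D‖ := norm_pos_iff.2 (sub_ne_zero.2 hne)
  have hda : ‖D‖ ≤ 2 * a := (norm_sub_le _ _).trans (by linarith)
  have ha : 0 < a := by linarith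
  have hc0 : 0 ≤ c := by
    have h1 := (h0 D).trans (hc D)
    have h2 : 0 < frobSq D := lt_of_lt_of_le (by positivity) (norm_sq_le_frobSq D)
    exact nonneg_of_mul_nonneg_left h1 h2
  have hb : ∀ X : M3, B X ≤ 9 * c * ‖X‖ ^ 2 := fun X => by
    have := mul_le_mul_of_nonneg_left (frobSq_le_norm_sq X) hc0
    linarith [hc X]
  have hG : G = H + D := by rw [hD]; abel
  have hexp : B G = B H + B D + QuadraticMap.polar B H D := by
    rw [hG, QuadraticMap.map_add B]
  have hBH : B H ≤ 9 * c * a ^ 2 := (hb H).trans (by gcongr)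
  have hBD : B D ≤ 9 * c * ‖D‖ ^ 2 := hb D
  have hpol : ∀ s : ℝ, s * QuadraticMap.polar B H D ≥ -(B H + s ^ 2 * B D) := fun s => by
    have h1 := h0 (H + s • D)
    rw [QuadraticMap.map_add B, QuadraticMap.map_smul, QuadraticMap.polar_smul_right,
      smul_eq_mul, smul_eq_mul] at h1
    nlinarith
  -- This parameter gives B(H) and s²B(D) the same bound 9ca²; the opposite sign yields the other
  -- side of the estimate.
  have hs := hpol (a / ‖D‖)
  have hs' := hpol (-(a / ‖D‖))
  have hsq : (a / ‖D‖) ^ 2 * B D ≤ 9 * c * a ^ 2 := by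
    calc (a / ‖D‖) ^ 2 * B D ≤ (a / ‖D‖) ^ 2 * (9 * c * ‖D‖ ^ 2) := by gcongr
      _ = _ := by field_simp
  have hp : |QuadraticMap.polar B H D| ≤ 18 * c * a * ‖D‖ := by
    have h1 : |a / ‖D‖ * QuadraticMap.polar B H D| ≤ 18 * c * a ^ 2 := by
      rw [abs_le]
      constructor <;> nlinarith
    rw [abs_mul, abs_of_pos (div_pos ha hd), div_mul_eq_mul_div, div_le_iff₀ hd] at h1
    have h2 : a * |QuadraticMap.polar B H D| ≤ a * (18 * c * a * ‖D‖) := by linarith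
    exact le_of_mul_le_mul_left h2 ha
  have hBD0 := h0 D
  have hBD' : B D ≤ 18 * c * a * ‖D‖ := hBD.trans (by
    have : 9 * c * ‖D‖ * ‖D‖ ≤ 9 * c * ‖D‖ * (2 * a) := by gcongr
    linarith)
  rw [hexp, show B H + B D + QuadraticMap.polar B H D - B H =
    B D + QuadraticMap.polar B H D by ring]
  have h3 := abs_add_le (B D) (QuadraticMap.polar B H D)
  rw [abs_of_nonneg hBD0] at h3
  linarith

end MatrixEstimates

end BendingPlate

namespace BendingPlate

/-! ### Slices of the energy density -/

theorem measurableSet_Y : MeasurableSet Y := by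
  have : Y = ⋂ i, {y : R2 | y i ∈ Ico (0 : ℝ) 1} := by ext y; simp [Y]
  rw [this]
  exact MeasurableSet.iInter fun i => measurable_pi_apply i measurableSet_Ico

/-- The projection of the real line to `I`. -/
noncomputable def clampI (t : ℝ) : I := projIcc (-1 / 2 : ℝ) (1 / 2) (by norm_num) t

theorem clampI_of_mem {t : ℝ} (ht : t ∈ I) : (clampI t : ℝ) = t := by
  unfold clampI
  rw [projIcc_of_mem _ ht]

theorem continuous_clampI : Continuous clampI :=
  continuous_projIcc (h := by norm_num)

/-- A property which is periodic and holds almost everywhere in the cell holds almost everywhere. -/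
theorem ae_of_ae_restrict_Y {P : R2 → Prop}
    (hP : ∀ (y : R2) (k : Fin 2 → ℤ), P y → P (y + fun i => (k i : ℝ)))
    (h : ∀ᵐ y ∂(volume.restrict Y), P y) : ∀ᵐ y : R2, P y := by
  rw [ae_restrict_iff' measurableSet_Y, ae_iff] at h
  rw [ae_iff]
  have hsub : {y : R2 | ¬ P y} ⊆
      ⋃ k : Fin 2 → ℤ, (fun y : R2 => y - fun i => (k i : ℝ)) ⁻¹' {y | ¬ (y ∈ Y → P y)} := by
    intro y hy
    -- Subtracting integer parts moves y into the cell, so the exceptional set lies in a countable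
    -- union of translates of a null set.
    refine mem_iUnion.2 ⟨fun i => ⌊y i⌋, ?_⟩
    simp only [mem_preimage, mem_ofPred_eq, Classical.not_imp]
    refine ⟨fun i => ?_, fun h => hy ?_⟩
    · exact ⟨by simp, by simpa using Int.fract_lt_one (y i)⟩
    · simpa using hP _ (fun i => ⌊y i⌋) h
  refine measure_mono_null hsub (measure_iUnion_null fun k => ?_)
  rw [(measurePreserving_sub_right volume _).measure_preimage_emb
    (measurableEmbedding_subRight _), h]

/-- The limit of `n² W(t, y, Id + G / n)`. -/
noncomputable def scaledLimit (W : ℝ → R2 → M3 → ENNReal) (t : ℝ) (y : R2) (G : M3) : ℝ :=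
  (limsup (fun n : ℕ => ENNReal.ofReal ((n + 1 : ℝ) ^ 2) *
    W (clampI t) y (1 + (n + 1 : ℝ)⁻¹ • G)) atTop).toReal

/-- The properties of the energy density at a fixed height `x₃`, with its quadratic expansion. -/
structure SliceDensity (c ρ : ℝ) (w : R2 → M3 → ENNReal) (q : R2 → M3 → ℝ) : Prop where
  periodic_q : ∀ (y : R2) (k : Fin 2 → ℤ) (F : M3), q (y + fun i => (k i : ℝ)) F = q y F
  frame : ∀ᵐ y, ∀ (F : M3) (R : Matrix.specialOrthogonalGroup (Fin 3) ℝ),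
    w y ((R : M3) * F) = w y F
  upper : ∀ᵐ y, ∀ F : M3, distSqSO3 F ≤ ρ → w y F ≤ ENNReal.ofReal (c * distSqSO3 F)
  quad : ∀ᵐ y, ∃ B : QuadraticForm ℝ M3, (∀ G, q y G = B G) ∧
    ∀ G, 0 ≤ B G ∧ B G ≤ c * frobSq G
  expansion : ∀ η, 0 < η → ∃ δ, 0 < δ ∧ ∀ᵐ y, ∀ G, frobSq G < δ →
    w y (1 + G) ≠ ⊤ ∧ |(w y (1 + G)).toReal - q y G| ≤ η * frobSq G

/-- The real number r is not known to be nonnegative here. Since w ≥ 0, closeness of r to w yields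
-a ≤ r; this is the source of the nonnegativity of Q. -/
theorem toReal_close_of_abs_le {w : ENNReal} {r a : ℝ}
    (h : EReal.abs ((w : EReal) - (r : EReal)) ≤ ENNReal.ofReal a) (ha : 0 ≤ a) :
    w ≤ ENNReal.ofReal (r + a) ∧ ENNReal.ofReal (r - a) ≤ w ∧ -a ≤ r := by
  induction w with
  | top => simp at h
  | coe x =>
    have e : ((x : ENNReal) : EReal) - (r : EReal) = (((x : ℝ) - r : ℝ) : EReal) := by
      rw [EReal.coe_sub]; rfl
    rw [e, EReal.abs_def, ENNReal.ofReal_le_ofReal_iff ha, abs_le] at h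
    have hx : (x : ENNReal) = ENNReal.ofReal x := by simp
    refine ⟨?_, ?_, ?_⟩
    · rw [hx]; exact ENNReal.ofReal_le_ofReal (by linarith)
    · rw [hx]; exact ENNReal.ofReal_le_ofReal (by linarith)
    · linarith [x.2]

theorem toReal_close {w : ENNReal} {r a : ℝ} (h1 : w ≤ ENNReal.ofReal (r + a))
    (h2 : ENNReal.ofReal (r - a) ≤ w) (hr : 0 ≤ r) (ha : 0 ≤ a) :
    w ≠ ⊤ ∧ |w.toReal - r| ≤ a := by
  have hw : w ≠ ⊤ := ne_top_of_le_ne_top ENNReal.ofReal_ne_top h1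
  refine ⟨hw, abs_le.2 ⟨?_, ?_⟩⟩
  · have := ENNReal.toReal_mono hw h2
    rw [ENNReal.toReal_ofReal'] at this
    linarith [le_max_left (r - a) 0]
  · have := ENNReal.toReal_mono ENNReal.ofReal_ne_top h1
    rw [ENNReal.toReal_ofReal (by linarith)] at this
    linarith

section Slice

attribute [local instance] Matrix.normedAddCommGroup Matrix.normedSpace

variable {c ρ : ℝ} {w : R2 → M3 → ENNReal} {Q : R2 → QuadraticForm ℝ M3}

/-- The essential supremum in the expansion gives, for each G, an exceptional null set of y
depending on G. Restricting to a countable dense set of G makes the null set common, and continuity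
in G of both the density and the quadratic form recovers all small G. -/
theorem expansion_two_sided (hc : 0 ≤ c) (hρ : 0 < ρ)
    (hcont : ∀ᵐ y ∂(volume.restrict Y), Continuous (w y))
    (hup : ∀ᵐ y ∂(volume.restrict Y),
      ∀ F : M3, distSqSO3 F ≤ ρ → w y F ≤ ENNReal.ofReal (c * distSqSO3 F))
    (hexp : Tendsto (fun G : M3 => essSup
        (fun y => EReal.abs ((w y (1 + G) : EReal) - ((Q y G : ℝ) : EReal)) /
          ENNReal.ofReal (frobSq G)) (volume.restrict Y)) (𝓝[≠] 0) (𝓝 0))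
    {η : ℝ} (hη : 0 < η) :
    ∃ δ, 0 < δ ∧ ∀ᵐ y ∂(volume.restrict Y), ∀ G, frobSq G < δ →
      w y (1 + G) ≤ ENNReal.ofReal (Q y G + η * frobSq G) ∧
      ENNReal.ofReal (Q y G - η * frobSq G) ≤ w y (1 + G) ∧ -(η * frobSq G) ≤ Q y G := by
  have h1 := hexp.eventually_le_const (ENNReal.ofReal_pos.2 hη)
  rw [eventually_nhdsWithin_iff] at h1
  obtain ⟨r, hr, h2⟩ := Metric.eventually_nhds_iff.1 h1
  refine ⟨r ^ 2, by positivity, ?_⟩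
  have : TopologicalSpace.SeparableSpace M3 :=
    inferInstanceAs (TopologicalSpace.SeparableSpace (Fin 3 → Fin 3 → ℝ))
  obtain ⟨D, hDc, hD⟩ := TopologicalSpace.exists_countable_dense M3
  have h3 : ∀ᵐ y ∂(volume.restrict Y), ∀ G ∈ D, G ≠ 0 → frobSq G < r ^ 2 →
      w y (1 + G) ≤ ENNReal.ofReal (Q y G + η * frobSq G) ∧
      ENNReal.ofReal (Q y G - η * frobSq G) ≤ w y (1 + G) ∧ -(η * frobSq G) ≤ Q y G := by
    rw [ae_ball_iff hDc]
    intro G _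
    by_cases hG0 : G = 0
    · exact ae_of_all _ fun y h => absurd hG0 h
    by_cases hGr : frobSq G < r ^ 2
    swap
    · exact ae_of_all _ fun y _ h => absurd h hGr
    have hdist : dist G 0 < r := by
      rw [dist_zero_right]
      exact lt_of_pow_lt_pow_left₀ 2 hr.le ((norm_sq_le_frobSq G).trans_lt hGr)
    have hpos : 0 < frobSq G := lt_of_le_of_ne (frobSq_nonneg G)
      fun h => hG0 (frobSq_eq_zero_iff.1 h.symm)
    filter_upwards [ae_le_essSup (f := fun y => EReal.abs ((w y (1 + G) : EReal) -
      ((Q y G : ℝ) : EReal)) / ENNReal.ofReal (frobSq G)) (μ := volume.restrict Y)] with y hy _ _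
    have h4 := hy.trans (h2 hdist hG0)
    rw [ENNReal.div_le_iff (ENNReal.ofReal_pos.2 hpos).ne' ENNReal.ofReal_ne_top,
      ← ENNReal.ofReal_mul hη.le] at h4
    exact toReal_close_of_abs_le h4 (by positivity)
  filter_upwards [h3, hcont, hup] with y hy hyc hyu G hG
  -- The expansion lives on a punctured neighbourhood and says nothing at G = 0; there the upper
  -- bound at the identity forces the density to vanish.
  by_cases hG0 : G = 0
  · subst hG0
    have hz : frobSq (0 : M3) = 0 := by simp [frobSq]
    have hd := distSqSO3_one_add_le 0
    rw [hz] at hd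
    have h5 := hyu _ (hd.trans hρ.le)
    rw [ENNReal.ofReal_of_nonpos (mul_nonpos_of_nonneg_of_nonpos hc hd)] at h5
    simp only [hz, QuadraticMap.map_zero]
    simpa using h5
  have ho : IsOpen ({G : M3 | frobSq G < r ^ 2} ∩ {0}ᶜ) :=
    (isOpen_lt continuous_frobSq continuous_const).inter isOpen_compl_singleton
  have hmem : G ∈ closure (({G : M3 | frobSq G < r ^ 2} ∩ {0}ᶜ) ∩ D) :=
    hD.open_subset_closure_inter ho ⟨hG, hG0⟩
  have hQ := continuous_quadraticForm (Q y)
  have hw : Continuous fun G : M3 => w y (1 + G) := hyc.comp (continuous_const.add continuous_id)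
  have hf := continuous_frobSq
  have hclosed : IsClosed {G : M3 | w y (1 + G) ≤ ENNReal.ofReal (Q y G + η * frobSq G) ∧
      ENNReal.ofReal (Q y G - η * frobSq G) ≤ w y (1 + G) ∧ -(η * frobSq G) ≤ Q y G} := by
    refine IsClosed.and ?_ (IsClosed.and ?_ ?_)
    · exact isClosed_le hw (ENNReal.continuous_ofReal.comp (hQ.add (continuous_const.mul hf)))
    · exact isClosed_le (ENNReal.continuous_ofReal.comp (hQ.sub (continuous_const.mul hf))) hw
    · exact isClosed_le (continuous_const.mul hf).neg hQ
  exact closure_minimal (fun H hH => hy H hH.2 hH.1.2 hH.1.1) hclosed hmem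

/-- Two-sided bounds at a point determine the sign, the size and the limit of the expansion. -/
theorem scaled_tendsto {w : M3 → ENNReal} {B : QuadraticForm ℝ M3} (hc : 0 ≤ c) (hρ : 0 < ρ)
    (hup : ∀ F : M3, distSqSO3 F ≤ ρ → w F ≤ ENNReal.ofReal (c * distSqSO3 F))
    (h : ∀ k : ℕ, ∃ δ, 0 < δ ∧ ∀ G, frobSq G < δ →
      w (1 + G) ≤ ENNReal.ofReal (B G + 1 / (k + 1) * frobSq G) ∧
      ENNReal.ofReal (B G - 1 / (k + 1) * frobSq G) ≤ w (1 + G) ∧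
        -(1 / (k + 1) * frobSq G) ≤ B G) (G : M3) :
    0 ≤ B G ∧ B G ≤ c * frobSq G ∧
      Tendsto (fun n : ℕ => ENNReal.ofReal ((n + 1 : ℝ) ^ 2) * w (1 + (n + 1 : ℝ)⁻¹ • G)) atTop
        (𝓝 (ENNReal.ofReal (B G))) := by
  have hinv : Tendsto (fun n : ℕ => ((n : ℝ) + 1)⁻¹) atTop (𝓝 0) := by
    simpa [one_div] using tendsto_one_div_add_atTop_nhds_zero_nat (𝕜 := ℝ)
  have hsmall : ∀ δ, 0 < δ → ∀ᶠ n : ℕ in atTop, frobSq ((n + 1 : ℝ)⁻¹ • G) < δ := fun δ hδ => by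
    have h1 : Tendsto (fun n : ℕ => frobSq ((n + 1 : ℝ)⁻¹ • G)) atTop (𝓝 0) := by
      simp_rw [frobSq_smul]
      simpa using (hinv.pow 2).mul_const (frobSq G)
    exact h1.eventually_lt_const hδ
  have hBs : ∀ n : ℕ, B ((n + 1 : ℝ)⁻¹ • G) = ((n + 1 : ℝ)⁻¹) ^ 2 * B G := fun n => by
    rw [QuadraticMap.map_smul, smul_eq_mul, sq]
  have hlim : ∀ x y : ℝ, (∀ k : ℕ, x ≤ y + 1 / (k + 1) * frobSq G) → x ≤ y := fun x y hxy => by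
    have h1 : Tendsto (fun k : ℕ => y + 1 / ((k : ℝ) + 1) * frobSq G) atTop (𝓝 (y + 0 * frobSq G)) :=
      (tendsto_one_div_add_atTop_nhds_zero_nat.mul_const _).const_add y
    rw [zero_mul, add_zero] at h1
    exact ge_of_tendsto' h1 hxy
  have h0 : 0 ≤ B G := by
    -- Both sides of the lower bound scale quadratically, so evaluating it at a small multiple of G
    -- gives B(G) ≥ -|G|²/(k+1) for every k. The upper bound is obtained in the same way.
    refine hlim _ _ fun k => ?_
    obtain ⟨δ, hδ, hk⟩ := h k
    obtain ⟨n, hn⟩ := (hsmall δ hδ).exists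
    have h1 := (hk _ hn).2.2
    rw [hBs, frobSq_smul] at h1
    have h2 : (0 : ℝ) < ((n + 1 : ℝ)⁻¹) ^ 2 := by positivity
    have h3 : 0 ≤ ((n + 1 : ℝ)⁻¹) ^ 2 * (B G + 1 / (k + 1) * frobSq G) := by linarith
    exact nonneg_of_mul_nonneg_right h3 h2
  have hBnn : ∀ n : ℕ, 0 ≤ B ((n + 1 : ℝ)⁻¹ • G) := fun n => by
    rw [hBs]; positivity
  refine ⟨h0, ?_, ?_⟩
  · refine hlim _ _ fun k => ?_
    obtain ⟨δ, hδ, hk⟩ := h k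
    obtain ⟨n, hn, hn'⟩ := ((hsmall δ hδ).and (hsmall ρ hρ)).exists
    have h1 := (hk _ hn).2.1
    have hd := distSqSO3_one_add_le ((n + 1 : ℝ)⁻¹ • G)
    have h2 := h1.trans (hup _ (hd.trans hn'.le))
    have h3 := h2.trans (ENNReal.ofReal_le_ofReal (mul_le_mul_of_nonneg_left hd hc))
    rw [ENNReal.ofReal_le_ofReal_iff (mul_nonneg hc (frobSq_nonneg _)), hBs, frobSq_smul] at h3
    have h2 : (0 : ℝ) < ((n + 1 : ℝ)⁻¹) ^ 2 := by positivity
    have h4 : ((n + 1 : ℝ)⁻¹) ^ 2 * B G ≤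
        ((n + 1 : ℝ)⁻¹) ^ 2 * (c * frobSq G + 1 / (k + 1) * frobSq G) := by linarith
    exact le_of_mul_le_mul_left h4 h2
  · have hclose : ∀ k : ℕ, ∀ᶠ n : ℕ in atTop, w (1 + (n + 1 : ℝ)⁻¹ • G) ≠ ⊤ ∧
        |(n + 1 : ℝ) ^ 2 * (w (1 + (n + 1 : ℝ)⁻¹ • G)).toReal - B G| ≤
          1 / (k + 1) * frobSq G := fun k => by
      obtain ⟨δ, hδ, hk⟩ := h k
      filter_upwards [hsmall δ hδ] with n hn
      obtain ⟨h1, h2, -⟩ := hk _ hn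
      have hf := frobSq_nonneg ((n + 1 : ℝ)⁻¹ • G)
      obtain ⟨h3, h4⟩ := toReal_close h1 h2 (hBnn n) (by positivity)
      refine ⟨h3, ?_⟩
      rw [hBs, frobSq_smul] at h4
      have hN : (0 : ℝ) < (n + 1 : ℝ) ^ 2 := by positivity
      have h5 := mul_le_mul_of_nonneg_left h4 hN.le
      rw [← abs_of_pos hN, ← abs_mul, abs_of_pos hN, mul_sub] at h5
      have e1 : (n + 1 : ℝ) ^ 2 * ((n + 1 : ℝ)⁻¹ ^ 2 * B G) = B G := by field_simp
      have e2 : (n + 1 : ℝ) ^ 2 * (1 / (k + 1) * ((n + 1 : ℝ)⁻¹ ^ 2 * frobSq G)) =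
          1 / (k + 1) * frobSq G := by field_simp
      rwa [e1, e2] at h5
    have hreal : Tendsto (fun n : ℕ => (n + 1 : ℝ) ^ 2 * (w (1 + (n + 1 : ℝ)⁻¹ • G)).toReal) atTop
        (𝓝 (B G)) := by
      rw [Metric.tendsto_nhds]
      intro η hη
      have h1 : Tendsto (fun k : ℕ => 1 / ((k : ℝ) + 1) * frobSq G) atTop (𝓝 0) := by
        simpa using tendsto_one_div_add_atTop_nhds_zero_nat.mul_const (frobSq G)
      obtain ⟨k, hk⟩ := (h1.eventually_lt_const hη).exists
      filter_upwards [hclose k] with n hn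
      exact hn.2.trans_lt hk
    refine (ENNReal.tendsto_ofReal hreal).congr' ?_
    filter_upwards [hclose 0] with n hn
    rw [ENNReal.ofReal_mul (by positivity), ENNReal.ofReal_toReal hn.1]

/-- Fubini transfers the almost-everywhere hypotheses to almost every height, and there
`scaledLimit` takes over the role of Q. The hypotheses control Q only for y in the cell, whereas
`scaledLimit` inherits periodicity from W, so its properties extend to almost every y in the plane.
-/
theorem IsEnergyDensity.ae_slice {c₁ c₂ ρ : ℝ} {W : ℝ → R2 → M3 → ENNReal}
    {Q : ℝ → R2 → QuadraticForm ℝ M3} (hW : IsEnergyDensity c₁ c₂ ρ W Q) :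
    ∀ᵐ t ∂((volume : Measure ℝ).restrict I),
      SliceDensity c₂ ρ (W t) (scaledLimit W t) ∧
      ∀ᵐ y ∂(volume.restrict Y), ∀ G, scaledLimit W t y G = Q t y G := by
  have hprod : (volume : Measure (ℝ × R2)).restrict (I ×ˢ univ) =
      (volume.restrict I).prod volume := by
    rw [Measure.volume_eq_prod, ← Measure.prod_restrict, Measure.restrict_univ]
  have h1 := hW.continuous
  have h2 := hW.frame_indifferent
  have h3 := hW.upper_bound
  rw [hprod] at h1 h2 h3
  filter_upwards [Measure.ae_ae_of_ae_prod h1, Measure.ae_ae_of_ae_prod h2,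
    Measure.ae_ae_of_ae_prod h3, hW.expansion,
    ae_restrict_mem (μ := (volume : Measure ℝ)) (s := I) measurableSet_Icc] with t hcont hfr hup hexp ht
  have hcl := clampI_of_mem ht
  have hpw : ∀ (y : R2) (k : Fin 2 → ℤ) (F : M3), W t (y + fun i => (k i : ℝ)) F = W t y F :=
    hW.periodic t ht
  have hpq : ∀ (y : R2) (k : Fin 2 → ℤ) (F : M3),
      scaledLimit W t (y + fun i => (k i : ℝ)) F = scaledLimit W t y F := fun y k F => by
    simp only [scaledLimit, hcl, hpw]
  have hts := fun k : ℕ => expansion_two_sided (Q := Q t) hW.c₂_pos.le hW.ρ_pos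
    (ae_restrict_of_ae hcont) (ae_restrict_of_ae hup) hexp (η := 1 / ((k : ℝ) + 1)) (by positivity)
  choose δ hδ hts using hts
  have hlim : ∀ᵐ y ∂(volume.restrict Y), ∀ G, 0 ≤ Q t y G ∧ Q t y G ≤ c₂ * frobSq G ∧
      scaledLimit W t y G = Q t y G := by
    filter_upwards [ae_all_iff.2 hts, ae_restrict_of_ae hup] with y hy hyu G
    obtain ⟨a1, a2, a3⟩ := scaled_tendsto (B := Q t y) hW.c₂_pos.le hW.ρ_pos hyu
      (fun k => ⟨δ k, hδ k, hy k⟩) G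
    refine ⟨a1, a2, ?_⟩
    rw [scaledLimit, hcl, a3.limsup_eq, ENNReal.toReal_ofReal a1]
  refine ⟨⟨hpq, hfr, hup, ?_, fun η hη => ?_⟩, ?_⟩
  · refine ae_of_ae_restrict_Y (fun y k => ?_) ?_
    · simp only [hpq, imp_self]
    · filter_upwards [hlim] with y hy
      exact ⟨Q t y, fun G => (hy G).2.2, fun G => ⟨(hy G).1, (hy G).2.1⟩⟩
  · obtain ⟨δ, hδ, hts⟩ := expansion_two_sided (Q := Q t) hW.c₂_pos.le hW.ρ_pos
      (ae_restrict_of_ae hcont) (ae_restrict_of_ae hup) hexp hη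
    refine ⟨δ, hδ, ae_of_ae_restrict_Y (fun y k => ?_) ?_⟩
    · simp only [hpq, hpw, imp_self]
    · filter_upwards [hts, hlim] with y hy hl G hG
      obtain ⟨b1, b2, -⟩ := hy G hG
      rw [(hl G).2.2]
      exact toReal_close b1 b2 (hl G).1 (mul_nonneg hη.le (frobSq_nonneg G))
  · filter_upwards [hlim] with y hy G using (hy G).2.2

/-- Measurability of W is assumed only for heights in the subtype `I`; clamping the height yields a
function measurable everywhere and unchanged on the plate. -/
theorem IsEnergyDensity.measurable_comp {c₁ c₂ ρ : ℝ} {W : ℝ → R2 → M3 → ENNReal}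
    {Q : ℝ → R2 → QuadraticForm ℝ M3} (hW : IsEnergyDensity c₁ c₂ ρ W Q) {α : Type*}
    [MeasurableSpace α] {f : α → ℝ} {y : α → R2} {F : α → M3} (hf : Measurable f)
    (hy : Measurable y) (hF : ∀ i j, Measurable fun a => F a i j) :
    Measurable fun a => W (clampI (f a)) (y a) (F a) := by
  have h : Measurable fun a => ((clampI (f a), y a, fun i j => F a i j) :
      I × R2 × (Fin 3 → Fin 3 → ℝ)) :=
    (continuous_clampI.measurable.comp hf).prodMk
      (hy.prodMk (measurable_pi_lambda _ fun i => measurable_pi_lambda _ fun j => hF i j))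
  exact hW.measurable.comp h

theorem IsEnergyDensity.measurable_scaledLimit {c₁ c₂ ρ : ℝ} {W : ℝ → R2 → M3 → ENNReal}
    {Q : ℝ → R2 → QuadraticForm ℝ M3} (hW : IsEnergyDensity c₁ c₂ ρ W Q) {α : Type*}
    [MeasurableSpace α] {f : α → ℝ} {y : α → R2} {F : α → M3} (hf : Measurable f)
    (hy : Measurable y) (hF : ∀ i j, Measurable fun a => F a i j) :
    Measurable fun a => scaledLimit W (f a) (y a) (F a) := by
  refine (Measurable.limsup fun n => ?_).ennreal_toReal
  refine (hW.measurable_comp hf hy fun i j => ?_).const_mul _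
  simp only [Matrix.add_apply, Matrix.smul_apply, smul_eq_mul]
  exact (hF i j).const_mul _ |>.const_add _

end Slice

end BendingPlate

/-! ### Uniform energy estimates near rotations at a fixed height -/

namespace BendingPlate

section SliceEstimates

attribute [local instance] Matrix.normedAddCommGroup Matrix.normedSpace

variable {c ρ : ℝ} {w : R2 → M3 → ENNReal} {q : R2 → M3 → ℝ}

/-- Reduction of `R (Id + S + h G + E)` to `Id + h G'` by frame indifference. -/
theorem exists_strain_of_frame {w : M3 → ENNReal}
    (hfr : ∀ (F : M3) (R : Matrix.specialOrthogonalGroup (Fin 3) ℝ), w ((R : M3) * F) = w F)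
    {R S G E : M3} {h τ : ℝ} (hh : 0 < h) (hR : R ∈ Matrix.specialOrthogonalGroup (Fin 3) ℝ)
    (hS : Sᵀ = -S)
    (hE : 9 * (‖S‖ ^ 2 + h * (‖S‖ * ‖G‖) + (1 + ‖S‖) * ‖E‖) ≤ τ * h) :
    ∃ G' : M3, w (R * (1 + S + h • G + E)) = w (1 + h • G') ∧ ‖G' - G‖ ≤ τ := by
  obtain ⟨C, hC, E', hCE, hE'⟩ := exists_rotation_mul_eq S G E h hS
  rw [abs_of_pos hh] at hE'
  refine ⟨G + h⁻¹ • E', ?_, ?_⟩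
  · rw [hfr _ ⟨R, hR⟩, ← hfr _ ⟨C, hC⟩, hCE, smul_add, smul_smul, mul_inv_cancel₀ hh.ne', one_smul,
      add_assoc]
  · rw [add_sub_cancel_left, norm_smul, Real.norm_eq_abs, abs_of_pos (inv_pos.2 hh),
      inv_mul_le_iff₀ hh, mul_comm]
    exact hE'.trans hE

/-- The null set of y is chosen before h, R, S, G and E, which is needed because these vary with x
when y = x/ε is inserted. Two errors add up: the expansion at Id + hG', and the replacement of G' by
G in the quadratic form; each receives η/2. -/
theorem SliceDensity.ae_close (hs : SliceDensity c ρ w q) (hc : 0 ≤ c) {a η : ℝ} (ha : 0 ≤ a)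
    (hη : 0 < η) : ∃ τ, 0 < τ ∧ ∀ᵐ y, ∀ (h : ℝ) (R S G E : M3), 0 < h → h ≤ τ →
      R ∈ Matrix.specialOrthogonalGroup (Fin 3) ℝ → Sᵀ = -S → ‖G‖ ≤ a →
      9 * (‖S‖ ^ 2 + h * (‖S‖ * ‖G‖) + (1 + ‖S‖) * ‖E‖) ≤ τ * h →
      w y (R * (1 + S + h • G + E)) ≠ ⊤ ∧
      |(w y (R * (1 + S + h • G + E))).toReal / h ^ 2 - q y G| ≤ η := by
  set K := 9 * (a + 1) ^ 2 with hK
  have hK0 : 0 < K := by positivity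
  obtain ⟨δ, hδ, hexp⟩ := hs.expansion (η / (2 * K)) (by positivity)
  set L := 36 * c * (a + 1) with hL
  have hL0 : 0 ≤ L := by positivity
  -- The condition Lτ ≤ η/2 pays for replacing G' by G; τK < δ together with h² ≤ τ keeps hG' within
  -- the range of the expansion.
  obtain ⟨τ, hτ, hτ1, hτL, hτδ⟩ : ∃ τ, 0 < τ ∧ τ ≤ 1 ∧ L * τ ≤ η / 2 ∧ τ * K < δ := by
    refine ⟨min 1 (min (η / (2 * (L + 1))) (δ / (2 * K))), by positivity, min_le_left _ _, ?_, ?_⟩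
    · calc _ ≤ (L + 1) * (η / (2 * (L + 1))) := by
            gcongr
            · linarith
            · exact (min_le_right _ _).trans (min_le_left _ _)
        _ = η / 2 := by field_simp
    · calc _ ≤ δ / (2 * K) * K := by
            gcongr
            exact (min_le_right _ _).trans (min_le_right _ _)
        _ = δ / 2 := by field_simp
        _ < δ := by linarith
  refine ⟨τ, hτ, ?_⟩
  filter_upwards [hexp, hs.frame, hs.quad] with y hy hfr hq h R S G E hh hhτ hR hS hG hE
  obtain ⟨B, hqB, hB⟩ := hq
  obtain ⟨G', hwG, hGG⟩ := exists_strain_of_frame hfr hh hR hS hE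
  have hG' : ‖G'‖ ≤ a + 1 := by
    calc ‖G'‖ = ‖G + (G' - G)‖ := by abel_nf
      _ ≤ ‖G‖ + ‖G' - G‖ := norm_add_le _ _
      _ ≤ _ := by linarith
  have hfG : frobSq G' ≤ K := (frobSq_le_norm_sq G').trans (by rw [hK]; gcongr)
  have hsm : frobSq (h • G') < δ := by
    rw [frobSq_smul]
    calc h ^ 2 * frobSq G' ≤ τ * K := by
          have : h ^ 2 ≤ τ := by nlinarith
          have := frobSq_nonneg G'
          gcongr
      _ < δ := hτδ
  obtain ⟨h1, h2⟩ := hy _ hsm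
  rw [hwG]
  refine ⟨h1, ?_⟩
  have e1 : q y (h • G') = h ^ 2 * q y G' := by
    rw [hqB, hqB, QuadraticMap.map_smul, smul_eq_mul, sq]
  rw [e1, frobSq_smul] at h2
  have h3 : |(w y (1 + h • G')).toReal / h ^ 2 - q y G'| ≤ η / 2 := by
    have e2 : (w y (1 + h • G')).toReal / h ^ 2 - q y G' =
        ((w y (1 + h • G')).toReal - h ^ 2 * q y G') / h ^ 2 := by field_simp
    rw [e2, abs_div, abs_of_pos (show (0 : ℝ) < h ^ 2 by positivity), div_le_iff₀ (by positivity)]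
    refine h2.trans ?_
    calc η / (2 * K) * (h ^ 2 * frobSq G') ≤ η / (2 * K) * (h ^ 2 * K) := by gcongr
      _ = _ := by field_simp
  have h4 : |q y G' - q y G| ≤ η / 2 := by
    rw [hqB, hqB]
    refine (quadraticForm_sub_le B (fun G => (hB G).1) (fun G => (hB G).2) G' G hG'
      (by linarith)).trans ?_
    exact (mul_le_mul_of_nonneg_left hGG hL0).trans hτL
  calc _ = |((w y (1 + h • G')).toReal / h ^ 2 - q y G') + (q y G' - q y G)| := by ring_nf
    _ ≤ _ := (abs_add_le _ _).trans (by linarith)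

/-- This crude bound of order h² dominates the slice energies. Its constants do not depend on the
slice, in contrast to the threshold τ of `SliceDensity.ae_close`. -/
theorem SliceDensity.ae_le (hs : SliceDensity c ρ w q) (hc : 0 ≤ c) (a : ℝ) :
    ∀ᵐ y, ∀ (h : ℝ) (R S G E : M3), 0 < h → h ^ 2 * (9 * (a + 1) ^ 2) ≤ ρ →
      R ∈ Matrix.specialOrthogonalGroup (Fin 3) ℝ → Sᵀ = -S → ‖G‖ ≤ a →
      9 * (‖S‖ ^ 2 + h * (‖S‖ * ‖G‖) + (1 + ‖S‖) * ‖E‖) ≤ 1 * h →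
      w y (R * (1 + S + h • G + E)) ≤ ENNReal.ofReal (c * (h ^ 2 * (9 * (a + 1) ^ 2))) := by
  filter_upwards [hs.frame, hs.upper] with y hfr hup h R S G E hh hhρ hR hS hG hE
  obtain ⟨G', hwG, hGG⟩ := exists_strain_of_frame hfr hh hR hS hE
  have hG' : ‖G'‖ ≤ a + 1 := by
    calc ‖G'‖ = ‖G + (G' - G)‖ := by abel_nf
      _ ≤ ‖G‖ + ‖G' - G‖ := norm_add_le _ _
      _ ≤ _ := by linarith
  have hd : distSqSO3 (1 + h • G') ≤ h ^ 2 * (9 * (a + 1) ^ 2) := by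
    refine (distSqSO3_one_add_le _).trans ?_
    rw [frobSq_smul]
    gcongr
    exact (frobSq_le_norm_sq G').trans (by gcongr)
  rw [hwG]
  exact (hup _ (hd.trans hhρ)).trans (ENNReal.ofReal_le_ofReal (by gcongr))

/-- The quadratic expansion only depends on the symmetric part. -/
theorem SliceDensity.ae_eq_of_symm (hs : SliceDensity c ρ w q) (hc : 0 ≤ c) :
    ∀ᵐ y, ∀ A B : M3, A + Aᵀ = B + Bᵀ → q y A = q y B := by
  -- Norm bounds and accuracies run through integers, so that one null set of y serves all pairs A,
  -- B.
  choose τ hτ hτc using fun p : ℕ × ℕ => hs.ae_close hc (a := p.1) (η := 1 / ((p.2 : ℝ) + 1))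
    (by positivity) (by positivity)
  filter_upwards [ae_all_iff.2 hτc] with y hy A B hAB
  obtain ⟨m, hm⟩ := exists_nat_ge (max ‖A‖ ‖B‖)
  have hA := (le_max_left _ _).trans hm
  have hB := (le_max_right _ _).trans hm
  have hS : (A - B)ᵀ = -(A - B) := by
    rw [Matrix.transpose_sub, neg_sub, sub_eq_sub_iff_add_eq_add, add_comm, hAB, add_comm]
  have key : ∀ k : ℕ, |q y A - q y B| ≤ 2 * (1 / ((k : ℝ) + 1)) := fun k => by
    set D := ‖A - B‖
    set K := 9 * (D ^ 2 + D * m) with hK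
    have hK0 : 0 ≤ K := by positivity
    have hτk := hτ (m, k)
    -- K measures the cost of treating h(A - B) as the skew part; this h makes Kh ≤ τ.
    set h := τ (m, k) / (K + 1)
    have hh : 0 < h := by positivity
    have hK1 : (K + 1) * h = τ (m, k) := by simp only [h]; field_simp
    have hhτ : h ≤ τ (m, k) := by nlinarith
    have h1 := (hy (m, k) h 1 0 A 0 hh hhτ (one_mem _) (by simp) hA (by
      simp; positivity)).2
    have h2 := (hy (m, k) h 1 (h • (A - B)) B 0 hh hhτ (one_mem _) (by
      rw [Matrix.transpose_smul, hS, smul_neg]) hB (by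
      have : h * (h * (D * ‖B‖)) ≤ h * (h * (D * m)) := by gcongr
      have h3 : ‖h • (A - B)‖ = h * D := by rw [norm_smul, Real.norm_eq_abs, abs_of_pos hh]
      rw [h3, norm_zero, mul_zero, add_zero]
      calc 9 * ((h * D) ^ 2 + h * (h * D * ‖B‖)) ≤ 9 * ((h * D) ^ 2 + h * (h * D * m)) := by gcongr
        _ = (K * h) * h := by rw [hK]; ring
        _ ≤ τ (m, k) * h := by
          gcongr
          nlinarith)).2
    -- The same matrix is read in two ways: as strain A without skew part, and as strain B with skew
    -- part h(A - B). Its energy divided by h² is therefore close to both q(A) and q(B).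
    have e : (1 : M3) + 0 + h • A + 0 = 1 + h • (A - B) + h • B + 0 := by
      rw [smul_sub]; abel
    rw [e] at h1
    rw [abs_le] at *
    constructor <;> linarith [h1.1, h1.2, h2.1, h2.2]
  have hlim : Tendsto (fun k : ℕ => 2 * (1 / ((k : ℝ) + 1))) atTop (𝓝 (2 * 0)) :=
    tendsto_one_div_add_atTop_nhds_zero_nat.const_mul 2
  rw [mul_zero] at hlim
  have := ge_of_tendsto' hlim key
  exact sub_eq_zero.1 (abs_nonpos_iff.1 this)

end SliceEstimates

end BendingPlate

namespace BendingPlate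

/-! ### Two-scale convergence of oscillating integrals -/

theorem Y_eq_fundamentalDomain : Y = ZSpan.fundamentalDomain (Pi.basisFun ℝ (Fin 2)) := by
  ext y
  simp [Y, ZSpan.mem_fundamentalDomain]

theorem volume_Y : volume Y = 1 := by
  have : Y = Set.pi univ fun _ : Fin 2 => Ico (0 : ℝ) 1 := by ext y; simp [Y]
  rw [this, Real.volume_pi_Ico]
  simp

theorem norm_le_one_of_mem_Y {y : R2} (hy : y ∈ Y) : ‖y‖ ≤ 1 :=
  (pi_norm_le_iff_of_nonneg zero_le_one).2 fun i => by
    rw [Real.norm_eq_abs, abs_of_nonneg (hy i).1]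
    exact (hy i).2.le

/-- The cell and its translate are both fundamental domains of the integer lattice, and a periodic
function has the same integral over either. -/
theorem setIntegral_Y_add {f : R2 → ℝ} (hf : PeriodicY f) (a : R2) :
    ∫ z in Y, f (a + z) = ∫ z in Y, f z := by
  have hY : IsAddFundamentalDomain (Submodule.span ℤ (range (Pi.basisFun ℝ (Fin 2)))) Y
      (volume : Measure R2) := by
    rw [Y_eq_fundamentalDomain]
    exact ZSpan.isAddFundamentalDomain _ _
  have hvadd : VAddInvariantMeasure (Submodule.span ℤ (range (Pi.basisFun ℝ (Fin 2)))) R2 volume :=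
    ⟨fun g s _ => measure_preimage_add volume (g : R2) s⟩
  have hY' : IsAddFundamentalDomain (Submodule.span ℤ (range (Pi.basisFun ℝ (Fin 2))))
      ((fun z => a + z) '' Y) (volume : Measure R2) := by
    refine hY.image_of_equiv (Equiv.addLeft a)
      (measurePreserving_add_left volume (-a)).quasiMeasurePreserving (Equiv.refl _) fun g x => ?_
    change a + ((g : R2) + x) = (g : R2) + (a + x)
    abel
  have hinv : ∀ (g : Submodule.span ℤ (range (Pi.basisFun ℝ (Fin 2)))) (x : R2),
      f (g +ᵥ x) = f x := by
    rintro ⟨g, hg⟩ x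
    obtain ⟨k, rfl⟩ := (Submodule.mem_span_range_iff_exists_fun ℤ).1 hg
    have : (∑ i, k i • Pi.basisFun ℝ (Fin 2) i) = fun i => (k i : ℝ) := by
      ext i
      simp [Finset.sum_apply, Pi.single_apply]
    change f ((∑ i, k i • Pi.basisFun ℝ (Fin 2) i) + x) = f x
    rw [this, add_comm]
    exact hf x k
  rw [← hY'.setIntegral_eq hY hinv]
  exact ((measurePreserving_add_left volume a).setIntegral_image_emb
    (measurableEmbedding_addLeft a) f Y).symm

/-- Translations are continuous in `L¹`. -/
theorem tendsto_integral_norm_translate_sub {E : Type*} [NormedAddCommGroup E] [NormedSpace ℝ E]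
    {m : R2 → E} (hm : Integrable m) :
    Tendsto (fun v : R2 => ∫ x, ‖m (x + v) - m x‖) (𝓝 0) (𝓝 0) := by
  rw [Metric.tendsto_nhds]
  intro η hη
  -- For a continuous compactly supported approximation g the claim follows by dominated
  -- convergence. The errors of m and of its translate are equal by translation invariance.
  obtain ⟨g, hgc, hgm, hg, hgi⟩ := hm.exists_hasCompactSupport_integral_sub_le
    (show 0 < η / 4 by positivity)
  have hlim : Tendsto (fun v : R2 => ∫ x, ‖g (x + v) - g x‖) (𝓝 0) (𝓝 0) := by
    obtain ⟨C, hC⟩ := hg.bounded_above_of_compact_support hgc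
    have hK : IsCompact (Metric.cthickening 1 (tsupport g)) := hgc.isCompact.cthickening
    have h := tendsto_integral_filter_of_dominated_convergence (μ := (volume : Measure R2))
      (l := 𝓝 (0 : R2)) (F := fun v x => ‖g (x + v) - g x‖) (f := fun _ => (0 : ℝ))
      ((Metric.cthickening 1 (tsupport g)).indicator fun _ => 2 * C) ?_ ?_ ?_ ?_
    · simpa using h
    · exact Eventually.of_forall fun v =>
        ((hg.comp (continuous_id.add continuous_const)).sub hg).norm.aestronglyMeasurable
    · filter_upwards [Metric.ball_mem_nhds (0 : R2) one_pos] with v hv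
      refine ae_of_all _ fun x => ?_
      rw [norm_norm]
      have hv1 : ‖v‖ < 1 := by simpa using hv
      by_cases hx : x ∈ Metric.cthickening 1 (tsupport g)
      · rw [indicator_of_mem hx]
        exact (norm_sub_le _ _).trans (by linarith [hC (x + v), hC x])
      · have h1 : x ∉ tsupport g := fun h => hx (Metric.self_subset_cthickening _ h)
        have h2 : x + v ∉ tsupport g := fun h => hx
          (Metric.mem_cthickening_of_dist_le x (x + v) 1 _ h (by
            rw [dist_eq_norm]; simpa using hv1.le))
        rw [indicator_of_notMem hx, image_eq_zero_of_notMem_tsupport h1,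
          image_eq_zero_of_notMem_tsupport h2]
        simp
    · exact (integrable_indicator_iff hK.isClosed.measurableSet).2
        (integrableOn_const hK.measure_lt_top.ne)
    · refine ae_of_all _ fun x => ?_
      have : Continuous fun v : R2 => ‖g (x + v) - g x‖ :=
        ((hg.comp (continuous_const.add continuous_id)).sub continuous_const).norm
      simpa using this.tendsto 0
  filter_upwards [hlim.eventually_lt_const (show 0 < η / 4 by positivity)] with v hv
  have hi1 : Integrable fun x => ‖m (x + v) - g (x + v)‖ := ((hm.sub hgi).comp_add_right v).norm
  have hi2 : Integrable fun x => ‖m x - g x‖ := (hm.sub hgi).norm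
  have hi3 : Integrable fun x => ‖g (x + v) - g x‖ := ((hgi.comp_add_right v).sub hgi).norm
  have hi4 : Integrable fun x => ‖m (x + v) - m x‖ := ((hm.comp_add_right v).sub hm).norm
  have e1 : ∫ x, ‖m (x + v) - g (x + v)‖ = ∫ x, ‖m x - g x‖ :=
    integral_add_right_eq_self (fun x => ‖m x - g x‖) v
  have hle : ∫ x, ‖m (x + v) - m x‖ ≤
      ∫ x, (‖m (x + v) - g (x + v)‖ + ‖m x - g x‖ + ‖g (x + v) - g x‖) := by
    refine integral_mono hi4 ((hi1.add hi2).add hi3) fun x => ?_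
    calc ‖m (x + v) - m x‖
        = ‖(m (x + v) - g (x + v)) - (m x - g x) + (g (x + v) - g x)‖ := by abel_nf
      _ ≤ _ := (norm_add_le _ _).trans (add_le_add_left (norm_sub_le _ _) _)
  have hi12 : Integrable fun x => ‖m (x + v) - g (x + v)‖ + ‖m x - g x‖ := hi1.add hi2
  rw [integral_add hi12 hi3, integral_add hi1 hi2, e1] at hle
  have h0 : 0 ≤ ∫ x, ‖m (x + v) - m x‖ := integral_nonneg fun _ => norm_nonneg _
  rw [Real.dist_eq, sub_zero, abs_of_nonneg h0]
  linarith

/-- No continuity in the fast variable is needed: F may be merely measurable in y. In the slow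
variable, F is controlled by a Lipschitz part and by increments of an integrable map m, whose
translates converge in L¹. -/
theorem tendsto_integral_two_scale {E : Type*} [NormedAddCommGroup E] [NormedSpace ℝ E]
    {m : R2 → E} (hm : Integrable m) {F : R2 → R2 → ℝ}
    (hF : Measurable fun p : R2 × R2 => F p.1 p.2) (hper : ∀ x, PeriodicY (F x)) {r C L : ℝ}
    (hL : 0 ≤ L)
    (hsupp : ∀ x ∉ Metric.closedBall (0 : R2) r, ∀ y, F x y = 0)
    (hC : ∀ᵐ y, ∀ x, |F x y| ≤ C)
    (hlip : ∀ᵐ y, ∀ x x', |F x y - F x' y| ≤ ‖m x - m x'‖ + L * ‖x - x'‖) :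
    Tendsto (fun ε : ℝ => ∫ x, F x (ε⁻¹ • x)) (𝓝[>] 0) (𝓝 (∫ x, ∫ y in Y, F x y)) := by
  set B := Metric.closedBall (0 : R2) r
  set B' := Metric.closedBall (0 : R2) (r + 1)
  have hqmp : ∀ (ε : ℝ) (z : R2), 0 < ε →
      Measure.QuasiMeasurePreserving (fun x : R2 => ε⁻¹ • x + z) volume volume := fun ε z hε => by
    have h1 : Measure.QuasiMeasurePreserving (fun x : R2 => ε⁻¹ • x) volume volume :=
      Measure.quasiMeasurePreserving_smul volume (inv_ne_zero hε.ne')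
    exact (measurePreserving_add_right volume z).quasiMeasurePreserving.comp h1
  have hB : volume B ≠ ⊤ := measure_closedBall_lt_top.ne
  have hfin : IsFiniteMeasure (volume.restrict B) := ⟨by simpa using hB.lt_top⟩
  have hfinY : IsFiniteMeasure (volume.restrict Y) := ⟨by simp [volume_Y]⟩
  have hint : ∀ (g : R2 → R2), Measurable g → (∀ᵐ x, ∀ x', |F x' (g x)| ≤ C) →
      Integrable fun x => F x (g x) := fun g hg hgC => by
    have hon : IntegrableOn (fun x => F x (g x)) B :=
      Integrable.of_bound (hF.comp (measurable_id.prodMk hg)).aestronglyMeasurable C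
        (ae_restrict_of_ae (by filter_upwards [hgC] with x hx using hx x))
    exact (integrableOn_iff_integrable_of_support_subset fun x hx => by
      by_contra h
      exact hx (hsupp x h _)).1 hon
  have hms : ∀ (ε : ℝ) (z : R2), Measurable fun x : R2 => ε⁻¹ • x + z := fun ε z => by fun_prop
  rw [Metric.tendsto_nhds]
  intro η hη
  obtain ⟨δ, hδ, hm'⟩ := Metric.eventually_nhds_iff.1
    ((tendsto_integral_norm_translate_sub hm).eventually_lt_const (show 0 < η / 4 by positivity))
  have hLε : Tendsto (fun ε : ℝ => L * ε * volume.real B') (𝓝[>] 0) (𝓝 0) := by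
    have : Continuous fun ε : ℝ => L * ε * volume.real B' := by fun_prop
    simpa using (this.tendsto 0).mono_left nhdsWithin_le_nhds
  filter_upwards [self_mem_nhdsWithin, hLε.eventually_lt_const (show 0 < η / 4 by positivity),
    mem_nhdsWithin_of_mem_nhds (Iio_mem_nhds hδ), mem_nhdsWithin_of_mem_nhds (Iio_mem_nhds one_pos)]
    with ε hε hε1 hεδ hε2
  rw [mem_Ioi] at hε
  rw [mem_Iio] at hεδ hε2
  have hCz : ∀ z : R2, ∀ᵐ x, ∀ x', |F x' (ε⁻¹ • x + z)| ≤ C := fun z => (hqmp ε z hε).ae hC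
  have hlipz : ∀ z : R2, ∀ᵐ x, ∀ x' x'', |F x' (ε⁻¹ • x + z) - F x'' (ε⁻¹ • x + z)| ≤
      ‖m x' - m x''‖ + L * ‖x' - x''‖ := fun z => (hqmp ε z hε).ae hlip
  set A := ∫ x, F x (ε⁻¹ • x) with hA
  -- The substitution x ↦ x + εz shifts the fast variable by exactly z. Undoing the shift in the
  -- slow variable alone costs an L¹ translation error of m plus a term of order ε, uniformly for z
  -- in the cell.
  have hshift : ∀ z ∈ Y, |A - ∫ x in B, F x (ε⁻¹ • x + z)| ≤ η / 2 := fun z hz => by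
    have hz1 := norm_le_one_of_mem_Y hz
    have hεz : ‖ε • z‖ ≤ ε := by
      rw [norm_smul, Real.norm_eq_abs, abs_of_pos hε]
      exact mul_le_of_le_one_right hε.le hz1
    have e1 : A = ∫ x, F (x + ε • z) (ε⁻¹ • x + z) := by
      rw [hA, ← integral_add_right_eq_self _ (ε • z)]
      simp only [smul_add, smul_smul, inv_mul_cancel₀ hε.ne', one_smul]
    have e2 : ∫ x in B, F x (ε⁻¹ • x + z) = ∫ x, F x (ε⁻¹ • x + z) :=
      setIntegral_eq_integral_of_forall_compl_eq_zero fun x hx => hsupp x hx _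
    have i1 : Integrable fun x => F (x + ε • z) (ε⁻¹ • x + z) := by
      have := (hint (fun x => ε⁻¹ • x + 0) (hms _ _) (hCz 0)).comp_add_right (ε • z)
      simpa only [smul_add, smul_smul, inv_mul_cancel₀ hε.ne', one_smul, add_zero] using this
    have i2 := hint (fun x => ε⁻¹ • x + z) (hms _ _) (hCz z)
    have i3 : Integrable fun x => ‖m (x + ε • z) - m x‖ := ((hm.comp_add_right _).sub hm).norm
    have i4 : Integrable (B'.indicator fun _ : R2 => L * ε) :=
      (integrable_indicator_iff measurableSet_closedBall).2
        (integrableOn_const measure_closedBall_lt_top.ne)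
    rw [e2, e1, ← integral_sub i1 i2, ← Real.norm_eq_abs]
    have hle : ∀ᵐ x, ‖F (x + ε • z) (ε⁻¹ • x + z) - F x (ε⁻¹ • x + z)‖ ≤
        ‖m (x + ε • z) - m x‖ + B'.indicator (fun _ : R2 => L * ε) x := by
      filter_upwards [hlipz z] with x hx
      by_cases hxB : x ∈ B'
      · rw [indicator_of_mem hxB]
        refine (hx _ _).trans ?_
        rw [add_sub_cancel_left]
        gcongr
      · rw [mem_closedBall_zero_iff, not_le] at hxB
        have h1 : x ∉ B := fun h => by
          rw [mem_closedBall_zero_iff] at h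
          linarith
        have h2 : x + ε • z ∉ B := fun h => by
          rw [mem_closedBall_zero_iff] at h
          have : ‖x‖ ≤ ‖x + ε • z‖ + ‖ε • z‖ := by
            simpa using norm_sub_le (x + ε • z) (ε • z)
          linarith
        rw [hsupp x h1, hsupp _ h2, sub_zero, norm_zero]
        refine add_nonneg (norm_nonneg _) (indicator_nonneg (fun _ _ => by positivity) _)
    refine (norm_integral_le_of_norm_le (i3.add i4) hle).trans ?_
    have e3 : ∫ x, ((fun x => ‖m (x + ε • z) - m x‖) + B'.indicator fun _ : R2 => L * ε) x =
        (∫ x, ‖m (x + ε • z) - m x‖) + L * ε * volume.real B' := by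
      simp only [Pi.add_apply]
      rw [integral_add i3 i4, integral_indicator_const _ measurableSet_closedBall, smul_eq_mul,
        mul_comm (volume.real B')]
    refine e3.le.trans ?_
    have := hm' (y := ε • z) (by rw [dist_zero_right]; linarith)
    linarith
  have hjm : Measurable fun p : R2 × R2 => F p.1 (ε⁻¹ • p.1 + p.2) := by
    have h1 : Measurable fun p : R2 × R2 => ε⁻¹ • p.1 + p.2 := by fun_prop
    exact hF.comp (measurable_fst.prodMk h1)
  have hjoint : Integrable (fun p : R2 × R2 => F p.1 (ε⁻¹ • p.1 + p.2))
      ((volume.restrict B).prod (volume.restrict Y)) := by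
    refine Integrable.of_bound hjm.aestronglyMeasurable C ?_
    refine (Measure.ae_prod_iff_ae_ae (measurableSet_le hjm.norm measurable_const)).2 ?_
    refine ae_of_all _ fun x => ae_restrict_of_ae ?_
    filter_upwards [(measurePreserving_add_left (volume : Measure R2)
      (ε⁻¹ • x)).quasiMeasurePreserving.ae hC] with z hz using hz x
  -- After averaging over z and exchanging the integrals, periodicity removes the base point x/ε, so
  -- the average does not depend on ε at all.
  have hswap : ∫ z in Y, ∫ x in B, F x (ε⁻¹ • x + z) = ∫ x, ∫ y in Y, F x y := by
    rw [← integral_integral_swap hjoint]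
    simp_rw [setIntegral_Y_add (hper _)]
    exact setIntegral_eq_integral_of_forall_compl_eq_zero fun x hx => by simp [hsupp x hx]
  have hiz : IntegrableOn (fun z => ∫ x in B, F x (ε⁻¹ • x + z)) Y := hjoint.integral_prod_right
  have hfinal : A - ∫ x, ∫ y in Y, F x y = ∫ z in Y, (A - ∫ x in B, F x (ε⁻¹ • x + z)) := by
    rw [integral_sub (integrable_const A) hiz, hswap, setIntegral_const,
      measureReal_def, volume_Y]
    simp
  rw [Real.dist_eq, hfinal, ← Real.norm_eq_abs]
  have := norm_setIntegral_le_of_norm_le_const (μ := volume) (s := Y)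
    (f := fun z => A - ∫ x in B, F x (ε⁻¹ • x + z)) (by simp [volume_Y]) hshift
  rw [measureReal_def, volume_Y] at this
  simp only [ENNReal.toReal_one, mul_one] at this
  linarith

end BendingPlate

namespace BendingPlate

/-! ### Correctors -/

variable {S : Set R2}

theorem IsThickCorrector.continuousOn {f : R2 → ℝ → R2 → ℝ} (hf : IsThickCorrector S f) :
    ContinuousOn (fun p : R2 × ℝ × R2 => f p.1 p.2.1 p.2.2) (univ ×ˢ (I ×ˢ univ)) :=
  hf.1.continuousOn

theorem exists_shift_mem_Y (y : R2) : ∃ k : Fin 2 → ℤ, (y + fun i => (k i : ℝ)) ∈ Y := by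
  refine ⟨fun i => -⌊y i⌋, fun i => ?_⟩
  simp only [Pi.add_apply, Int.cast_neg]
  exact ⟨by linarith [Int.floor_le (y i)], by linarith [Int.lt_floor_add_one (y i)]⟩

theorem IsThickCorrector.exists_bound {f : R2 → ℝ → R2 → ℝ} (hf : IsThickCorrector S f) :
    ∃ C, 0 ≤ C ∧ ∀ x, ∀ t ∈ I, ∀ y, |f x t y| ≤ C := by
  obtain ⟨hfs, hper, K, -, hK, hK0⟩ := hf
  have hc : IsCompact (K ×ˢ (I ×ˢ Metric.closedBall (0 : R2) 1)) :=
    hK.prod (isCompact_Icc.prod (isCompact_closedBall _ _))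
  obtain ⟨C, hC⟩ := hc.exists_bound_of_continuousOn (hfs.continuousOn.mono
    (prod_mono (subset_univ _) (prod_mono subset_rfl (subset_univ _))))
  refine ⟨|C|, abs_nonneg _, fun x t ht y => ?_⟩
  by_cases hx : x ∈ K
  · obtain ⟨k, hk⟩ := exists_shift_mem_Y y
    rw [← hper x t ht y k]
    exact (hC (x, t, _) ⟨hx, ht, mem_closedBall_zero_iff.2 (norm_le_one_of_mem_Y hk)⟩).trans
      (le_abs_self C)
  · rw [hK0 x hx t ht, abs_zero]
    exact abs_nonneg _

/-- Points at distance at least 1 are handled by the sup bound. Nearby points are moved by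
periodicity into a fixed compact set, where smoothness gives a Lipschitz constant. -/
theorem IsThickCorrector.exists_lipschitz {f : R2 → ℝ → R2 → ℝ} (hf : IsThickCorrector S f) :
    ∃ L, 0 ≤ L ∧ ∀ x x', ∀ t ∈ I, ∀ y y',
      |f x t y - f x' t y'| ≤ L * (‖x - x'‖ + ‖y - y'‖) := by
  obtain ⟨C, hC0, hC⟩ := hf.exists_bound
  obtain ⟨hfs, hper, K, -, hK, hK0⟩ := hf
  obtain ⟨r, hr⟩ := hK.isBounded.subset_closedBall (0 : R2)
  have hconv : Convex ℝ ((univ : Set R2) ×ˢ (I ×ˢ (univ : Set R2))) :=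
    convex_univ.prod ((convex_Icc _ _).prod convex_univ)
  have hc : IsCompact (Metric.closedBall (0 : R2) (r + 1) ×ˢ (I ×ˢ Metric.closedBall (0 : R2) 2)) :=
    (isCompact_closedBall _ _).prod (isCompact_Icc.prod (isCompact_closedBall _ _))
  have hloc : LocallyLipschitzOn ((univ : Set R2) ×ˢ (I ×ˢ (univ : Set R2)))
      (fun p : R2 × ℝ × R2 => f p.1 p.2.1 p.2.2) := fun p hp => by
    obtain ⟨L, t, ht, h⟩ := ((hfs p hp).of_le (by exact_mod_cast le_top)).exists_lipschitzOnWith hconv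
    exact ⟨L, t, ht, h⟩
  obtain ⟨L, hL⟩ := (hloc.mono (prod_mono (subset_univ _)
    (prod_mono subset_rfl (subset_univ _)))).exists_lipschitzOnWith_of_compact hc
  refine ⟨2 * C + L, by positivity, fun x x' t ht y y' => ?_⟩
  set D := ‖x - x'‖ + ‖y - y'‖ with hD
  have hD0 : 0 ≤ D := by positivity
  have hx0 : 0 ≤ ‖x - x'‖ := norm_nonneg _
  have hy0 : 0 ≤ ‖y - y'‖ := norm_nonneg _
  have hLD : 0 ≤ (L : ℝ) * D := by positivity
  have hCD : 0 ≤ C * D := by positivity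
  by_cases h1 : 1 ≤ D
  · have h2 := (abs_sub (f x t y) (f x' t y')).trans (add_le_add (hC x t ht y) (hC x' t ht y'))
    nlinarith
  rw [not_le] at h1
  by_cases hxx : x ∉ K ∧ x' ∉ K
  · rw [hK0 x hxx.1 t ht, hK0 x' hxx.2 t ht, sub_self, abs_zero]
    positivity
  have hball : x ∈ Metric.closedBall (0 : R2) (r + 1) ∧ x' ∈ Metric.closedBall (0 : R2) (r + 1) := by
    simp only [mem_closedBall_zero_iff]
    have h3 : ‖x‖ ≤ ‖x'‖ + ‖x - x'‖ := by
      simpa using norm_add_le x' (x - x')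
    have h4 : ‖x'‖ ≤ ‖x‖ + ‖x - x'‖ := by
      simpa using norm_sub_le x (x - x')
    by_cases hx : x ∈ K
    · have := mem_closedBall_zero_iff.1 (hr hx)
      constructor <;> linarith
    · have hx' : x' ∈ K := by
        by_contra h
        exact hxx ⟨hx, h⟩
      have := mem_closedBall_zero_iff.1 (hr hx')
      constructor <;> linarith
  obtain ⟨k, hk⟩ := exists_shift_mem_Y y
  have hk1 := norm_le_one_of_mem_Y hk
  set v : R2 := fun i => (k i : ℝ)
  have hyy : y + v - (y' + v) = y - y' := by abel
  have hk2 : ‖y' + v‖ ≤ 2 := by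
    have := norm_sub_le (y + v) (y + v - (y' + v))
    rw [sub_sub_cancel, hyy] at this
    linarith
  rw [← hper x t ht y k, ← hper x' t ht y' k]
  have := hL.dist_le_mul (x, t, y + v) ⟨hball.1, ht, mem_closedBall_zero_iff.2 (by linarith)⟩
    (x', t, y' + v) ⟨hball.2, ht, mem_closedBall_zero_iff.2 hk2⟩
  rw [Real.dist_eq] at this
  have hdist : dist (x, t, y + v) (x', t, y' + v) ≤ D := by
    rw [Prod.dist_eq, Prod.dist_eq, dist_self, dist_eq_norm, dist_eq_norm, hyy]
    simp only [hD, max_le_iff]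
    refine ⟨by linarith, by linarith, by linarith⟩
  calc _ ≤ (L : ℝ) * dist (x, t, y + v) (x', t, y' + v) := this
    _ ≤ L * D := by gcongr
    _ ≤ _ := by nlinarith

theorem IsThickCorrector.continuous_clamp {f : R2 → ℝ → R2 → ℝ} (hf : IsThickCorrector S f) :
    Continuous fun p : R2 × ℝ × R2 => f p.1 (clampI p.2.1) p.2.2 := by
  have h : Continuous fun p : R2 × ℝ × R2 => (p.1, ((clampI p.2.1 : I) : ℝ), p.2.2) :=
    continuous_fst.prodMk ((continuous_subtype_val.comp
      (continuous_clampI.comp continuous_snd.fst)).prodMk continuous_snd.snd)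
  exact hf.continuousOn.comp_continuous h fun p => ⟨mem_univ _, (clampI _).2, mem_univ _⟩

theorem IsThickCorrector.component {f : R2 → ℝ → R2 → R3} (hf : IsThickCorrector S f) (j : Fin 3) :
    IsThickCorrector S fun x t y => f x t y j := by
  obtain ⟨hfs, hper, K, hKS, hK, hK0⟩ := hf
  exact ⟨contDiffOn_pi.1 hfs j, fun x t ht y k => congrFun (hper x t ht y k) j, K, hKS, hK,
    fun x hx t ht y => congrFun (hK0 x hx t ht y) j⟩

theorem IsCorrector.component {f : R2 → R2 → R2} (hf : IsCorrector S f) (j : Fin 2) :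
    IsCorrector S fun x y => f x y j := by
  obtain ⟨hfs, hper, K, hKS, hK, hK0⟩ := hf
  exact ⟨contDiff_pi.1 hfs j, fun x y k => congrFun (hper x y k) j, K, hKS, hK,
    fun x hx y => congrFun (hK0 x hx y) j⟩

variable {f : R2 → R2 → ℝ}

theorem IsCorrector.isThick (hf : IsCorrector S f) : IsThickCorrector S fun x _ y => f x y := by
  obtain ⟨hfs, hper, K, hKS, hK, hK0⟩ := hf
  exact ⟨(hfs.comp (contDiff_fst.prodMk contDiff_snd.snd)).contDiffOn, fun x _ _ => hper x, K, hKS,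
    hK, fun x hx _ _ y => hK0 x hx y⟩

theorem zero_mem_I : (0 : ℝ) ∈ I := ⟨by norm_num, by norm_num⟩

theorem IsCorrector.exists_bound (hf : IsCorrector S f) : ∃ C, 0 ≤ C ∧ ∀ x y, |f x y| ≤ C := by
  obtain ⟨C, hC, h⟩ := hf.isThick.exists_bound
  exact ⟨C, hC, fun x y => h x 0 zero_mem_I y⟩

theorem IsCorrector.exists_lipschitz (hf : IsCorrector S f) :
    ∃ L, 0 ≤ L ∧ ∀ x x' y y', |f x y - f x' y'| ≤ L * (‖x - x'‖ + ‖y - y'‖) := by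
  obtain ⟨C, hC, h⟩ := hf.isThick.exists_lipschitz
  exact ⟨C, hC, fun x x' y y' => h x x' 0 zero_mem_I y y'⟩

/-- The partial derivative in the slow variable. -/
noncomputable def dX (α : Fin 2) (f : R2 → R2 → ℝ) (x y : R2) : ℝ :=
  fderiv ℝ (fun z => f z y) x (e α)

/-- The partial derivative in the fast variable. -/
noncomputable def dY (α : Fin 2) (f : R2 → R2 → ℝ) (x y : R2) : ℝ :=
  fderiv ℝ (fun w => f x w) y (e α)

theorem IsCorrector.hasFDerivAt (hf : IsCorrector S f) (x y : R2) :
    HasFDerivAt (fun p : R2 × R2 => f p.1 p.2)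
      (fderiv ℝ (fun p : R2 × R2 => f p.1 p.2) (x, y)) (x, y) :=
  (hf.1.differentiable (by simp)).differentiableAt.hasFDerivAt

theorem IsCorrector.dX_eq (hf : IsCorrector S f) (α : Fin 2) (x y : R2) :
    dX α f x y = fderiv ℝ (fun p : R2 × R2 => f p.1 p.2) (x, y) (e α, 0) := by
  have h : HasFDerivAt (fun z : R2 => (z, y)) (ContinuousLinearMap.inl ℝ R2 R2) x :=
    hasFDerivAt_prodMk_left x y
  have h2 : HasFDerivAt (fun z => f z y) _ x :=
    HasFDerivAt.comp (g := fun p : R2 × R2 => f p.1 p.2) x (hf.hasFDerivAt x y) h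
  rw [dX, h2.fderiv]
  simp

theorem IsCorrector.dY_eq (hf : IsCorrector S f) (α : Fin 2) (x y : R2) :
    dY α f x y = fderiv ℝ (fun p : R2 × R2 => f p.1 p.2) (x, y) (0, e α) := by
  have h : HasFDerivAt (fun w : R2 => (x, w)) (ContinuousLinearMap.inr ℝ R2 R2) y :=
    hasFDerivAt_prodMk_right x y
  have h2 : HasFDerivAt (fun w => f x w) _ y :=
    HasFDerivAt.comp (g := fun p : R2 × R2 => f p.1 p.2) y (hf.hasFDerivAt x y) h
  rw [dY, h2.fderiv]
  simp

theorem IsCorrector.contDiff_fderiv_apply (hf : IsCorrector S f) (v : R2 × R2) :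
    ContDiff ℝ ∞ fun p : R2 × R2 => fderiv ℝ (fun p : R2 × R2 => f p.1 p.2) p v :=
  (hf.1.fderiv_right (by simp)).clm_apply contDiff_const

theorem IsCorrector.dX (hf : IsCorrector S f) (α : Fin 2) : IsCorrector S (dX α f) := by
  have hs : ContDiff ℝ ∞ fun p : R2 × R2 => BendingPlate.dX α f p.1 p.2 := by
    simp_rw [hf.dX_eq]
    exact hf.contDiff_fderiv_apply _
  obtain ⟨-, hper, K, hKS, hK, hK0⟩ := hf
  refine ⟨hs, fun x y k => ?_, K, hKS, hK, fun x hx y => ?_⟩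
  · simp only [BendingPlate.dX, fun z => hper z y k]
  · have : (fun z => f z y) =ᶠ[𝓝 x] fun _ => 0 := by
      filter_upwards [hK.isClosed.isOpen_compl.mem_nhds hx] with z hz using hK0 z hz y
    rw [BendingPlate.dX, this.fderiv_eq]
    simp

theorem IsCorrector.dY (hf : IsCorrector S f) (α : Fin 2) : IsCorrector S (dY α f) := by
  have hs : ContDiff ℝ ∞ fun p : R2 × R2 => BendingPlate.dY α f p.1 p.2 := by
    simp_rw [hf.dY_eq]
    exact hf.contDiff_fderiv_apply _
  obtain ⟨-, hper, K, hKS, hK, hK0⟩ := hf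
  refine ⟨hs, fun x y k => ?_, K, hKS, hK, fun x hx y => ?_⟩
  · simp only [BendingPlate.dY]
    rw [← fderiv_comp_add_right]
    simp only [fun w => hper x w k]
  · have : (fun w => f x w) = fun _ => 0 := by
      ext w
      exact hK0 x hx w
    rw [BendingPlate.dY, this]
    simp

/-- The oscillating function `x ↦ f(x, x / ε)`. -/
noncomputable def osc (f : R2 → R2 → ℝ) (ε : ℝ) (x : R2) : ℝ := f x (ε⁻¹ • x)

theorem IsCorrector.contDiff_osc (hf : IsCorrector S f) (ε : ℝ) : ContDiff ℝ ∞ (osc f ε) :=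
  hf.1.comp (contDiff_id.prodMk (contDiff_id.const_smul ε⁻¹))

theorem IsCorrector.blip_osc (hf : IsCorrector S f) (ε : ℝ) (U : Set R2) : BLip U (osc f ε) := by
  obtain ⟨C, -, hC⟩ := hf.exists_bound
  have hs := hf.contDiff_osc ε
  obtain ⟨-, -, K, -, hK, hK0⟩ := hf
  have hc : HasCompactSupport (osc f ε) := HasCompactSupport.intro hK fun x hx => hK0 x hx _
  obtain ⟨L, hL⟩ := ContDiff.lipschitzWith_of_hasCompactSupport hc hs (by simp)
  exact BLip.of_lipschitzWith hL fun x _ => hC x _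

theorem IsCorrector.fderiv_osc (hf : IsCorrector S f) (ε : ℝ) (α : Fin 2) (x : R2) :
    fderiv ℝ (osc f ε) x (e α) = osc (BendingPlate.dX α f) ε x + ε⁻¹ * osc (BendingPlate.dY α f) ε x := by
  have h1 : HasFDerivAt (fun x : R2 => (x, ε⁻¹ • x))
      ((ContinuousLinearMap.id ℝ R2).prod (ε⁻¹ • ContinuousLinearMap.id ℝ R2)) x :=
    (hasFDerivAt_id x).prodMk ((hasFDerivAt_id x).const_smul ε⁻¹)
  have h2 : HasFDerivAt (osc f ε) _ x :=
    HasFDerivAt.comp (g := fun p : R2 × R2 => f p.1 p.2) x (hf.hasFDerivAt x (ε⁻¹ • x)) h1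
  rw [h2.fderiv, osc, osc, hf.dX_eq, hf.dY_eq, ← smul_eq_mul, ← map_smul, ← map_add]
  simp

/-! ### The integrated shear corrector -/

/-- The primitive `∫_{-1/2}^t g(x, s, x / ε) ds`. -/
noncomputable def oscPrim (g : R2 → ℝ → R2 → ℝ) (ε : ℝ) (p : R2 × ℝ) : ℝ :=
  ∫ s in (-1 / 2 : ℝ)..p.2, g p.1 (clampI s) (ε⁻¹ • p.1)

variable {g : R2 → ℝ → R2 → ℝ}

theorem IsThickCorrector.continuous_slice (hg : IsThickCorrector S g) (x y : R2) :
    Continuous fun s => g x (clampI s) y :=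
  hg.continuous_clamp.comp (continuous_const.prodMk (continuous_id.prodMk continuous_const))

theorem IsThickCorrector.hasDerivAt_oscPrim (hg : IsThickCorrector S g) (ε : ℝ) (x : R2) (t : ℝ) :
    HasDerivAt (fun s => oscPrim g ε (x, s)) (g x (clampI t) (ε⁻¹ • x)) t := by
  have := hg.continuous_slice x (ε⁻¹ • x)
  exact intervalIntegral.integral_hasDerivAt_right (this.intervalIntegrable (-1 / 2) t)
    this.stronglyMeasurable.stronglyMeasurableAtFilter this.continuousAt

/-- The factor 1 + ε⁻¹ reflects dependence on x both directly and through x/ε. Multiplied by h² it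
contributes h²/ε to the gradient, which is o(h) because h/ε → 0. -/
theorem IsThickCorrector.exists_oscPrim_bounds (hg : IsThickCorrector S g) :
    ∃ C, 0 ≤ C ∧ (∀ ε x, ∀ t ∈ I, |oscPrim g ε (x, t)| ≤ C) ∧
      ∀ ε, 0 < ε → LipschitzOnWith (Real.toNNReal (C * (1 + ε⁻¹))) (oscPrim g ε) (univ ×ˢ I) := by
  obtain ⟨C, hC0, hC⟩ := hg.exists_bound
  obtain ⟨L, hL0, hL⟩ := hg.exists_lipschitz
  have hlen : ∀ t ∈ I, |t - -1 / 2| ≤ 1 := fun t ht => by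
    have h1 := ht.1
    have h2 := ht.2
    rw [abs_le]
    constructor <;> linarith
  refine ⟨C + L, by positivity, fun ε x t ht => ?_, fun ε hε => ?_⟩
  · have := intervalIntegral.norm_integral_le_of_norm_le_const (a := -1 / 2) (b := t)
      (f := fun s => g x (clampI s) (ε⁻¹ • x)) (C := C) fun s _ => hC x _ (clampI s).2 _
    refine this.trans ?_
    nlinarith [hlen t ht, abs_nonneg (t - -1 / 2)]
  · refine LipschitzOnWith.of_dist_le_mul fun p hp p' hp' => ?_
    obtain ⟨x, t⟩ := p
    obtain ⟨x', t'⟩ := p'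
    have hε' : 0 < ε⁻¹ := inv_pos.2 hε
    rw [Real.coe_toNNReal _ (by positivity), Real.dist_eq]
    have hi : ∀ x a b, IntervalIntegrable (fun s => g x (clampI s) (ε⁻¹ • x)) volume a b :=
      fun x a b => (hg.continuous_slice _ _).intervalIntegrable _ _
    have e1 : oscPrim g ε (x, t) - oscPrim g ε (x', t') =
        (∫ s in t'..t, g x (clampI s) (ε⁻¹ • x)) +
        ∫ s in (-1 / 2 : ℝ)..t', (g x (clampI s) (ε⁻¹ • x) - g x' (clampI s) (ε⁻¹ • x')) := by
      rw [intervalIntegral.integral_sub (hi _ _ _) (hi _ _ _), oscPrim, oscPrim,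
        ← intervalIntegral.integral_add_adjacent_intervals (hi x (-1 / 2) t') (hi x t' t)]
      ring
    have b1 := intervalIntegral.norm_integral_le_of_norm_le_const (a := t') (b := t)
      (f := fun s => g x (clampI s) (ε⁻¹ • x)) (C := C) fun s _ => hC x _ (clampI s).2 _
    have b2 := intervalIntegral.norm_integral_le_of_norm_le_const (a := -1 / 2) (b := t')
      (f := fun s => g x (clampI s) (ε⁻¹ • x) - g x' (clampI s) (ε⁻¹ • x'))
      (C := L * ((1 + ε⁻¹) * ‖x - x'‖)) fun s _ => by
        refine (hL x x' _ (clampI s).2 _ _).trans (le_of_eq ?_)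
        rw [← smul_sub, norm_smul, Real.norm_eq_abs, abs_of_pos hε']
        ring
    have hd1 : ‖x - x'‖ ≤ dist (x, t) (x', t') := by
      rw [← dist_eq_norm]; exact le_max_left _ _
    have hd2 : |t - t'| ≤ dist (x, t) (x', t') := by
      rw [← Real.dist_eq]; exact le_max_right _ _
    rw [e1]
    refine (abs_add_le _ _).trans ?_
    rw [Real.norm_eq_abs] at b1 b2
    set d := dist (x, t) (x', t')
    have hd0 : 0 ≤ d := dist_nonneg
    have c1 : C * |t - t'| ≤ C * ((1 + ε⁻¹) * d) := by
      gcongr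
      nlinarith
    have c2 : L * ((1 + ε⁻¹) * ‖x - x'‖) * |t' - -1 / 2| ≤ L * ((1 + ε⁻¹) * d) := by
      have h1 : L * ((1 + ε⁻¹) * ‖x - x'‖) ≤ L * ((1 + ε⁻¹) * d) := by gcongr
      have h2 : 0 ≤ L * ((1 + ε⁻¹) * ‖x - x'‖) := by positivity
      nlinarith [hlen t' hp'.2, abs_nonneg (t' - -1 / 2)]
    linarith

end BendingPlate

namespace BendingPlate

variable {S : Set R2}

/-! ### Representatives of `W^{2,∞}` maps -/

/-- `U` and `P` are Lipschitz representatives of `u` and of its first weak derivatives. -/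
structure IsRep (S : Set R2) (u U : R2 → R3) (P : Fin 2 → R2 → R3) : Prop where
  blip : ∀ i, BLip S fun x => U x i
  blip_deriv : ∀ α i, BLip S fun x => P α x i
  meas_deriv : ∀ α, Measurable (P α)
  ae_eq : ∀ᵐ x ∂(volume.restrict S), u x = U x
  pd_ae_eq : ∀ᵐ x ∂(volume.restrict S), ∀ α, pd S α u x = P α x
  fderiv_ae_eq : ∀ᵐ x ∂(volume.restrict S), ∀ α i, fderiv ℝ (fun z => U z i) x (e α) = P α x i

theorem exists_isRep (hS : IsOpen S) {u : R2 → R3} (hu : MemWVec ⊤ S 2 u) :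
    ∃ U P, IsRep S u U P := by
  choose U P hU hP using fun i => MemW.exists_blip_deriv hS (hu i)
  refine ⟨fun x i => U i x, fun α x i => P i α x, fun i => (hU i).1, fun α i => (hP i α).1,
    fun α => measurable_pi_lambda _ fun i => (hP i α).2.1,
    ?_, ?_, ?_⟩
  · filter_upwards [ae_all_iff.2 fun i => (hU i).2.2] with x hx
    exact funext hx
  · filter_upwards [ae_all_iff.2 fun i => ae_all_iff.2 fun α => (hP i α).2.2.1] with x hx α
    exact funext fun i => hx i α
  · filter_upwards [ae_all_iff.2 fun i => ae_all_iff.2 fun α => (hP i α).2.2.2] with x hx α i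
    exact hx i α

/-- The fields entering the recovery sequence. -/
structure Fields where
  U : R2 → R3
  P : Fin 2 → R2 → R3
  V : R2 → R3
  PV : Fin 2 → R2 → R3
  ζ : R2 → R2 → R2
  φ : R2 → R2 → ℝ
  g : R2 → ℝ → R2 → R3

namespace Fields

variable (d : Fields)

/-- The normal. -/
def N (x : R2) : R3 := crossProduct (d.P 0 x) (d.P 1 x)

/-- The frame. -/
def R (x : R2) : M3 := (Matrix.of ![d.P 0 x, d.P 1 x, d.N x])ᵀ

/-- The variation of the normal. -/
def MU (x : R2) : R3 :=
  ((1 : M3) - Matrix.vecMulVec (d.N x) (d.N x)) *ᵥ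
    (crossProduct (d.PV 0 x) (d.P 1 x) + crossProduct (d.P 0 x) (d.PV 1 x))

/-- The full derivative of `x ↦ φ(x, x / ε)`. -/
noncomputable def D (ε : ℝ) (β : Fin 2) (x : R2) : ℝ :=
  osc (dX β d.φ) ε x + ε⁻¹ * osc (dY β d.φ) ε x

/-- The partial derivatives of the normal. -/
noncomputable def DN (α : Fin 2) (x : R2) : R3 := fun i => fderiv ℝ (fun z => d.N z i) x (e α)

/-- The Lipschitz representative of the recovery sequence. -/
noncomputable def rep (h ε : ℝ) (i : Fin 3) (p : R2 × ℝ) : ℝ :=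
  d.U p.1 i + h * p.2 * d.N p.1 i + h * (d.V p.1 i + h * p.2 * d.MU p.1 i)
    - ε ^ 2 * osc d.φ ε p.1 * d.N p.1 i
    + h * ε ^ 2 * p.2 * ∑ β, d.P β p.1 i * d.D ε β p.1
    + h * ε * ∑ β, d.P β p.1 i * osc (fun x y => d.ζ x y β) ε p.1
    + h ^ 2 * ∑ j, d.R p.1 i j * oscPrim (fun x t y => d.g x t y j) ε p

/-- The hypotheses on the fields. -/
structure Admissible (S : Set R2) (u V : R2 → R3) : Prop where
  isOpen : IsOpen S
  rep_u : IsRep S u d.U d.P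
  rep_V : IsRep S V d.V d.PV
  isometry : ∀ x ∈ S, ∀ α β, d.P α x ⬝ᵥ d.P β x = if α = β then 1 else 0
  ζ_corr : IsCorrector S d.ζ
  φ_corr : IsCorrector S d.φ
  g_corr : IsThickCorrector S d.g

variable {d}

theorem R_apply_zero (x : R2) (i : Fin 3) : d.R x i 0 = d.P 0 x i := rfl
theorem R_apply_one (x : R2) (i : Fin 3) : d.R x i 1 = d.P 1 x i := rfl
theorem R_apply_two (x : R2) (i : Fin 3) : d.R x i 2 = d.N x i := rfl

theorem cross_apply_eq (a b : R3) (i : Fin 3) :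
    crossProduct a b i = a (i + 1) * b (i + 2) - a (i + 2) * b (i + 1) := by
  fin_cases i <;> simp [cross_apply]

theorem MU_apply (x : R2) (i : Fin 3) : d.MU x i =
    (crossProduct (d.PV 0 x) (d.P 1 x) i + crossProduct (d.P 0 x) (d.PV 1 x) i) -
    d.N x i * ∑ k, d.N x k *
      (crossProduct (d.PV 0 x) (d.P 1 x) k + crossProduct (d.P 0 x) (d.PV 1 x) k) := by
  rw [MU, Matrix.sub_mulVec, Matrix.one_mulVec, Matrix.vecMulVec_mulVec]
  simp only [Pi.sub_apply, Pi.add_apply, Pi.smul_apply, dotProduct]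
  simp [mul_comm]

theorem blip_cross {S : Set R2} (hS : IsOpen S) {a b : R2 → R3} (ha : ∀ i, BLip S fun x => a x i)
    (hb : ∀ i, BLip S fun x => b x i) (i : Fin 3) : BLip S fun x => crossProduct (a x) (b x) i := by
  simp only [cross_apply_eq]
  exact ((ha _).mul hS (hb _)).sub hS ((ha _).mul hS (hb _))

end Fields

end BendingPlate

/-! ### Algebra and regularity of the frame, the normal and μ -/

namespace BendingPlate

variable {S : Set R2} {d : Fields} {u V : R2 → R3}

namespace Fields

theorem Admissible.blip_N (hd : d.Admissible S u V) (i : Fin 3) : BLip S fun x => d.N x i :=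
  blip_cross hd.isOpen (hd.rep_u.blip_deriv 0) (hd.rep_u.blip_deriv 1) i

theorem Admissible.blip_R (hd : d.Admissible S u V) (i j : Fin 3) : BLip S fun x => d.R x i j := by
  fin_cases j
  · exact hd.rep_u.blip_deriv 0 i
  · exact hd.rep_u.blip_deriv 1 i
  · exact hd.blip_N i

theorem Admissible.blip_MU (hd : d.Admissible S u V) (i : Fin 3) : BLip S fun x => d.MU x i := by
  have hS := hd.isOpen
  have hw : ∀ i, BLip S fun x => crossProduct (d.PV 0 x) (d.P 1 x) i +
      crossProduct (d.P 0 x) (d.PV 1 x) i := fun i =>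
    (blip_cross hS (hd.rep_V.blip_deriv 0) (hd.rep_u.blip_deriv 1) i).add
      (blip_cross hS (hd.rep_u.blip_deriv 0) (hd.rep_V.blip_deriv 1) i)
  simp only [MU_apply]
  exact (hw i).sub hS ((hd.blip_N i).mul hS
    (BLip.sum _ fun k _ => (hd.blip_N k).mul hS (hw k)))

theorem Admissible.dot_expand (hd : d.Admissible S u V) {x : R2} (hx : x ∈ S) :
    d.P 0 x 0 ^ 2 + d.P 0 x 1 ^ 2 + d.P 0 x 2 ^ 2 = 1 ∧
    d.P 1 x 0 ^ 2 + d.P 1 x 1 ^ 2 + d.P 1 x 2 ^ 2 = 1 ∧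
    d.P 0 x 0 * d.P 1 x 0 + d.P 0 x 1 * d.P 1 x 1 + d.P 0 x 2 * d.P 1 x 2 = 0 := by
  have h00 := hd.isometry x hx 0 0
  have h11 := hd.isometry x hx 1 1
  have h01 := hd.isometry x hx 0 1
  simp only [dotProduct, Fin.sum_univ_three] at h00 h11 h01
  refine ⟨?_, ?_, ?_⟩
  · simpa [sq] using h00
  · simpa [sq] using h11
  · simpa using h01

theorem N_expand (x : R2) : d.N x 0 = d.P 0 x 1 * d.P 1 x 2 - d.P 0 x 2 * d.P 1 x 1 ∧
    d.N x 1 = d.P 0 x 2 * d.P 1 x 0 - d.P 0 x 0 * d.P 1 x 2 ∧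
    d.N x 2 = d.P 0 x 0 * d.P 1 x 1 - d.P 0 x 1 * d.P 1 x 0 := by
  refine ⟨?_, ?_, ?_⟩ <;> simp [N, cross_apply]

theorem Admissible.N_dot (hd : d.Admissible S u V) {x : R2} (hx : x ∈ S) :
    d.N x 0 ^ 2 + d.N x 1 ^ 2 + d.N x 2 ^ 2 = 1 ∧
    d.P 0 x 0 * d.N x 0 + d.P 0 x 1 * d.N x 1 + d.P 0 x 2 * d.N x 2 = 0 ∧
    d.P 1 x 0 * d.N x 0 + d.P 1 x 1 * d.N x 1 + d.P 1 x 2 * d.N x 2 = 0 := by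
  obtain ⟨h1, h2, h3⟩ := hd.dot_expand hx
  obtain ⟨n0, n1, n2⟩ := N_expand (d := d) x
  rw [n0, n1, n2]
  refine ⟨?_, by ring, by ring⟩
  -- Lagrange's identity |a ∧ b|² = |a|²|b|² - (a·b)².
  linear_combination (d.P 1 x 0 ^ 2 + d.P 1 x 1 ^ 2 + d.P 1 x 2 ^ 2) * h1 + h2 -
    (d.P 0 x 0 * d.P 1 x 0 + d.P 0 x 1 * d.P 1 x 1 + d.P 0 x 2 * d.P 1 x 2) * h3

theorem Admissible.transpose_mul_R (hd : d.Admissible S u V) {x : R2} (hx : x ∈ S) :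
    (d.R x)ᵀ * d.R x = 1 := by
  obtain ⟨h1, h2, h3⟩ := hd.dot_expand hx
  obtain ⟨h4, h5, h6⟩ := hd.N_dot hx
  ext i j
  rw [Matrix.mul_apply, Fin.sum_univ_three]
  simp only [Matrix.transpose_apply]
  fin_cases i <;> fin_cases j <;>
    simp [R_apply_zero, R_apply_one, R_apply_two] <;> linarith

theorem Admissible.R_mul_transpose (hd : d.Admissible S u V) {x : R2} (hx : x ∈ S) :
    d.R x * (d.R x)ᵀ = 1 :=
  mul_eq_one_comm.1 (hd.transpose_mul_R hx)

theorem Admissible.R_mem (hd : d.Admissible S u V) {x : R2} (hx : x ∈ S) :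
    d.R x ∈ Matrix.specialOrthogonalGroup (Fin 3) ℝ := by
  rw [Matrix.mem_specialOrthogonalGroup_iff, Matrix.mem_orthogonalGroup_iff]
  refine ⟨hd.R_mul_transpose hx, ?_⟩
  obtain ⟨h4, -, -⟩ := hd.N_dot hx
  obtain ⟨n0, n1, n2⟩ := N_expand (d := d) x
  rw [Matrix.det_fin_three]
  simp only [R_apply_zero, R_apply_one, R_apply_two]
  -- The determinant is the triple product of ∂₁u, ∂₂u and n, which is |n|² = 1.
  linear_combination h4 - d.N x 0 * n0 - d.N x 1 * n1 - d.N x 2 * n2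

/-- The last row of `Rᵀ (∂V, μ)` is skew. -/
theorem Admissible.MU_relations (hd : d.Admissible S u V) {x : R2} (hx : x ∈ S) :
    (∀ α, ∑ k, d.N x k * d.PV α x k + ∑ k, d.P α x k * d.MU x k = 0) ∧
      ∑ k, d.N x k * d.MU x k = 0 := by
  obtain ⟨h1, h2, h3⟩ := hd.dot_expand hx
  obtain ⟨h4, h5, h6⟩ := hd.N_dot hx
  have key : ∀ a : R3, ∑ k, a k * d.MU x k =
      (∑ k, a k * (crossProduct (d.PV 0 x) (d.P 1 x) k + crossProduct (d.P 0 x) (d.PV 1 x) k)) -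
      (∑ k, a k * d.N x k) * ∑ k, d.N x k *
      (crossProduct (d.PV 0 x) (d.P 1 x) k + crossProduct (d.P 0 x) (d.PV 1 x) k) := fun a => by
    simp only [MU_apply, mul_sub, Finset.sum_sub_distrib, Finset.sum_mul, mul_assoc]
  have hPN : ∀ α, ∑ k, d.P α x k * d.N x k = 0 := fun α => by
    rw [Fin.sum_univ_three]
    fin_cases α
    · exact h5
    · exact h6
  have hNN : ∑ k, d.N x k * d.N x k = 1 := by
    rw [Fin.sum_univ_three]
    linarith
  obtain ⟨n0, n1, n2⟩ := N_expand (d := d) x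
  refine ⟨fun α => ?_, ?_⟩
  -- Tangent vectors do not see the projection in μ. What remains is the antisymmetry of the triple
  -- product: for instance ∂₁u · (∂₁V ∧ ∂₂u) = -n · ∂₁V.
  · rw [key, hPN, zero_mul, sub_zero]
    simp only [Fin.sum_univ_three, n0, n1, n2]
    fin_cases α <;> simp [cross_apply] <;> ring
  · rw [key, hNN, one_mul, sub_self]

theorem Admissible.ae_differentiable (hd : d.Admissible S u V) :
    ∀ᵐ x ∂(volume.restrict S), ∀ i, DifferentiableAt ℝ (fun z => d.U z i) x ∧
      DifferentiableAt ℝ (fun z => d.V z i) x ∧ DifferentiableAt ℝ (fun z => d.MU z i) x ∧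
      ∀ j, DifferentiableAt ℝ (fun z => d.R z i j) x := by
  have hS := hd.isOpen
  rw [ae_all_iff]
  intro i
  filter_upwards [(hd.rep_u.blip i).ae_differentiableAt hS, (hd.rep_V.blip i).ae_differentiableAt hS,
    (hd.blip_MU i).ae_differentiableAt hS,
    ae_all_iff.2 fun j => (hd.blip_R i j).ae_differentiableAt hS] with x h1 h2 h3 h4
  exact ⟨h1, h2, h3, h4⟩

/-- The derivatives of the normal are tangential. -/
theorem Admissible.ae_N_DN (hd : d.Admissible S u V) :
    ∀ᵐ x ∂(volume.restrict S), ∀ α, ∑ k, d.N x k * d.DN α x k = 0 := by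
  filter_upwards [hd.ae_differentiable, ae_restrict_mem hd.isOpen.measurableSet] with x hx hxS α
  have hN : ∀ k, HasFDerivAt (fun z => d.N z k) (fderiv ℝ (fun z => d.N z k) x) x := fun k =>
    ((hx k).2.2.2 2).hasFDerivAt
  have h1 : HasFDerivAt (fun z => ∑ k, d.N z k * d.N z k)
      (∑ k, (d.N x k • fderiv ℝ (fun z => d.N z k) x + d.N x k • fderiv ℝ (fun z => d.N z k) x)) x :=
    HasFDerivAt.fun_sum fun k _ => (hN k).mul (hN k)
  -- The isometry relations hold at every point of the open set S, not just almost everywhere, so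
  -- |n|² = 1 may be differentiated.
  have h2 : (fun z => ∑ k, d.N z k * d.N z k) =ᶠ[𝓝 x] fun _ => 1 := by
    filter_upwards [hd.isOpen.mem_nhds hxS] with z hz
    have := (hd.N_dot hz).1
    rw [Fin.sum_univ_three]
    linarith
  have h3 := h1.fderiv
  rw [h2.fderiv_eq] at h3
  have h4 := DFunLike.congr_fun h3 (e α)
  simp only [fderiv_const_apply, Fin.sum_univ_three] at h4
  simp only [Fin.sum_univ_three, DN]
  simp at h4
  linarith

theorem measurable_cross {a b : R2 → R3} (ha : Measurable a) (hb : Measurable b) :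
    Measurable fun x => crossProduct (a x) (b x) := by
  refine measurable_pi_lambda _ fun i => ?_
  simp only [cross_apply_eq]
  fun_prop

theorem Admissible.measurable_N (hd : d.Admissible S u V) : Measurable d.N :=
  measurable_cross (hd.rep_u.meas_deriv 0) (hd.rep_u.meas_deriv 1)

theorem Admissible.measurable_R (hd : d.Admissible S u V) (i j : Fin 3) :
    Measurable fun x => d.R x i j := by
  fin_cases j
  · exact (measurable_pi_apply i).comp (hd.rep_u.meas_deriv 0)
  · exact (measurable_pi_apply i).comp (hd.rep_u.meas_deriv 1)
  · exact (measurable_pi_apply i).comp hd.measurable_N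

theorem Admissible.measurable_MU (hd : d.Admissible S u V) : Measurable d.MU := by
  refine measurable_pi_lambda _ fun i => ?_
  have h1 := measurable_cross (hd.rep_V.meas_deriv 0) (hd.rep_u.meas_deriv 1)
  have h2 := measurable_cross (hd.rep_u.meas_deriv 0) (hd.rep_V.meas_deriv 1)
  have h3 := hd.measurable_N
  simp only [MU_apply]
  fun_prop

theorem measurable_DN (α : Fin 2) : Measurable (d.DN α) :=
  measurable_pi_lambda _ fun _ => measurable_fderiv_apply_const ℝ _ _

/-- Identification of the fields of the statement with their representatives. -/
theorem Admissible.ae_identify (hd : d.Admissible S u V) :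
    ∀ᵐ x ∂(volume.restrict S), u x = d.U x ∧ V x = d.V x ∧ normal S u x = d.N x ∧
      frame S u x = d.R x ∧ muField S u V x = d.MU x ∧
      (∀ α, pd S α u x = d.P α x) ∧ (∀ α, pd S α V x = d.PV α x) ∧
      ∀ α, pd S α (normal S u) x = d.DN α x := by
  have hS := hd.isOpen
  have hN : ∀ᵐ x ∂(volume.restrict S), normal S u x = d.N x := by
    filter_upwards [hd.rep_u.pd_ae_eq] with x hx
    rw [normal, N, hx, hx]
  have hDN : ∀ᵐ x ∂(volume.restrict S), ∀ α i, weakDeriv S (e α) (fun z => normal S u z i) x =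
      fderiv ℝ (fun z => d.N z i) x (e α) := by
    refine ae_all_iff.2 fun α => ae_all_iff.2 fun i => ?_
    refine (hd.blip_N i).weakDeriv_ae_eq hS ?_ (e α)
    filter_upwards [hN] with x hx
    rw [hx]
  filter_upwards [hd.rep_u.pd_ae_eq, hd.rep_V.pd_ae_eq, hd.rep_u.ae_eq, hd.rep_V.ae_eq, hN, hDN]
    with x h1 h2 h3 h4 h5 h6
  refine ⟨h3, h4, h5, ?_, ?_, h1, h2, fun α => funext fun i => h6 α i⟩
  · rw [frame, R, h1, h1, h5]
  · rw [muField, MU, h5, h1, h1, h2, h2]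

end Fields

end BendingPlate

/-! ### Classical derivatives of the recovery sequence -/

namespace BendingPlate

variable {S : Set R2} {d : Fields} {u V : R2 → R3}

theorem isOpen_openPlate (hS : IsOpen S) : IsOpen (openPlate S) := hS.prod isOpen_Ioo

theorem Ioo_subset_I : Ioo (-1 / 2 : ℝ) (1 / 2) ⊆ I := Ioo_subset_Icc_self

theorem BLip.snd_openPlate : BLip (openPlate S) fun p : R2 × ℝ => p.2 :=
  BLip.of_lipschitzWith (C := 1 / 2) LipschitzWith.prod_snd fun p hp => by
    have h1 := hp.2.1
    have h2 := hp.2.2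
    rw [abs_le]
    constructor <;> linarith

theorem IsThickCorrector.blip_oscPrim {g : R2 → ℝ → R2 → ℝ} (hg : IsThickCorrector S g) {ε : ℝ}
    (hε : 0 < ε) : BLip (openPlate S) (oscPrim g ε) := by
  obtain ⟨C, hC0, hC, hL⟩ := hg.exists_oscPrim_bounds
  refine ⟨Real.toNNReal (C * (1 + ε⁻¹)), fun p hp => ?_, fun p hp => ?_⟩
  · have : 0 < ε⁻¹ := inv_pos.2 hε
    rw [Real.coe_toNNReal _ (by positivity)]
    have h := hC ε p.1 p.2 (Ioo_subset_I hp.2)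
    exact h.trans (by nlinarith)
  · exact ⟨univ ×ˢ Ioo (-1 / 2 : ℝ) (1 / 2), (isOpen_univ.prod isOpen_Ioo).mem_nhds
      ⟨mem_univ _, hp.2⟩, (hL ε hε).mono (prod_mono subset_rfl Ioo_subset_I)⟩

theorem ae_plate_of_openPlate {P : R2 × ℝ → Prop}
    (h : ∀ᵐ p ∂(volume.restrict (openPlate S)), P p) :
    ∀ᵐ p ∂(volume.restrict (plate S)), P p := by
  have e : (volume : Measure (R2 × ℝ)).restrict (openPlate S) = volume.restrict (plate S) := by
    rw [openPlate, plate, I, Measure.volume_eq_prod, ← Measure.prod_restrict,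
      ← Measure.prod_restrict, Measure.restrict_congr_set Ioo_ae_eq_Icc]
  rwa [← e]

theorem ae_openPlate_fst {P : R2 → Prop} (h : ∀ᵐ x ∂(volume.restrict S), P x) :
    ∀ᵐ p ∂((volume : Measure (R2 × ℝ)).restrict (openPlate S)), P p.1 := by
  rw [openPlate, Measure.volume_eq_prod, ← Measure.prod_restrict]
  exact Measure.quasiMeasurePreserving_fst.ae h

namespace Fields

theorem Admissible.blip_D (hd : d.Admissible S u V) (ε : ℝ) (β : Fin 2) (T : Set R2) (hT : IsOpen T) :
    BLip T (d.D ε β) :=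
  ((hd.φ_corr.dX β).blip_osc ε T).add (((hd.φ_corr.dY β).blip_osc ε T).const_mul _ hT)

theorem Admissible.blip_rep (hd : d.Admissible S u V) {ε : ℝ} (hε : 0 < ε) (h : ℝ) (i : Fin 3) :
    BLip (openPlate S) (d.rep h ε i) := by
  have hS := hd.isOpen
  have hO := isOpen_openPlate hS
  have ht : BLip (openPlate S) fun p : R2 × ℝ => p.2 := BLip.snd_openPlate
  have hlift : ∀ {f : R2 → ℝ}, BLip S f → BLip (openPlate S) fun p : R2 × ℝ => f p.1 :=
    fun hf => hf.comp_fst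
  have hN := hlift (hd.blip_N i)
  have hφ := hlift (hd.φ_corr.blip_osc ε S)
  refine BLip.add (BLip.add (BLip.add (BLip.sub hO (BLip.add (BLip.add (hlift (hd.rep_u.blip i))
    ((ht.const_mul h hO).mul hO hN)) (((hlift (hd.rep_V.blip i)).add
    ((ht.const_mul h hO).mul hO (hlift (hd.blip_MU i)))).const_mul h hO))
    ((hφ.const_mul _ hO).mul hO hN)) ?_) ?_) ?_
  · exact (ht.const_mul _ hO).mul hO (BLip.sum _ fun β _ =>
      (hlift (hd.rep_u.blip_deriv β i)).mul hO (hlift (hd.blip_D ε β S hS)))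
  · exact (BLip.sum _ fun β _ => (hlift (hd.rep_u.blip_deriv β i)).mul hO
      (hlift ((hd.ζ_corr.component β).blip_osc ε S))).const_mul _ hO
  · exact (BLip.sum _ fun j _ => (hlift (hd.blip_R i j)).mul hO
      ((hd.g_corr.component j).blip_oscPrim hε)).const_mul _ hO

/-- The clamped primitive in `rep` agrees with the one in the ansatz because all heights between
-1/2 and x₃ lie in I. -/
theorem Admissible.ae_recovery_eq (hd : d.Admissible S u V) (h ε : ℝ) :
    ∀ᵐ p ∂(volume.restrict (openPlate S)),
      recovery S u V d.ζ d.φ d.g h ε p = fun i => d.rep h ε i p := by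
  filter_upwards [ae_openPlate_fst hd.ae_identify,
    ae_restrict_mem (isOpen_openPlate hd.isOpen).measurableSet] with p hp hpS
  obtain ⟨h1, h2, h3, h4, h5, -⟩ := hp
  have ht : p.2 ∈ I := Ioo_subset_I hpS.2
  have hI : ∀ s ∈ uIcc (-1 / 2) p.2, s ∈ I := fun s hs => by
    rw [uIcc_of_le ht.1] at hs
    exact ⟨hs.1, hs.2.trans ht.2⟩
  have hcont : ∀ j, ContinuousOn (fun s => d.g p.1 s (ε⁻¹ • p.1) j) I := fun j => by
    refine (hd.g_corr.component j).continuousOn.comp (f := fun s : ℝ => (p.1, s, ε⁻¹ • p.1))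
      (by fun_prop) fun s hs => ⟨mem_univ _, hs, mem_univ _⟩
  have hint : ∀ i, (∫ s in (-1 / 2 : ℝ)..p.2, d.R p.1 *ᵥ d.g p.1 s (ε⁻¹ • p.1)) i =
      ∑ j, d.R p.1 i j * oscPrim (fun x t y => d.g x t y j) ε p := fun i => by
    have e1 : (∫ s in (-1 / 2 : ℝ)..p.2, d.R p.1 *ᵥ d.g p.1 s (ε⁻¹ • p.1)) i =
        ∫ s in (-1 / 2 : ℝ)..p.2, (d.R p.1 *ᵥ d.g p.1 s (ε⁻¹ • p.1)) i := by
      have hci : ∀ i, ContinuousOn (fun s => (d.R p.1 *ᵥ d.g p.1 s (ε⁻¹ • p.1)) i)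
          (uIcc (-1 / 2) p.2) := fun i => by
        simp only [Matrix.mulVec, dotProduct]
        exact continuousOn_finsetSum _ fun j _ => continuousOn_const.mul ((hcont j).mono hI)
      have hii : IntervalIntegrable (fun s => d.R p.1 *ᵥ d.g p.1 s (ε⁻¹ • p.1)) volume
          (-1 / 2) p.2 := (continuousOn_pi.2 hci).intervalIntegrable
      exact ((ContinuousLinearMap.proj (R := ℝ) (φ := fun _ : Fin 3 => ℝ) i
        ).intervalIntegral_comp_comm hii).symm
    rw [e1]
    simp only [Matrix.mulVec, dotProduct]
    rw [intervalIntegral.integral_finsetSum fun j _ =>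
      (((hcont j).mono hI).intervalIntegrable).const_mul _]
    refine Finset.sum_congr rfl fun j _ => ?_
    rw [intervalIntegral.integral_const_mul, oscPrim]
    congr 1
    refine intervalIntegral.integral_congr fun s hs => ?_
    simp only [clampI_of_mem (hI s hs)]
  ext i
  simp only [recovery, kirchhoffLove, h1, h2, h3, h4, h5, Pi.add_apply, Pi.sub_apply,
    Pi.smul_apply, smul_eq_mul, hint, rep]
  simp only [Matrix.mulVec, dotProduct, Fin.sum_univ_three, Fin.sum_univ_two]
  simp only [R_apply_zero, R_apply_one, R_apply_two]
  simp [D, osc, twoScaleD, dX, dY]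

/-- The mixed derivatives of `D`. -/
noncomputable def DD (d : Fields) (ε : ℝ) (α β : Fin 2) (x : R2) : ℝ :=
  osc (dX α (dX β d.φ)) ε x + ε⁻¹ * osc (dY α (dX β d.φ)) ε x +
    ε⁻¹ * (osc (dX α (dY β d.φ)) ε x + ε⁻¹ * osc (dY α (dY β d.φ)) ε x)

theorem hasDerivAt_line {f : R2 → ℝ} {x v : R2} (hf : DifferentiableAt ℝ f x) :
    HasDerivAt (fun s : ℝ => f (x + s • v)) (fderiv ℝ f x v) 0 :=
  hf.hasFDerivAt.hasLineDerivAt v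

theorem Admissible.fderiv_D (hd : d.Admissible S u V) (ε : ℝ) (α β : Fin 2) (x : R2) :
    fderiv ℝ (d.D ε β) x (e α) = d.DD ε α β x := by
  have h1 := (((hd.φ_corr.dX β).contDiff_osc ε).differentiable (by simp)).differentiableAt (x := x)
  have h2 := (((hd.φ_corr.dY β).contDiff_osc ε).differentiable (by simp)).differentiableAt (x := x)
  have h3 : HasFDerivAt (d.D ε β) _ x := h1.hasFDerivAt.add (h2.hasFDerivAt.const_mul ε⁻¹)
  rw [h3.fderiv]
  simp only [add_apply, smul_apply, smul_eq_mul]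
  rw [(hd.φ_corr.dX β).fderiv_osc, (hd.φ_corr.dY β).fderiv_osc]
  rfl

/-- The in-plane derivatives of the recovery sequence. -/
theorem Admissible.fderiv_rep_plane (hd : d.Admissible S u V) {h ε : ℝ} {i : Fin 3} {p : R2 × ℝ}
    (hp : DifferentiableAt ℝ (d.rep h ε i) p)
    (hx : ∀ i, DifferentiableAt ℝ (fun z => d.U z i) p.1 ∧
      DifferentiableAt ℝ (fun z => d.V z i) p.1 ∧ DifferentiableAt ℝ (fun z => d.MU z i) p.1 ∧
      ∀ j, DifferentiableAt ℝ (fun z => d.R z i j) p.1)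
    (hg : ∀ j, DifferentiableAt ℝ (oscPrim (fun x t y => d.g x t y j) ε) p) (α : Fin 2) :
    fderiv ℝ (d.rep h ε i) p (e α, 0) =
      fderiv ℝ (fun z => d.U z i) p.1 (e α) + h * p.2 * fderiv ℝ (fun z => d.N z i) p.1 (e α) +
      h * (fderiv ℝ (fun z => d.V z i) p.1 (e α) +
        h * p.2 * fderiv ℝ (fun z => d.MU z i) p.1 (e α)) -
      ε ^ 2 * (d.D ε α p.1 * d.N p.1 i + osc d.φ ε p.1 * fderiv ℝ (fun z => d.N z i) p.1 (e α)) +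
      h * ε ^ 2 * p.2 * ∑ β, (fderiv ℝ (fun z => d.P β z i) p.1 (e α) * d.D ε β p.1 +
        d.P β p.1 i * d.DD ε α β p.1) +
      h * ε * ∑ β, (fderiv ℝ (fun z => d.P β z i) p.1 (e α) * osc (fun x y => d.ζ x y β) ε p.1 +
        d.P β p.1 i * (osc (dX α fun x y => d.ζ x y β) ε p.1 +
          ε⁻¹ * osc (dY α fun x y => d.ζ x y β) ε p.1)) +
      h ^ 2 * ∑ j, (fderiv ℝ (fun z => d.R z i j) p.1 (e α) *
          oscPrim (fun x t y => d.g x t y j) ε p +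
        d.R p.1 i j * fderiv ℝ (oscPrim (fun x t y => d.g x t y j) ε) p (e α, 0)) := by
  obtain ⟨hU, hV, hM, hR⟩ := hx i
  have lU := hasDerivAt_line (v := e α) hU
  have lV := hasDerivAt_line (v := e α) hV
  have lM := hasDerivAt_line (v := e α) hM
  have lN := hasDerivAt_line (v := e α) (hR 2)
  have lP : ∀ β, HasDerivAt (fun s : ℝ => d.P β (p.1 + s • e α) i)
      (fderiv ℝ (fun z => d.P β z i) p.1 (e α)) 0 := fun β => by
    fin_cases β
    · exact hasDerivAt_line (v := e α) (hR 0)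
    · exact hasDerivAt_line (v := e α) (hR 1)
  have lR := fun j => hasDerivAt_line (v := e α) (hR j)
  have lφ := hasDerivAt_line (v := e α)
    ((hd.φ_corr.contDiff_osc ε).differentiable (by simp)).differentiableAt (x := p.1)
  rw [hd.φ_corr.fderiv_osc] at lφ
  have lζ : ∀ β, HasDerivAt (fun s : ℝ => osc (fun x y => d.ζ x y β) ε (p.1 + s • e α))
      (osc (dX α fun x y => d.ζ x y β) ε p.1 +
          ε⁻¹ * osc (dY α fun x y => d.ζ x y β) ε p.1) 0 := fun β => by
    have := hasDerivAt_line (v := e α) (((hd.ζ_corr.component β).contDiff_osc ε).differentiable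
      (by simp)).differentiableAt (x := p.1)
    rwa [(hd.ζ_corr.component β).fderiv_osc] at this
  have lD : ∀ β, HasDerivAt (fun s : ℝ => d.D ε β (p.1 + s • e α)) (d.DD ε α β p.1) 0 := fun β => by
    have hdD : DifferentiableAt ℝ (d.D ε β) p.1 :=
      ((((hd.φ_corr.dX β).contDiff_osc ε).differentiable (by simp)).differentiableAt).add
        (((((hd.φ_corr.dY β).contDiff_osc ε).differentiable (by simp)).differentiableAt).const_mul _)
    have := hasDerivAt_line (v := e α) hdD
    rwa [hd.fderiv_D] at this
  have eline : ∀ s : ℝ, p + s • (e α, (0 : ℝ)) = (p.1 + s • e α, p.2) := fun s => by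
    refine Prod.ext ?_ ?_ <;> simp
  have lG : ∀ j, HasDerivAt (fun s : ℝ => oscPrim (fun x t y => d.g x t y j) ε (p.1 + s • e α, p.2))
      (fderiv ℝ (oscPrim (fun x t y => d.g x t y j) ε) p (e α, 0)) 0 := fun j => by
    have := (hg j).hasFDerivAt.hasLineDerivAt (e α, (0 : ℝ))
    simpa only [HasLineDerivAt, eline] using this
  -- Restricting to a line reduces the computation to the product rule in one variable; as the
  -- representative is differentiable at p, the line derivative is the value of its differential.
  have hmain : HasDerivAt (fun s : ℝ => d.rep h ε i (p.1 + s • e α, p.2)) _ 0 :=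
    (((((lU.add (lN.const_mul (h * p.2))).add ((lV.add (lM.const_mul (h * p.2))).const_mul h)).sub
      ((lφ.const_mul (ε ^ 2)).mul lN)).add
      ((HasDerivAt.fun_sum (u := Finset.univ) fun β _ => (lP β).mul (lD β)).const_mul
        (h * ε ^ 2 * p.2))).add
      ((HasDerivAt.fun_sum (u := Finset.univ) fun β _ => (lP β).mul (lζ β)).const_mul (h * ε))).add
      ((HasDerivAt.fun_sum (u := Finset.univ) fun j _ => (lR j).mul (lG j)).const_mul (h ^ 2))
  have h0 : HasDerivAt (fun s : ℝ => d.rep h ε i (p.1 + s • e α, p.2))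
      (fderiv ℝ (d.rep h ε i) p (e α, 0)) 0 := by
    have := hp.hasFDerivAt.hasLineDerivAt (e α, (0 : ℝ))
    simpa only [HasLineDerivAt, eline] using this
  rw [h0.unique hmain]
  simp only [zero_smul, add_zero, R_apply_two, D]
  ring

/-- The out-of-plane derivative of the recovery sequence. -/
theorem Admissible.fderiv_rep_vert (hd : d.Admissible S u V) {h ε : ℝ} {i : Fin 3} {p : R2 × ℝ}
    (hp : DifferentiableAt ℝ (d.rep h ε i) p) (hpI : p.2 ∈ I) :
    fderiv ℝ (d.rep h ε i) p (0, 1) =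
      h * d.N p.1 i + h * (h * d.MU p.1 i) + h * ε ^ 2 * ∑ β, d.P β p.1 i * d.D ε β p.1 +
      h ^ 2 * ∑ j, d.R p.1 i j * d.g p.1 p.2 (ε⁻¹ • p.1) j := by
  have eline : ∀ s : ℝ, p + s • ((0 : R2), (1 : ℝ)) = (p.1, p.2 + s) := fun s => by
    refine Prod.ext ?_ ?_ <;> simp
  have h0 : HasDerivAt (fun s : ℝ => d.rep h ε i (p.1, p.2 + s))
      (fderiv ℝ (d.rep h ε i) p (0, 1)) 0 := by
    have := hp.hasFDerivAt.hasLineDerivAt ((0 : R2), (1 : ℝ))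
    simpa only [HasLineDerivAt, eline] using this
  have ls : HasDerivAt (fun s : ℝ => p.2 + s) 1 0 := (hasDerivAt_id 0).const_add p.2
  have lG : ∀ j, HasDerivAt (fun s : ℝ => oscPrim (fun x t y => d.g x t y j) ε (p.1, p.2 + s))
      (d.g p.1 p.2 (ε⁻¹ • p.1) j) 0 := fun j => by
    have := (hd.g_corr.component j).hasDerivAt_oscPrim ε p.1 p.2
    rw [clampI_of_mem hpI] at this
    have h2 : HasDerivAt (fun s => oscPrim (fun x t y => d.g x t y j) ε (p.1, s))
      (d.g p.1 p.2 (ε⁻¹ • p.1) j) (p.2 + 0) := by rwa [add_zero]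
    exact h2.comp_const_add p.2 0
  have c : ∀ a : ℝ, HasDerivAt (fun _ : ℝ => a) 0 0 := fun a => hasDerivAt_const 0 a
  have hmain : HasDerivAt (fun s : ℝ => d.rep h ε i (p.1, p.2 + s)) _ 0 :=
    ((((((c (d.U p.1 i)).add ((ls.const_mul h).mul_const (d.N p.1 i))).add
      (((c (d.V p.1 i)).add ((ls.const_mul h).mul_const (d.MU p.1 i))).const_mul h)).sub
      (c (ε ^ 2 * osc d.φ ε p.1 * d.N p.1 i))).add
      ((ls.const_mul (h * ε ^ 2)).mul_const (∑ β, d.P β p.1 i * d.D ε β p.1))).add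
      (c (h * ε * ∑ β, d.P β p.1 i * osc (fun x y => d.ζ x y β) ε p.1))).add
      ((HasDerivAt.fun_sum (u := Finset.univ) fun j _ => (lG j).const_mul (d.R p.1 i j)).const_mul
        (h ^ 2))
  rw [h0.unique hmain]
  ring

end Fields

end BendingPlate

namespace BendingPlate

variable {S : Set R2} {d : Fields} {u V : R2 → R3}

namespace Fields

/-! ### The scaled gradient of the recovery sequence -/

/-- The scaled gradient of the representative of the recovery sequence. -/
noncomputable def grad (d : Fields) (h ε : ℝ) (p : R2 × ℝ) : M3 :=
  (Matrix.of ![fun i => fderiv ℝ (d.rep h ε i) p (e 0, 0), fun i => fderiv ℝ (d.rep h ε i) p (e 1, 0),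
    fun i => h⁻¹ * fderiv ℝ (d.rep h ε i) p (0, 1)])ᵀ

/-- The part of the strain that does not oscillate. -/
noncomputable def lead (d : Fields) (t : ℝ) (x : R2) : M3 :=
  (d.R x)ᵀ * (Matrix.of ![fun i => t * d.DN 0 x i + d.PV 0 x i, fun i => t * d.DN 1 x i + d.PV 1 x i,
    d.MU x])ᵀ

/-- The oscillating part of the strain. -/
noncomputable def corr (d : Fields) (t : ℝ) (x y : R2) : M3 :=
  !![dY 0 (fun x y => d.ζ x y 0) x y + t * dY 0 (dY 0 d.φ) x y,
      dY 1 (fun x y => d.ζ x y 0) x y + t * dY 1 (dY 0 d.φ) x y, d.g x t y 0;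
    dY 0 (fun x y => d.ζ x y 1) x y + t * dY 0 (dY 1 d.φ) x y,
      dY 1 (fun x y => d.ζ x y 1) x y + t * dY 1 (dY 1 d.φ) x y, d.g x t y 1;
    0, 0, d.g x t y 2]

/-- The skew part of the scaled gradient, which is of order `ε`. -/
noncomputable def skew (d : Fields) (ε : ℝ) (x : R2) : M3 :=
  !![0, 0, ε ^ 2 * d.D ε 0 x; 0, 0, ε ^ 2 * d.D ε 1 x;
    -(ε ^ 2 * d.D ε 0 x), -(ε ^ 2 * d.D ε 1 x), 0]

theorem skew_transpose (ε : ℝ) (x : R2) : (d.skew ε x)ᵀ = -d.skew ε x := by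
  ext i j
  fin_cases i <;> fin_cases j <;> simp [skew]

/-- The remainder of the expansion of the scaled gradient. -/
noncomputable def err (d : Fields) (h ε : ℝ) (p : R2 × ℝ) : M3 :=
  d.grad h ε p - d.R p.1 *
    (1 + d.skew ε p.1 + h • (d.lead p.2 p.1 + d.corr p.2 p.1 (ε⁻¹ • p.1)))

/-- The remainder is conjugated to the right of the rotation, giving the form Id + S + hG + E to
which frame indifference applies. -/
theorem Admissible.grad_eq (hd : d.Admissible S u V) (h ε : ℝ) {p : R2 × ℝ} (hp : p.1 ∈ S) :
    d.grad h ε p = d.R p.1 * (1 + d.skew ε p.1 +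
      h • (d.lead p.2 p.1 + d.corr p.2 p.1 (ε⁻¹ • p.1)) + (d.R p.1)ᵀ * d.err h ε p) := by
  rw [Matrix.mul_add, ← Matrix.mul_assoc, hd.R_mul_transpose hp, one_mul, err]
  abel

/-- A common bound for the fields and their derivatives. -/
structure Bounded (d : Fields) (S : Set R2) (K : ℝ) : Prop where
  one_le : 1 ≤ K
  R : ∀ i j, ∀ x ∈ S, |d.R x i j| ≤ K
  DR : ∀ i j α, ∀ x ∈ S, |fderiv ℝ (fun z => d.R z i j) x (e α)| ≤ K
  V : ∀ i, ∀ x ∈ S, |d.V x i| ≤ K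
  PV : ∀ α i, ∀ x ∈ S, |d.PV α x i| ≤ K
  MU : ∀ i, ∀ x ∈ S, |d.MU x i| ≤ K
  DMU : ∀ i α, ∀ x ∈ S, |fderiv ℝ (fun z => d.MU z i) x (e α)| ≤ K
  φ : ∀ x y, |d.φ x y| ≤ K
  Xφ : ∀ α x y, |dX α d.φ x y| ≤ K
  Yφ : ∀ α x y, |dY α d.φ x y| ≤ K
  XXφ : ∀ α β x y, |dX α (dX β d.φ) x y| ≤ K
  YXφ : ∀ α β x y, |dY α (dX β d.φ) x y| ≤ K
  XYφ : ∀ α β x y, |dX α (dY β d.φ) x y| ≤ K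
  YYφ : ∀ α β x y, |dY α (dY β d.φ) x y| ≤ K
  ζ : ∀ β x y, |d.ζ x y β| ≤ K
  Xζ : ∀ α β x y, |dX α (fun x y => d.ζ x y β) x y| ≤ K
  Yζ : ∀ α β x y, |dY α (fun x y => d.ζ x y β) x y| ≤ K
  g : ∀ j x, ∀ t ∈ I, ∀ y, |d.g x t y j| ≤ K
  G : ∀ j ε x, ∀ t ∈ I, |oscPrim (fun x t y => d.g x t y j) ε (x, t)| ≤ K
  DG : ∀ j ε, 0 < ε → ∀ p ∈ openPlate (univ : Set R2), ∀ α,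
    |fderiv ℝ (oscPrim (fun x t y => d.g x t y j) ε) p (e α, 0)| ≤ K * (1 + ε⁻¹)

theorem eventually_bound {ι : Type*} {P : ι → Prop} {f : ι → ℝ} (h : ∃ C, ∀ x, P x → |f x| ≤ C) :
    ∀ᶠ K : ℝ in atTop, ∀ x, P x → |f x| ≤ K := by
  obtain ⟨C, hC⟩ := h
  filter_upwards [eventually_ge_atTop C] with K hK x hx using (hC x hx).trans hK

theorem norm_e (α : Fin 2) : ‖e α‖ = 1 := by
  simp [e, Pi.norm_single]

/-- Each bound holds for all sufficiently large K, and finitely many such conditions can be met at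
once. -/
theorem Admissible.exists_bounded (hd : d.Admissible S u V) : ∃ K, d.Bounded S K := by
  have hB : ∀ {f : R2 → ℝ}, BLip S f → ∀ᶠ K : ℝ in atTop, ∀ x ∈ S, |f x| ≤ K := fun hf => by
    obtain ⟨C, -, hC⟩ := hf.exists_bound
    exact eventually_bound ⟨C, hC⟩
  have hB' : ∀ {f : R2 → ℝ}, BLip S f → ∀ α, ∀ᶠ K : ℝ in atTop, ∀ x ∈ S, |fderiv ℝ f x (e α)| ≤ K :=
      fun hf α => by
    obtain ⟨C, -, hC⟩ := hf.exists_fderiv_bound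
    refine eventually_bound ⟨C, fun x hx => ?_⟩
    simpa [norm_e] using hC x hx (e α)
  have hC : ∀ {f : R2 → R2 → ℝ}, IsCorrector S f → ∀ᶠ K : ℝ in atTop, ∀ x y, |f x y| ≤ K :=
      fun hf => by
    obtain ⟨C, -, hC⟩ := hf.exists_bound
    filter_upwards [eventually_ge_atTop C] with K hK x y using (hC x y).trans hK
  have hφ := hd.φ_corr
  have hG := fun j => (hd.g_corr.component j).exists_oscPrim_bounds
  choose CG hCG0 hCG hLG using hG
  have e1 := eventually_all.2 fun i => eventually_all.2 fun j => hB (hd.blip_R i j)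
  have e2 := eventually_all.2 fun i => eventually_all.2 fun j => eventually_all.2 fun α =>
    hB' (hd.blip_R i j) α
  have e3 := eventually_all.2 fun i => hB (hd.rep_V.blip i)
  have e4 := eventually_all.2 fun α => eventually_all.2 fun i => hB (hd.rep_V.blip_deriv α i)
  have e5 := eventually_all.2 fun i => hB (hd.blip_MU i)
  have e6 := eventually_all.2 fun i => eventually_all.2 fun α => hB' (hd.blip_MU i) α
  have e7 := hC hφ
  have e8 := eventually_all.2 fun α => hC (hφ.dX α)
  have e9 := eventually_all.2 fun α => hC (hφ.dY α)
  have e10 := eventually_all.2 fun α => eventually_all.2 fun β => hC ((hφ.dX β).dX α)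
  have e11 := eventually_all.2 fun α => eventually_all.2 fun β => hC ((hφ.dX β).dY α)
  have e12 := eventually_all.2 fun α => eventually_all.2 fun β => hC ((hφ.dY β).dX α)
  have e13 := eventually_all.2 fun α => eventually_all.2 fun β => hC ((hφ.dY β).dY α)
  have e14 := eventually_all.2 fun β => hC (hd.ζ_corr.component β)
  have e15 := eventually_all.2 fun α => eventually_all.2 fun β => hC ((hd.ζ_corr.component β).dX α)
  have e16 := eventually_all.2 fun α => eventually_all.2 fun β => hC ((hd.ζ_corr.component β).dY α)
  have e17 : ∀ᶠ K : ℝ in atTop, ∀ j x, ∀ t ∈ I, ∀ y, |d.g x t y j| ≤ K :=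
      eventually_all.2 fun j => by
    obtain ⟨C, -, hC⟩ := (hd.g_corr.component j).exists_bound
    filter_upwards [eventually_ge_atTop C] with K hK x t ht y using (hC x t ht y).trans hK
  have e18 := eventually_all.2 fun j => eventually_ge_atTop (CG j)
  obtain ⟨K, hK⟩ := ((eventually_ge_atTop (1 : ℝ)).and (e1.and (e2.and (e3.and (e4.and (e5.and
    (e6.and (e7.and (e8.and (e9.and (e10.and (e11.and (e12.and (e13.and (e14.and (e15.and (e16.and
    (e17.and e18)))))))))))))))))).exists
  obtain ⟨k0, k1, k2, k3, k4, k5, k6, k7, k8, k9, k10, k11, k12, k13, k14, k15, k16, k17, k18⟩ := hK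
  refine ⟨K, k0, k1, k2, k3, k4, k5, k6, k7, k8, k9, k10, k11, k12, k13, k14, k15, k16, k17,
    fun j ε x t ht => (hCG j ε x t ht).trans (k18 j), fun j ε hε p hp α => ?_⟩
  have hpos : 0 < ε⁻¹ := inv_pos.2 hε
  have hn := norm_fderiv_le_of_lipschitzOn ℝ ((isOpen_openPlate isOpen_univ).mem_nhds hp)
    ((hLG j ε hε).mono (prod_mono subset_rfl Ioo_subset_I))
  have h0 := hCG0 j
  rw [Real.coe_toNNReal _ (by positivity)] at hn
  refine (ContinuousLinearMap.le_of_opNorm_le _ hn _).trans ?_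
  rw [Prod.norm_def, norm_e, norm_zero, max_eq_left zero_le_one, mul_one]
  exact mul_le_mul_of_nonneg_right (k18 j) (by positivity)

end Fields

end BendingPlate

/-! ### The remainder in the scaled gradient -/

namespace BendingPlate

variable {S : Set R2} {d : Fields} {u V : R2 → R3}

theorem abs_mul_le_mul {a b A B : ℝ} (ha : |a| ≤ A) (hb : |b| ≤ B) : |a * b| ≤ A * B := by
  rw [abs_mul]
  exact mul_le_mul ha hb (abs_nonneg _) ((abs_nonneg _).trans ha)

theorem abs_add_le_add {a b A B : ℝ} (ha : |a| ≤ A) (hb : |b| ≤ B) : |a + b| ≤ A + B :=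
  (abs_add_le _ _).trans (add_le_add ha hb)

theorem abs_sub_le_add {a b A B : ℝ} (ha : |a| ≤ A) (hb : |b| ≤ B) : |a - b| ≤ A + B := by
  rw [sub_eq_add_neg]
  exact abs_add_le_add ha (by rwa [abs_neg])

theorem abs_le_one_of_mem_I {t : ℝ} (ht : t ∈ I) : |t| ≤ 1 := by
  have h1 := ht.1
  have h2 := ht.2
  rw [abs_le]
  constructor <;> linarith

namespace Fields

variable {K ε h : ℝ}

theorem Bounded.abs_D_le (hK : d.Bounded S K) (hε : 0 < ε) (hε1 : ε ≤ 1) (β : Fin 2) (x : R2) :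
    |d.D ε β x| ≤ 2 * K * ε⁻¹ := by
  have h0 : 0 < ε⁻¹ := inv_pos.2 hε
  have h1 : 1 ≤ ε⁻¹ := (one_le_inv₀ hε).2 hε1
  have hK1 := hK.one_le
  have := abs_add_le_add (hK.Xφ β x (ε⁻¹ • x))
    (abs_mul_le_mul (abs_of_pos h0).le (hK.Yφ β x (ε⁻¹ • x)))
  refine this.trans ?_
  nlinarith

/-- Only the pure fast second derivative has order ε⁻². Multiplied by hε²x₃ it is the term x₃∇²_yφ
of the strain; the rest then has order hε and joins the remainder. -/
theorem Bounded.abs_DD_sub_le (hK : d.Bounded S K) (hε : 0 < ε) (hε1 : ε ≤ 1) (α β : Fin 2)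
    (x : R2) :
    |d.DD ε α β x - ε⁻¹ * (ε⁻¹ * osc (dY α (dY β d.φ)) ε x)| ≤ 3 * K * ε⁻¹ := by
  have h0 : 0 < ε⁻¹ := inv_pos.2 hε
  have h1 : 1 ≤ ε⁻¹ := (one_le_inv₀ hε).2 hε1
  have hK1 := hK.one_le
  have := abs_add_le_add (abs_add_le_add (hK.XXφ α β x (ε⁻¹ • x))
    (abs_mul_le_mul (abs_of_pos h0).le (hK.YXφ α β x (ε⁻¹ • x))))
    (abs_mul_le_mul (abs_of_pos h0).le (hK.XYφ α β x (ε⁻¹ • x)))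
  have e : d.DD ε α β x - ε⁻¹ * (ε⁻¹ * osc (dY α (dY β d.φ)) ε x) =
      dX α (dX β d.φ) x (ε⁻¹ • x) + ε⁻¹ * dY α (dX β d.φ) x (ε⁻¹ • x) +
        ε⁻¹ * dX α (dY β d.φ) x (ε⁻¹ • x) := by
    simp only [DD, osc]
    ring
  rw [e]
  refine this.trans ?_
  nlinarith

theorem Bounded.P (hK : d.Bounded S K) (β : Fin 2) (i : Fin 3) {x : R2} (hx : x ∈ S) :
    |d.P β x i| ≤ K := by
  fin_cases β
  · exact hK.R i 0 x hx
  · exact hK.R i 1 x hx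

theorem Bounded.DP (hK : d.Bounded S K) (β : Fin 2) (i : Fin 3) (α : Fin 2) {x : R2} (hx : x ∈ S) :
    |fderiv ℝ (fun z => d.P β z i) x (e α)| ≤ K := by
  fin_cases β
  · exact hK.DR i 0 α x hx
  · exact hK.DR i 1 α x hx

/-- The size of the remainder in the scaled gradient. -/
noncomputable def size (h ε : ℝ) : ℝ := ε ^ 2 + h * ε + h ^ 2 * ε⁻¹

theorem R_mul_lead (hd : d.Admissible S u V) (t : ℝ) {x : R2} (hx : x ∈ S) :
    d.R x * d.lead t x = (Matrix.of ![fun i => t * d.DN 0 x i + d.PV 0 x i,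
      fun i => t * d.DN 1 x i + d.PV 1 x i, d.MU x])ᵀ := by
  rw [lead, ← Matrix.mul_assoc, hd.R_mul_transpose hx, one_mul]

theorem err_apply (hd : d.Admissible S u V) (h ε : ℝ) {p : R2 × ℝ} (hp : p.1 ∈ S) (i j : Fin 3) :
    d.err h ε p i j = d.grad h ε p i j - (d.R p.1 i j + ∑ k, d.R p.1 i k * d.skew ε p.1 k j +
      h * ((Matrix.of ![fun i => p.2 * d.DN 0 p.1 i + d.PV 0 p.1 i,
        fun i => p.2 * d.DN 1 p.1 i + d.PV 1 p.1 i, d.MU p.1])ᵀ i j +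
        ∑ k, d.R p.1 i k * d.corr p.2 p.1 (ε⁻¹ • p.1) k j)) := by
  rw [err, mul_add, mul_add, mul_one, Matrix.mul_smul, mul_add, R_mul_lead hd _ hp]
  simp only [Matrix.sub_apply, Matrix.add_apply, Matrix.smul_apply, smul_eq_mul, Matrix.mul_apply]

/-- The derivatives that survive in the limit have been absorbed in R, `skew`, `lead` and `corr`.
The remainder consists of derivatives falling on the slow fields, slow derivatives of correctors,
and the in-plane derivative of the shear primitive. -/
theorem Admissible.abs_err_plane_le (hd : d.Admissible S u V) (hK : d.Bounded S K) (hε : 0 < ε)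
    (hε1 : ε ≤ 1) (hh : 0 < h) {p : R2 × ℝ} (hp : p ∈ openPlate S)
    (hr : ∀ i, DifferentiableAt ℝ (d.rep h ε i) p)
    (hx : ∀ i, DifferentiableAt ℝ (fun z => d.U z i) p.1 ∧
      DifferentiableAt ℝ (fun z => d.V z i) p.1 ∧ DifferentiableAt ℝ (fun z => d.MU z i) p.1 ∧
      ∀ j, DifferentiableAt ℝ (fun z => d.R z i j) p.1)
    (hg : ∀ j, DifferentiableAt ℝ (oscPrim (fun x t y => d.g x t y j) ε) p)
    (hU : ∀ α i, fderiv ℝ (fun z => d.U z i) p.1 (e α) = d.P α p.1 i)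
    (hV : ∀ α i, fderiv ℝ (fun z => d.V z i) p.1 (e α) = d.PV α p.1 i) (i : Fin 3) (α : Fin 2) :
    |d.err h ε p i α.castSucc| ≤ 20 * K ^ 2 * size h ε := by
  have hpS : p.1 ∈ S := hp.1
  have hpI : p.2 ∈ I := Ioo_subset_I hp.2
  have ht := abs_le_one_of_mem_I hpI
  have hpos : 0 < ε⁻¹ := inv_pos.2 hε
  have hone : 1 ≤ ε⁻¹ := (one_le_inv₀ hε).2 hε1
  have hee : ε * ε⁻¹ = 1 := mul_inv_cancel₀ hε.ne'
  have hK1 := hK.one_le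
  have hK0 : 0 ≤ K := by linarith
  -- The fast derivatives of ζ and φ cancel against the columns of R·`corr` since ε·ε⁻¹ = 1, and the
  -- term -ε²D n cancels against the last row of `skew`.
  have key : d.err h ε p i α.castSucc =
      h ^ 2 * (p.2 * fderiv ℝ (fun z => d.MU z i) p.1 (e α)) -
      ε ^ 2 * (osc d.φ ε p.1 * fderiv ℝ (fun z => d.R z i 2) p.1 (e α)) +
      h * ε ^ 2 * (p.2 * ∑ β, (fderiv ℝ (fun z => d.P β z i) p.1 (e α) * d.D ε β p.1 +
        d.P β p.1 i * (d.DD ε α β p.1 - ε⁻¹ * (ε⁻¹ * osc (dY α (dY β d.φ)) ε p.1)))) +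
      h * ε * ∑ β, (fderiv ℝ (fun z => d.P β z i) p.1 (e α) * osc (fun x y => d.ζ x y β) ε p.1 +
        d.P β p.1 i * osc (dX α fun x y => d.ζ x y β) ε p.1) +
      h ^ 2 * ∑ j, (fderiv ℝ (fun z => d.R z i j) p.1 (e α) *
          oscPrim (fun x t y => d.g x t y j) ε p +
        d.R p.1 i j * fderiv ℝ (oscPrim (fun x t y => d.g x t y j) ε) p (e α, 0)) := by
    have hf := hd.fderiv_rep_plane (hr i) hx hg α
    rw [hU, hV] at hf
    rw [err_apply hd h ε hpS]
    have e1 : d.grad h ε p i α.castSucc = fderiv ℝ (d.rep h ε i) p (e α, 0) := by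
      fin_cases α <;> rfl
    rw [e1, hf]
    have hDN : fderiv ℝ (fun z => d.N z i) p.1 (e α) = d.DN α p.1 i := rfl
    have hDR : fderiv ℝ (fun z => d.R z i 2) p.1 (e α) = d.DN α p.1 i := rfl
    rw [hDN, hDR]
    have hee2 : ε ^ 2 * (ε⁻¹ * ε⁻¹) = 1 := by field_simp
    have e2 : ∀ f : Fin 3 → ℝ, ∑ k, f k = f 0 + f 1 + f 2 := Fin.sum_univ_three
    simp only [e2, Fin.sum_univ_two]
    generalize fderiv ℝ (oscPrim (fun x t y => d.g x t y 0) ε) p (e α, 0) = X0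
    generalize fderiv ℝ (oscPrim (fun x t y => d.g x t y 1) ε) p (e α, 0) = X1
    generalize fderiv ℝ (oscPrim (fun x t y => d.g x t y 2) ε) p (e α, 0) = X2
    fin_cases α
    · simp [skew, corr, R_apply_zero, R_apply_one, R_apply_two, osc]
      field_simp
      ring
    · simp [skew, corr, R_apply_zero, R_apply_one, R_apply_two, osc]
      field_simp
      ring
  have b1 : |p.2 * fderiv ℝ (fun z => d.MU z i) p.1 (e α)| ≤ 1 * K :=
    abs_mul_le_mul ht (hK.DMU i α _ hpS)
  have b2 : |osc d.φ ε p.1 * fderiv ℝ (fun z => d.R z i 2) p.1 (e α)| ≤ K * K :=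
    abs_mul_le_mul (hK.φ _ _) (hK.DR i 2 α _ hpS)
  have b3 : |p.2 * ∑ β, (fderiv ℝ (fun z => d.P β z i) p.1 (e α) * d.D ε β p.1 +
        d.P β p.1 i * (d.DD ε α β p.1 - ε⁻¹ * (ε⁻¹ * osc (dY α (dY β d.φ)) ε p.1)))| ≤
      1 * (2 * (K * (2 * K * ε⁻¹) + K * (3 * K * ε⁻¹))) := by
    refine abs_mul_le_mul ht ?_
    rw [Fin.sum_univ_two, two_mul]
    exact abs_add_le_add
      (abs_add_le_add (abs_mul_le_mul (hK.DP _ _ _ hpS) (hK.abs_D_le hε hε1 _ _))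
        (abs_mul_le_mul (hK.P _ _ hpS) (hK.abs_DD_sub_le hε hε1 _ _ _)))
      (abs_add_le_add (abs_mul_le_mul (hK.DP _ _ _ hpS) (hK.abs_D_le hε hε1 _ _))
        (abs_mul_le_mul (hK.P _ _ hpS) (hK.abs_DD_sub_le hε hε1 _ _ _)))
  have b4 : |∑ β, (fderiv ℝ (fun z => d.P β z i) p.1 (e α) * osc (fun x y => d.ζ x y β) ε p.1 +
        d.P β p.1 i * osc (dX α fun x y => d.ζ x y β) ε p.1)| ≤ 2 * (K * K + K * K) := by
    rw [Fin.sum_univ_two, two_mul]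
    exact abs_add_le_add
      (abs_add_le_add (abs_mul_le_mul (hK.DP _ _ _ hpS) (hK.ζ _ _ _))
        (abs_mul_le_mul (hK.P _ _ hpS) (hK.Xζ _ _ _ _)))
      (abs_add_le_add (abs_mul_le_mul (hK.DP _ _ _ hpS) (hK.ζ _ _ _))
        (abs_mul_le_mul (hK.P _ _ hpS) (hK.Xζ _ _ _ _)))
  have b5 : |∑ j, (fderiv ℝ (fun z => d.R z i j) p.1 (e α) *
          oscPrim (fun x t y => d.g x t y j) ε p +
        d.R p.1 i j * fderiv ℝ (oscPrim (fun x t y => d.g x t y j) ε) p (e α, 0))| ≤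
      (K * K + K * (K * (1 + ε⁻¹))) + (K * K + K * (K * (1 + ε⁻¹))) +
        (K * K + K * (K * (1 + ε⁻¹))) := by
    have : ∀ j, |fderiv ℝ (fun z => d.R z i j) p.1 (e α) *
          oscPrim (fun x t y => d.g x t y j) ε p +
        d.R p.1 i j * fderiv ℝ (oscPrim (fun x t y => d.g x t y j) ε) p (e α, 0)| ≤
        K * K + K * (K * (1 + ε⁻¹)) := fun j =>
      abs_add_le_add (abs_mul_le_mul (hK.DR _ _ _ _ hpS) (hK.G j ε p.1 p.2 hpI))
        (abs_mul_le_mul (hK.R _ _ _ hpS) (hK.DG j ε hε p ⟨mem_univ _, hp.2⟩ α))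
    rw [Fin.sum_univ_three]
    exact abs_add_le_add (abs_add_le_add (this 0) (this 1)) (this 2)
  rw [key]
  have a1 : |h ^ 2| ≤ h ^ 2 := (abs_of_pos (by positivity)).le
  have a2 : |ε ^ 2| ≤ ε ^ 2 := (abs_of_pos (by positivity)).le
  have a3 : |h * ε ^ 2| ≤ h * ε ^ 2 := (abs_of_pos (by positivity)).le
  have a4 : |h * ε| ≤ h * ε := (abs_of_pos (by positivity)).le
  refine (abs_add_le_add (abs_add_le_add (abs_add_le_add (abs_sub_le_add (abs_mul_le_mul a1 b1)
    (abs_mul_le_mul a2 b2)) (abs_mul_le_mul a3 b3)) (abs_mul_le_mul a4 b4))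
    (abs_mul_le_mul a1 b5)).trans ?_
  -- As ε ≤ 1 and K ≥ 1, plain h² terms are absorbed in h²ε⁻¹K². The totals are 1 for ε², 14 for hε
  -- and 10 for h²ε⁻¹, all below 20.
  have c1 : h ^ 2 * K ≤ h ^ 2 * ε⁻¹ * K ^ 2 := by
    have : K ≤ ε⁻¹ * K ^ 2 := by nlinarith
    nlinarith [sq_nonneg h]
  have c3 : h * ε ^ 2 * (1 * (2 * (K * (2 * K * ε⁻¹) + K * (3 * K * ε⁻¹)))) =
      10 * K ^ 2 * (h * ε) := by
    field_simp
    ring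
  have c5 : h ^ 2 * (K * K + K * (K * (1 + ε⁻¹))) ≤ 3 * (h ^ 2 * ε⁻¹ * K ^ 2) := by
    have : K * K + K * (K * (1 + ε⁻¹)) ≤ 3 * (ε⁻¹ * K ^ 2) := by nlinarith [mul_nonneg hK0 hK0]
    nlinarith [sq_nonneg h]
  rw [c3, size]
  have p1 : 0 ≤ K ^ 2 * ε ^ 2 := by positivity
  have p2 : 0 ≤ K ^ 2 * (h * ε) := by positivity
  have p3 : 0 ≤ h ^ 2 * ε⁻¹ * K ^ 2 := by positivity
  nlinarith

/-- In the vertical direction the expansion is exact: the x₃-derivative of the ansatz is affine in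
the fields, and h⁻¹ brings it precisely to n, the last column of R·`skew`, and h times μ and Rḡ. -/
theorem Admissible.err_vert (hd : d.Admissible S u V) (hh : 0 < h) {p : R2 × ℝ}
    (hp : p ∈ openPlate S) (hr : ∀ i, DifferentiableAt ℝ (d.rep h ε i) p) (i : Fin 3) :
    d.err h ε p i 2 = 0 := by
  have hf := hd.fderiv_rep_vert (hr i) (Ioo_subset_I hp.2)
  rw [err_apply hd h ε hp.1]
  have e1 : d.grad h ε p i 2 = h⁻¹ * fderiv ℝ (d.rep h ε i) p (0, 1) := rfl
  rw [e1, hf]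
  simp only [Fin.sum_univ_three, Fin.sum_univ_two]
  simp [skew, corr, R_apply_zero, R_apply_one, R_apply_two]
  field_simp
  ring

end Fields

end BendingPlate

/-! ### Uniform bounds for the recovery sequence, its strain and its gradient -/

namespace BendingPlate

variable {S : Set R2} {d : Fields} {u V : R2 → R3}

theorem isAddHaarMeasure_volume_plate : (volume : Measure (R2 × ℝ)).IsAddHaarMeasure :=
  inferInstanceAs ((volume : Measure R2).prod (volume : Measure ℝ)).IsAddHaarMeasure

namespace Fields

variable {K ε h : ℝ}

theorem Bounded.abs_rep_sub_le (hK : d.Bounded S K) (hε : 0 < ε) (hε1 : ε ≤ 1) (hh : 0 < h)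
    (hh1 : h ≤ 1) {p : R2 × ℝ} (hp : p ∈ openPlate S) (i : Fin 3) :
    |d.rep h ε i p - d.U p.1 i| ≤ 13 * K ^ 2 * (h + ε) := by
  have hpS : p.1 ∈ S := hp.1
  have hpI : p.2 ∈ I := Ioo_subset_I hp.2
  have ht := abs_le_one_of_mem_I hpI
  have hK1 := hK.one_le
  have hK0 : 0 ≤ K := by linarith
  have a1 : |h| ≤ h := (abs_of_pos hh).le
  have a2 : |ε ^ 2| ≤ ε ^ 2 := (abs_of_pos (by positivity)).le
  have a3 : |h * ε ^ 2| ≤ h * ε ^ 2 := (abs_of_pos (by positivity)).le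
  have a4 : |h * ε| ≤ h * ε := (abs_of_pos (by positivity)).le
  have a5 : |h ^ 2| ≤ h ^ 2 := (abs_of_pos (by positivity)).le
  have key : d.rep h ε i p - d.U p.1 i =
      h * p.2 * d.R p.1 i 2 + h * (d.V p.1 i + h * p.2 * d.MU p.1 i)
      - ε ^ 2 * osc d.φ ε p.1 * d.R p.1 i 2
      + h * ε ^ 2 * p.2 * (d.P 0 p.1 i * d.D ε 0 p.1 + d.P 1 p.1 i * d.D ε 1 p.1)
      + h * ε * (d.P 0 p.1 i * osc (fun x y => d.ζ x y 0) ε p.1 +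
        d.P 1 p.1 i * osc (fun x y => d.ζ x y 1) ε p.1)
      + h ^ 2 * (d.R p.1 i 0 * oscPrim (fun x t y => d.g x t y 0) ε p +
        d.R p.1 i 1 * oscPrim (fun x t y => d.g x t y 1) ε p +
        d.R p.1 i 2 * oscPrim (fun x t y => d.g x t y 2) ε p) := by
    simp only [rep, Fin.sum_univ_three, Fin.sum_univ_two, R_apply_two]
    ring
  rw [key]
  have hR := fun j => hK.R i j _ hpS
  have hP := fun β => hK.P β i hpS
  have hD := fun β => hK.abs_D_le hε hε1 β p.1
  have hG := fun j => hK.G j ε p.1 p.2 hpI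
  have hζ := fun β => hK.ζ β p.1 (ε⁻¹ • p.1)
  refine (abs_add_le_add (abs_add_le_add (abs_add_le_add (abs_sub_le_add (abs_add_le_add
    (abs_mul_le_mul (abs_mul_le_mul a1 ht) (hR 2))
    (abs_mul_le_mul a1 (abs_add_le_add (hK.V i _ hpS) (abs_mul_le_mul (abs_mul_le_mul a1 ht)
      (hK.MU i _ hpS)))))
    (abs_mul_le_mul (abs_mul_le_mul a2 (hK.φ _ _)) (hR 2)))
    (abs_mul_le_mul (abs_mul_le_mul a3 ht) (abs_add_le_add (abs_mul_le_mul (hP 0) (hD 0))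
      (abs_mul_le_mul (hP 1) (hD 1)))))
    (abs_mul_le_mul a4 (abs_add_le_add (abs_mul_le_mul (hP 0) (hζ 0))
      (abs_mul_le_mul (hP 1) (hζ 1)))))
    (abs_mul_le_mul a5 (abs_add_le_add (abs_add_le_add (abs_mul_le_mul (hR 0) (hG 0))
      (abs_mul_le_mul (hR 1) (hG 1))) (abs_mul_le_mul (hR 2) (hG 2))))).trans ?_
  have c1 : h * ε ^ 2 * 1 * (K * (2 * K * ε⁻¹) + K * (2 * K * ε⁻¹)) = 4 * (h * ε) * K ^ 2 := by
    field_simp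
    ring
  rw [c1]
  have hKK : K ≤ K ^ 2 := by nlinarith
  have h1 : h * ε ≤ h := by nlinarith
  have h2 : h ^ 2 ≤ h := by nlinarith
  have h3 : ε ^ 2 ≤ ε := by nlinarith
  have m1 : h * K ≤ h * K ^ 2 := by gcongr
  have m2 : h ^ 2 * K ≤ h * K ^ 2 := by gcongr
  have m3 : h * ε * K ^ 2 ≤ h * K ^ 2 := by gcongr
  have m4 : h ^ 2 * K ^ 2 ≤ h * K ^ 2 := by gcongr
  have m5 : ε ^ 2 * K ^ 2 ≤ ε * K ^ 2 := by gcongr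
  have m6 : 0 ≤ ε * K ^ 2 := by positivity
  nlinarith

attribute [local instance] Matrix.normedAddCommGroup Matrix.normedSpace

theorem Bounded.norm_R_le (hK : d.Bounded S K) {x : R2} (hx : x ∈ S) : ‖d.R x‖ ≤ K :=
  (Matrix.norm_le_iff (by linarith [hK.one_le])).2 fun i j => hK.R i j x hx

theorem Bounded.norm_skew_le (hK : d.Bounded S K) (hε : 0 < ε) (hε1 : ε ≤ 1) (x : R2) :
    ‖d.skew ε x‖ ≤ 2 * K * ε := by
  have hK0 : 0 ≤ K := by linarith [hK.one_le]
  have h0 : 0 ≤ 2 * K * ε := by positivity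
  have h1 : ∀ β, |ε ^ 2 * d.D ε β x| ≤ 2 * K * ε := fun β => by
    have := abs_mul_le_mul (abs_of_pos (show 0 < ε ^ 2 by positivity)).le (hK.abs_D_le hε hε1 β x)
    refine this.trans (le_of_eq ?_)
    field_simp
  have h2 : ∀ β, ε ^ 2 * |d.D ε β x| ≤ 2 * K * ε := fun β => by simpa [abs_mul] using h1 β
  refine (Matrix.norm_le_iff h0).2 fun i j => ?_
  rw [Real.norm_eq_abs]
  fin_cases i <;> fin_cases j <;> simp only [skew] <;> simp <;>
    first
      | exact h0
      | exact h2 _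

theorem Bounded.norm_corr_le (hK : d.Bounded S K) {t : ℝ} (ht : t ∈ I) (x y : R2) :
    ‖d.corr t x y‖ ≤ 2 * K := by
  have hK0 : 0 ≤ K := by linarith [hK.one_le]
  have h1 : ∀ α β, |dY α (fun x y => d.ζ x y β) x y + t * dY α (dY β d.φ) x y| ≤ 2 * K :=
      fun α β => by
    have := abs_add_le_add (hK.Yζ α β x y)
      (abs_mul_le_mul (abs_le_one_of_mem_I ht) (hK.YYφ α β x y))
    linarith
  have h2 : ∀ j, |d.g x t y j| ≤ 2 * K := fun j => (hK.g j x t ht y).trans (by linarith)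
  refine (Matrix.norm_le_iff (by positivity)).2 fun i j => ?_
  rw [Real.norm_eq_abs]
  fin_cases i <;> fin_cases j <;> simp only [corr] <;> simp <;>
    first
      | exact h1 _ _
      | exact h2 _
      | exact hK0

theorem Bounded.norm_lead_le (hK : d.Bounded S K) {t : ℝ} (ht : t ∈ I) {x : R2} (hx : x ∈ S) :
    ‖d.lead t x‖ ≤ 6 * K ^ 2 := by
  have hK0 : 0 ≤ K := by linarith [hK.one_le]
  have h1 : ∀ α i, |t * d.DN α x i + d.PV α x i| ≤ 2 * K := fun α i => by
    have := abs_add_le_add (abs_mul_le_mul (abs_le_one_of_mem_I ht) (hK.DR i 2 α x hx))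
      (hK.PV α i x hx)
    refine this.trans (by linarith)
  have h2 : ∀ j, |d.MU x j| ≤ 2 * K := fun j => (hK.MU j x hx).trans (by linarith)
  rw [lead]
  refine (norm_mul_le_three _ _).trans ?_
  have n1 : ‖(d.R x)ᵀ‖ ≤ K := by
    rw [Matrix.norm_transpose]
    exact hK.norm_R_le hx
  have n2 : ‖(Matrix.of ![fun i => t * d.DN 0 x i + d.PV 0 x i,
      fun i => t * d.DN 1 x i + d.PV 1 x i, d.MU x])ᵀ‖ ≤ 2 * K := by
    refine (Matrix.norm_le_iff (by positivity)).2 fun i j => ?_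
    rw [Real.norm_eq_abs]
    fin_cases j
    · exact h1 0 i
    · exact h1 1 i
    · exact h2 i
  calc 3 * (‖(d.R x)ᵀ‖ * _) ≤ 3 * (K * (2 * K)) := by gcongr
    _ = _ := by ring

theorem Admissible.ae_norm_err_le (hd : d.Admissible S u V) (hK : d.Bounded S K) (hε : 0 < ε)
    (hε1 : ε ≤ 1) (hh : 0 < h) :
    ∀ᵐ p ∂(volume.restrict (openPlate S)), ‖d.err h ε p‖ ≤ 20 * K ^ 2 * size h ε := by
  have hO := isOpen_openPlate hd.isOpen
  have : (volume : Measure (R2 × ℝ)).IsAddHaarMeasure := isAddHaarMeasure_volume_plate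
  filter_upwards [ae_restrict_mem hO.measurableSet,
    ae_all_iff.2 fun i => (hd.blip_rep hε h i).ae_differentiableAt hO,
    ae_all_iff.2 fun j => ((hd.g_corr.component j).blip_oscPrim hε).ae_differentiableAt hO,
    ae_openPlate_fst hd.ae_differentiable, ae_openPlate_fst hd.rep_u.fderiv_ae_eq,
    ae_openPlate_fst hd.rep_V.fderiv_ae_eq] with p hp hr hg hx hU hV
  have h0 : 0 ≤ 20 * K ^ 2 * size h ε := by unfold size; positivity
  refine (Matrix.norm_le_iff h0).2 fun i j => ?_
  rw [Real.norm_eq_abs]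
  have hpl := hd.abs_err_plane_le hK hε hε1 hh hp hr hx hg hU hV i
  fin_cases j
  · exact hpl 0
  · exact hpl 1
  · exact (congrArg abs (hd.err_vert hh hp hr i)).trans_le (by simpa using h0)

/-- The scaled gradient is a rotation times a perturbation of the identity. -/
theorem Admissible.exists_strain_bound (hd : d.Admissible S u V) : ∃ a, 0 ≤ a ∧
    (∀ x ∈ S, ∀ t ∈ I, ∀ y, ‖d.lead t x + d.corr t x y‖ ≤ a) ∧
    ∀ h ε, 0 < h → 0 < ε → ε ≤ 1 → ∀ᵐ p ∂(volume.restrict (openPlate S)),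
      9 * (‖d.skew ε p.1‖ ^ 2 +
        h * (‖d.skew ε p.1‖ * ‖d.lead p.2 p.1 + d.corr p.2 p.1 (ε⁻¹ • p.1)‖) +
        (1 + ‖d.skew ε p.1‖) * ‖(d.R p.1)ᵀ * d.err h ε p‖) ≤ a * size h ε ∧
      ‖d.grad h ε p - d.R p.1‖ ≤ a * (ε + h + size h ε) := by
  obtain ⟨K, hK⟩ := hd.exists_bounded
  have hK1 := hK.one_le
  have hK0 : 0 ≤ K := by linarith
  set b := 8 * K ^ 2 with hb
  have hG : ∀ x ∈ S, ∀ t ∈ I, ∀ y, ‖d.lead t x + d.corr t x y‖ ≤ b := fun x hx t ht y =>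
    (norm_add_le _ _).trans ((add_le_add (hK.norm_lead_le ht hx) (hK.norm_corr_le ht x y)).trans
      (by rw [hb]; nlinarith))
  -- The first summand bounds the quadratic error left by the Cayley rotation, the second the
  -- distance of the gradient from R. Adding b gives one constant for all three claims.
  set M := 9 * ((2 * K) ^ 2 + 2 * K * b + (1 + 2 * K) * (60 * K ^ 3)) +
    (3 * K * (2 * K + b) + 20 * K ^ 2) with hM
  refine ⟨b + M, by positivity, fun x hx t ht y => (hG x hx t ht y).trans ?_,
    fun h ε hh hε hε1 => ?_⟩
  · have : 0 ≤ M := by positivity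
    linarith
  filter_upwards [hd.ae_norm_err_le hK hε hε1 hh,
    ae_restrict_mem (isOpen_openPlate hd.isOpen).measurableSet] with p herr hp
  have hpI := Ioo_subset_I hp.2
  have hGp := hG p.1 hp.1 p.2 hpI (ε⁻¹ • p.1)
  set G := d.lead p.2 p.1 + d.corr p.2 p.1 (ε⁻¹ • p.1) with hGdef
  have hS1 := hK.norm_skew_le hε hε1 p.1
  have hS2 : ‖d.skew ε p.1‖ ≤ 2 * K := hS1.trans (by nlinarith)
  have hR := hK.norm_R_le hp.1
  have hs0 : 0 ≤ size h ε := by unfold size; positivity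
  have hE : ‖(d.R p.1)ᵀ * d.err h ε p‖ ≤ 60 * K ^ 3 * size h ε := by
    refine (norm_mul_le_three _ _).trans ?_
    rw [Matrix.norm_transpose]
    calc 3 * (‖d.R p.1‖ * ‖d.err h ε p‖) ≤ 3 * (K * (20 * K ^ 2 * size h ε)) := by gcongr
      _ = _ := by ring
  have hsz1 : ε ^ 2 ≤ size h ε := by
    have : 0 ≤ h * ε + h ^ 2 * ε⁻¹ := by positivity
    unfold size; linarith
  have hsz2 : h * ε ≤ size h ε := by
    have : 0 ≤ ε ^ 2 + h ^ 2 * ε⁻¹ := by positivity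
    unfold size; linarith
  constructor
  · calc 9 * (‖d.skew ε p.1‖ ^ 2 + h * (‖d.skew ε p.1‖ * ‖G‖) +
          (1 + ‖d.skew ε p.1‖) * ‖(d.R p.1)ᵀ * d.err h ε p‖)
        ≤ 9 * ((2 * K * ε) ^ 2 + h * (2 * K * ε * b) + (1 + 2 * K) * (60 * K ^ 3 * size h ε)) := by
          gcongr
      _ = 9 * ((2 * K) ^ 2 * ε ^ 2 + 2 * K * b * (h * ε) + (1 + 2 * K) * (60 * K ^ 3) * size h ε) := by
          ring
      _ ≤ 9 * ((2 * K) ^ 2 * size h ε + 2 * K * b * size h ε +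
          (1 + 2 * K) * (60 * K ^ 3) * size h ε) := by gcongr
      _ = 9 * ((2 * K) ^ 2 + 2 * K * b + (1 + 2 * K) * (60 * K ^ 3)) * size h ε := by ring
      _ ≤ (b + M) * size h ε := by
          refine mul_le_mul_of_nonneg_right ?_ hs0
          have : 0 ≤ 3 * K * (2 * K + b) + 20 * K ^ 2 := by positivity
          have : 0 ≤ b := by positivity
          linarith
  · have e1 : d.grad h ε p - d.R p.1 = d.R p.1 * (d.skew ε p.1 + h • G) + d.err h ε p := by
      rw [err, mul_add, mul_add, mul_add, mul_one]
      abel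
    have n1 : ‖d.skew ε p.1 + h • G‖ ≤ 2 * K * ε + h * b := by
      refine (norm_add_le _ _).trans (add_le_add hS1 ?_)
      rw [norm_smul, Real.norm_eq_abs, abs_of_pos hh]
      gcongr
    rw [e1]
    calc ‖d.R p.1 * (d.skew ε p.1 + h • G) + d.err h ε p‖
        ≤ 3 * (‖d.R p.1‖ * ‖d.skew ε p.1 + h • G‖) + ‖d.err h ε p‖ :=
          (norm_add_le _ _).trans (add_le_add (norm_mul_le_three _ _) le_rfl)
      _ ≤ 3 * (K * (2 * K * ε + h * b)) + 20 * K ^ 2 * size h ε := by gcongr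
      _ ≤ (3 * K * (2 * K + b) + 20 * K ^ 2) * (ε + h + size h ε) := by
          have q1 : 0 ≤ K * K * h := by positivity
          have q2 : 0 ≤ K * b * ε := by positivity
          have q3 : 0 ≤ K * K * size h ε := by positivity
          have q4 : 0 ≤ K * b * size h ε := by positivity
          have q5 : 0 ≤ K * K * ε := by positivity
          nlinarith
      _ ≤ (b + M) * (ε + h + size h ε) := by
          refine mul_le_mul_of_nonneg_right ?_ (by positivity)
          have : 0 ≤ 9 * ((2 * K) ^ 2 + 2 * K * b + (1 + 2 * K) * (60 * K ^ 3)) := by positivity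
          have : 0 ≤ b := by positivity
          linarith

end Fields

/-- The quotient is ε²/h + ε + h/ε, so each term tends to zero by one of the scaling assumptions. -/
theorem IsScaling.tendsto_size {ε : ℝ → ℝ} (hε : IsScaling ε) :
    Tendsto (fun h => Fields.size h (ε h) / h) (𝓝[>] 0) (𝓝 0) := by
  have h1 := (hε.sq_div.add hε.tendsto_zero).add hε.h_div
  simp only [add_zero] at h1
  refine h1.congr' ?_
  filter_upwards [self_mem_nhdsWithin] with h hh
  have h0 : h ≠ 0 := (mem_Ioi.1 hh).ne'
  have h2 := (hε.pos h hh).ne'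
  unfold Fields.size
  field_simp

end BendingPlate

namespace BendingPlate

variable {S : Set R2} {d : Fields} {u V : R2 → R3}

/-! ### The limit at a fixed height -/

namespace Fields

theorem Admissible.continuous_corr (hd : d.Admissible S u V) (i j : Fin 3) :
    Continuous fun p : R2 × ℝ × R2 => d.corr (clampI p.2.1) p.1 p.2.2 i j := by
  have hc : Continuous fun p : R2 × ℝ × R2 => ((clampI p.2.1 : I) : ℝ) :=
    continuous_subtype_val.comp (continuous_clampI.comp continuous_snd.fst)
  have h0 : Continuous fun _ : R2 × ℝ × R2 => (0 : ℝ) := continuous_const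
  have hcomp : ∀ {f : R2 → R2 → ℝ}, IsCorrector S f →
      Continuous fun p : R2 × ℝ × R2 => f p.1 p.2.2 := fun hf =>
    hf.1.continuous.comp (continuous_fst.prodMk continuous_snd.snd)
  have h1 : ∀ α β, Continuous fun p : R2 × ℝ × R2 => dY α (fun x y => d.ζ x y β) p.1 p.2.2 +
      (clampI p.2.1 : I) * dY α (dY β d.φ) p.1 p.2.2 := fun α β =>
    (hcomp ((hd.ζ_corr.component β).dY α)).add (hc.mul (hcomp ((hd.φ_corr.dY β).dY α)))
  have h2 : ∀ j, Continuous fun p : R2 × ℝ × R2 => d.g p.1 (clampI p.2.1) p.2.2 j := fun j =>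
    (hd.g_corr.component j).continuous_clamp
  fin_cases i <;> fin_cases j <;>
    first
      | exact h1 _ _
      | exact h2 _
      | exact h0

theorem Admissible.measurable_lead (hd : d.Admissible S u V) (i j : Fin 3) :
    Measurable fun p : R2 × ℝ => d.lead p.2 p.1 i j := by
  have hR : ∀ k, Measurable fun p : R2 × ℝ => d.R p.1 k i := fun k =>
    (hd.measurable_R k i).comp measurable_fst
  have h1 : ∀ α k, Measurable fun p : R2 × ℝ => p.2 * d.DN α p.1 k + d.PV α p.1 k := fun α k =>
    (measurable_snd.mul ((measurable_pi_apply k).comp ((measurable_DN α).comp measurable_fst))).add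
      ((measurable_pi_apply k).comp ((hd.rep_V.meas_deriv α).comp measurable_fst))
  have h2 : ∀ k, Measurable fun p : R2 × ℝ => d.MU p.1 k := fun k =>
    (measurable_pi_apply k).comp (hd.measurable_MU.comp measurable_fst)
  simp only [lead, Matrix.mul_apply]
  refine Finset.measurable_sum _ fun k _ => (hR k).mul ?_
  fin_cases j
  · exact h1 0 k
  · exact h1 1 k
  · exact h2 k

theorem Admissible.measurable_strain (hd : d.Admissible S u V) (i j : Fin 3) :
    Measurable fun p : R2 × ℝ × R2 =>
      (d.lead (clampI p.2.1) p.1 + d.corr (clampI p.2.1) p.1 p.2.2) i j := by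
  have hc : Measurable fun p : R2 × ℝ × R2 => ((clampI p.2.1 : I) : ℝ) :=
    (continuous_subtype_val.comp (continuous_clampI.comp continuous_snd.fst)).measurable
  exact ((hd.measurable_lead i j).comp (measurable_fst.prodMk hc)).add
    (hd.continuous_corr i j).measurable

theorem Admissible.corr_periodic (hd : d.Admissible S u V) {t : ℝ} (ht : t ∈ I) (x : R2) :
    PeriodicY (d.corr t x) := by
  intro y k
  have h1 : ∀ α β, dY α (fun x y => d.ζ x y β) x (y + fun i => (k i : ℝ)) =
      dY α (fun x y => d.ζ x y β) x y := fun α β => ((hd.ζ_corr.component β).dY α).2.1 x y k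
  have h2 : ∀ α β, dY α (dY β d.φ) x (y + fun i => (k i : ℝ)) = dY α (dY β d.φ) x y :=
    fun α β => ((hd.φ_corr.dY β).dY α).2.1 x y k
  have h3 : d.g x t (y + fun i => (k i : ℝ)) = d.g x t y := hd.g_corr.2.1 x t ht y k
  simp only [corr, h1, h2, h3]

attribute [local instance] Matrix.normedAddCommGroup Matrix.normedSpace

theorem Admissible.exists_corr_lipschitz (hd : d.Admissible S u V) : ∃ L, 0 ≤ L ∧
    ∀ t ∈ I, ∀ x x' y, ‖d.corr t x y - d.corr t x' y‖ ≤ L * ‖x - x'‖ := by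
  choose L1 hL1 h1 using fun α : Fin 2 => fun β => ((hd.ζ_corr.component β).dY α).exists_lipschitz
  choose L2 hL2 h2 using fun α : Fin 2 => fun β => ((hd.φ_corr.dY β).dY α).exists_lipschitz
  choose L3 hL3 h3 using fun j => (hd.g_corr.component j).exists_lipschitz
  obtain ⟨L, hL⟩ := ((eventually_ge_atTop (0 : ℝ)).and ((eventually_all.2 fun α =>
    eventually_all.2 fun β => eventually_ge_atTop (L1 α β + L2 α β)).and
    (eventually_all.2 fun j => eventually_ge_atTop (L3 j)))).exists
  obtain ⟨l0, l1, l2⟩ := hL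
  refine ⟨L, l0, fun t ht x x' y => ?_⟩
  have hx := norm_nonneg (x - x')
  have b1 : ∀ α β, |(dY α (fun x y => d.ζ x y β) x y + t * dY α (dY β d.φ) x y) -
      (dY α (fun x y => d.ζ x y β) x' y + t * dY α (dY β d.φ) x' y)| ≤ L * ‖x - x'‖ := fun α β => by
    have e1 := h1 α β x x' y y
    have e2 := h2 α β x x' y y
    rw [sub_self, norm_zero, add_zero] at e1 e2
    have := abs_add_le_add e1 (abs_mul_le_mul (abs_le_one_of_mem_I ht) e2)
    have e3 : (L1 α β + L2 α β) * ‖x - x'‖ ≤ L * ‖x - x'‖ := by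
      gcongr
      exact l1 α β
    rw [show ∀ a b c e : ℝ, (a + t * b) - (c + t * e) = (a - c) + t * (b - e) by intros; ring]
    linarith
  have b2 : ∀ j, |d.g x t y j - d.g x' t y j| ≤ L * ‖x - x'‖ := fun j => by
    have e1 := h3 j x x' t ht y y
    rw [sub_self, norm_zero, add_zero] at e1
    exact e1.trans (by gcongr; exact l2 j)
  refine (Matrix.norm_le_iff (by positivity)).2 fun i j => ?_
  rw [Real.norm_eq_abs, Matrix.sub_apply]
  have b0 : |(0 : ℝ) - 0| ≤ L * ‖x - x'‖ := by
    rw [sub_zero, abs_zero]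
    positivity
  fin_cases i <;> fin_cases j <;>
    first
      | exact b1 _ _
      | exact b2 _
      | exact b0

end Fields

section SliceLimit

attribute [local instance] Matrix.normedAddCommGroup Matrix.normedSpace

variable {c ρ a t : ℝ} {w : R2 → M3 → ENNReal} {q : R2 → M3 → ℝ}

theorem SliceDensity.ae_bound (hs : SliceDensity c ρ w q) (hc : 0 ≤ c) (a : ℝ) :
    ∀ᵐ y, ∀ G, 0 ≤ q y G ∧ (‖G‖ ≤ a → q y G ≤ 9 * c * a ^ 2) := by
  filter_upwards [hs.quad] with y ⟨B, hqB, hB⟩ G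
  rw [hqB]
  refine ⟨(hB G).1, fun hG => ((hB G).2).trans ?_⟩
  have h1 := frobSq_le_norm_sq G
  have h2 : ‖G‖ ^ 2 ≤ a ^ 2 := by gcongr
  nlinarith

/-- Two-scale convergence for the quadratic energy on a slice. The integrand is extended by zero
outside S, so its jump across an arbitrary boundary and the merely measurable `lead` must both be
charged to the modulus m. -/
theorem tendsto_slice_integral (hd : d.Admissible S u V) (hSb : Bornology.IsBounded S)
    (hs : SliceDensity c ρ w q) (hc : 0 ≤ c) (ht : t ∈ I) (ha : 0 < a)
    (hqm : Measurable fun p : R2 × R2 => q p.2 (d.lead t p.1 + d.corr t p.1 p.2))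
    (hG : ∀ x ∈ S, ∀ y, ‖d.lead t x + d.corr t x y‖ ≤ a) :
    Tendsto (fun ε : ℝ => ∫ x in S, q (ε⁻¹ • x) (d.lead t x + d.corr t x (ε⁻¹ • x))) (𝓝[>] 0)
      (𝓝 (∫ x in S, ∫ y in Y, q y (d.lead t x + d.corr t x y))) := by
  have hSm := hd.isOpen.measurableSet
  obtain ⟨L, hL0, hL⟩ := hd.exists_corr_lipschitz
  obtain ⟨K, hK⟩ := hd.exists_bounded
  obtain ⟨r, hr⟩ := hSb.subset_closedBall 0
  set M := 9 * c * a ^ 2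
  have hM : 0 ≤ M := by positivity
  set A := 36 * c * a
  have hA : 0 ≤ A := by positivity
  -- The first component charges M when exactly one of two points lies in S. The second measures the
  -- variation of `lead`, which contains derivatives of the normal and need not be continuous.
  set m : R2 → ℝ × (Fin 3 → Fin 3 → ℝ) :=
    S.indicator fun x => (M, fun i j => A * d.lead t x i j) with hm
  have hmeas : Measurable m := by
    refine Measurable.indicator (measurable_const.prodMk (measurable_pi_lambda _ fun i =>
      measurable_pi_lambda _ fun j => ?_)) hSm
    exact ((hd.measurable_lead i j).comp (measurable_id.prodMk measurable_const)).const_mul A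
  have hvol : volume S ≠ ⊤ := hSb.measure_lt_top.ne
  have hmi : Integrable m := by
    have : IsFiniteMeasure ((volume : Measure R2).restrict S) := ⟨by
      rw [Measure.restrict_apply_univ]
      exact hvol.lt_top⟩
    have h1 : IntegrableOn (fun x => ((M, fun i j => A * d.lead t x i j) :
        ℝ × (Fin 3 → Fin 3 → ℝ))) S := by
      refine Measure.integrableOn_of_bounded hvol ?_ (M := max M (A * (6 * K ^ 2))) ?_
      · refine (measurable_const.prodMk (measurable_pi_lambda _ fun i =>
          measurable_pi_lambda _ fun j => ?_)).aestronglyMeasurable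
        exact ((hd.measurable_lead i j).comp (measurable_id.prodMk measurable_const)).const_mul A
      · filter_upwards [ae_restrict_mem hSm] with x hx
        refine max_le_max (by rw [Real.norm_eq_abs, abs_of_nonneg hM]) ?_
        refine (pi_norm_le_iff_of_nonneg (by positivity)).2 fun i =>
          (pi_norm_le_iff_of_nonneg (by positivity)).2 fun j => ?_
        rw [Real.norm_eq_abs, abs_mul, abs_of_nonneg hA]
        gcongr
        exact (abs_entry_le_norm _ i j).trans (hK.norm_lead_le ht hx)
    exact h1.integrable_indicator hSm
  have hdist : ∀ x ∈ S, ∀ x' ∈ S, A * ‖d.lead t x - d.lead t x'‖ ≤ ‖m x - m x'‖ :=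
      fun x hx x' hx' => by
    rw [hm, indicator_of_mem hx, indicator_of_mem hx']
    refine le_trans ?_ (le_max_right _ _)
    have e : ((fun i j => A * d.lead t x i j) - fun i j => A * d.lead t x' i j :
        Fin 3 → Fin 3 → ℝ) = A • (d.lead t x - d.lead t x') := by
      ext i j
      simp [mul_sub]
    change _ ≤ ‖((fun i j => A * d.lead t x i j) - fun i j => A * d.lead t x' i j :
        Fin 3 → Fin 3 → ℝ)‖
    rw [e]
    have h2 := norm_smul A (d.lead t x - d.lead t x')
    rw [Real.norm_eq_abs, abs_of_nonneg hA] at h2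
    exact h2.symm.le
  have hjump : ∀ x ∈ S, ∀ x' ∉ S, M ≤ ‖m x - m x'‖ := fun x hx x' hx' => by
    rw [hm, indicator_of_mem hx, indicator_of_notMem hx', sub_zero]
    exact le_trans (by rw [Real.norm_eq_abs, abs_of_nonneg hM]) (le_max_left _ _)
  set F : R2 → R2 → ℝ := fun x y => S.indicator (fun x => q y (d.lead t x + d.corr t x y)) x with hF
  have hFm : Measurable fun p : R2 × R2 => F p.1 p.2 := hqm.indicator (measurable_fst hSm)
  have hper : ∀ x, PeriodicY (F x) := fun x y k => by
    simp only [hF, hs.periodic_q, hd.corr_periodic ht _ y k]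
  have hFb : ∀ᵐ y, ∀ x, |F x y| ≤ M := by
    filter_upwards [hs.ae_bound hc a] with y hy x
    by_cases hx : x ∈ S
    · simp only [hF, indicator_of_mem hx]
      rw [abs_of_nonneg (hy _).1]
      exact (hy _).2 (hG x hx y)
    · simpa only [hF, indicator_of_notMem hx, abs_zero] using hM
  have hFl : ∀ᵐ y, ∀ x x', |F x y - F x' y| ≤ ‖m x - m x'‖ + A * L * ‖x - x'‖ := by
    filter_upwards [hs.quad, hFb] with y ⟨B, hqB, hB⟩ hb x x'
    have hpos : 0 ≤ A * L * ‖x - x'‖ := by positivity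
    by_cases hx : x ∈ S <;> by_cases hx' : x' ∈ S
    · simp only [hF, indicator_of_mem hx, indicator_of_mem hx']
      rw [hqB, hqB]
      refine (quadraticForm_sub_le B (fun G => (hB G).1) (fun G => (hB G).2) _ _ (hG x hx y)
        (hG x' hx' y)).trans ?_
      rw [add_sub_add_comm]
      have h1 := hdist x hx x' hx'
      have h2 := hL t ht x x' y
      calc A * ‖d.lead t x - d.lead t x' + (d.corr t x y - d.corr t x' y)‖
          ≤ A * (‖d.lead t x - d.lead t x'‖ + L * ‖x - x'‖) := by
            gcongr
            exact (norm_add_le _ _).trans (by gcongr)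
        _ ≤ _ := by linarith
    · have h1 := hb x
      rw [show F x' y = 0 from indicator_of_notMem hx' _, sub_zero]
      linarith [hjump x hx x' hx']
    · have h1 := hb x'
      rw [show F x y = 0 from indicator_of_notMem hx _, zero_sub, abs_neg, norm_sub_rev]
      linarith [hjump x' hx' x hx]
    · rw [show F x' y = 0 from indicator_of_notMem hx' _,
        show F x y = 0 from indicator_of_notMem hx _, sub_zero, abs_zero]
      positivity
  have hmain := tendsto_integral_two_scale hmi hFm hper (mul_nonneg hA hL0)
    (fun x hx y => indicator_of_notMem (fun h => hx (hr h)) _) hFb hFl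
  have e1 : ∀ ε : ℝ, ∫ x, F x (ε⁻¹ • x) =
      ∫ x in S, q (ε⁻¹ • x) (d.lead t x + d.corr t x (ε⁻¹ • x)) := fun ε => by
    rw [← integral_indicator hSm]
    rfl
  have e2 : ∫ x, ∫ y in Y, F x y = ∫ x in S, ∫ y in Y, q y (d.lead t x + d.corr t x y) := by
    rw [← integral_indicator hSm]
    refine integral_congr_ae (ae_of_all _ fun x => ?_)
    by_cases hx : x ∈ S
    · simp only [hF, indicator_of_mem hx]
    · simp only [hF, indicator_of_notMem hx, integral_zero]
  rw [e2] at hmain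
  exact hmain.congr e1

end SliceLimit

end BendingPlate

/-! ### Convergence of the slice energies -/

namespace BendingPlate

variable {S : Set R2} {d : Fields} {u V : R2 → R3}

theorem ae_comp_inv_smul {P : R2 → Prop} (h : ∀ᵐ y, P y) {ε : ℝ} (hε : 0 < ε) :
    ∀ᵐ x : R2, P (ε⁻¹ • x) :=
  (Measure.quasiMeasurePreserving_smul volume (inv_ne_zero hε.ne')).ae h

theorem lintegral_close {α : Type*} [MeasurableSpace α] {μ : Measure α} {f g : α → ENNReal}
    {η : ENNReal} (h1 : ∀ᵐ x ∂μ, f x ≤ g x + η) (h2 : ∀ᵐ x ∂μ, g x ≤ f x + η) :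
    ∫⁻ x, f x ∂μ ≤ ∫⁻ x, g x ∂μ + η * μ univ ∧ ∫⁻ x, g x ∂μ ≤ ∫⁻ x, f x ∂μ + η * μ univ := by
  constructor
  · refine (lintegral_mono_ae h1).trans (le_of_eq ?_)
    rw [lintegral_add_right _ measurable_const, lintegral_const]
  · refine (lintegral_mono_ae h2).trans (le_of_eq ?_)
    rw [lintegral_add_right _ measurable_const, lintegral_const]

theorem tendsto_of_close {a b : ℕ → ENNReal} {l m : ENNReal} (hl : l ≠ ⊤) (hm : m ≠ ⊤)
    (hb : Tendsto b atTop (𝓝 l))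
    (h : ∀ η : ℝ, 0 < η → ∀ᶠ n in atTop, a n ≤ b n + ENNReal.ofReal η * m ∧
      b n ≤ a n + ENNReal.ofReal η * m) : Tendsto a atTop (𝓝 l) := by
  rw [ENNReal.tendsto_nhds hl]
  intro δ hδ
  have hδ2 : 0 < δ / 2 := ENNReal.half_pos hδ.ne'
  obtain ⟨η, hη, hηm⟩ : ∃ η : ℝ, 0 < η ∧ ENNReal.ofReal η * m ≤ δ / 2 := by
    have h1 : Tendsto (fun η : ℝ => ENNReal.ofReal η * m) (𝓝[>] 0) (𝓝 0) := by
      have h2 : Tendsto ENNReal.ofReal (𝓝[>] 0) (𝓝 0) := by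
        simpa using (ENNReal.continuous_ofReal.tendsto 0).mono_left
          (nhdsWithin_le_nhds (s := Ioi (0 : ℝ)))
      simpa using ENNReal.Tendsto.mul_const h2 (Or.inr hm)
    obtain ⟨η, hη1, hη2⟩ := ((h1.eventually_le_const hδ2).and self_mem_nhdsWithin).exists
    exact ⟨η, hη2, hη1⟩
  filter_upwards [h η hη, (ENNReal.tendsto_nhds hl).1 hb (δ / 2) hδ2] with n ⟨h1, h2⟩ ⟨h3, h4⟩
  rw [tsub_le_iff_right] at h3
  constructor
  · rw [tsub_le_iff_right]
    calc l ≤ b n + δ / 2 := h3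
      _ ≤ a n + δ / 2 + δ / 2 := by gcongr; exact h2.trans (by gcongr)
      _ = a n + δ := by rw [add_assoc, ENNReal.add_halves]
  · calc a n ≤ b n + δ / 2 := h1.trans (by gcongr)
      _ ≤ l + δ / 2 + δ / 2 := by gcongr
      _ = l + δ := by rw [add_assoc, ENNReal.add_halves]

section SliceLimit

attribute [local instance] Matrix.normedAddCommGroup Matrix.normedSpace

variable {c ρ a t : ℝ} {w : R2 → M3 → ENNReal} {q : R2 → M3 → ℝ}

/-- The energies of the slices converge. -/
theorem tendsto_slice_energy (hd : d.Admissible S u V) (hSb : Bornology.IsBounded S)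
    (hs : SliceDensity c ρ w q) (hc : 0 ≤ c) (ht : t ∈ I) (ha : 0 < a)
    (hqm : Measurable fun p : R2 × R2 => q p.2 (d.lead t p.1 + d.corr t p.1 p.2))
    (hG : ∀ x ∈ S, ∀ y, ‖d.lead t x + d.corr t x y‖ ≤ a) {h ε : ℕ → ℝ} (hh : ∀ n, 0 < h n)
    (hh0 : Tendsto h atTop (𝓝 0)) (hε : ∀ n, 0 < ε n) (hε0 : Tendsto ε atTop (𝓝 0))
    (hsize : Tendsto (fun n => Fields.size (h n) (ε n) / h n) atTop (𝓝 0))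
    (hdec : ∀ᶠ n in atTop, ∀ᵐ x ∂(volume.restrict S), 9 * (‖d.skew (ε n) x‖ ^ 2 +
        h n * (‖d.skew (ε n) x‖ * ‖d.lead t x + d.corr t x ((ε n)⁻¹ • x)‖) +
        (1 + ‖d.skew (ε n) x‖) * ‖(d.R x)ᵀ * d.err (h n) (ε n) (x, t)‖) ≤
          a * Fields.size (h n) (ε n)) :
    Tendsto (fun n => ∫⁻ x in S, w ((ε n)⁻¹ • x) (d.grad (h n) (ε n) (x, t)) /
      ENNReal.ofReal (h n ^ 2)) atTop
      (𝓝 (ENNReal.ofReal (∫ x in S, ∫ y in Y, q y (d.lead t x + d.corr t x y)))) := by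
  have hSm := hd.isOpen.measurableSet
  have hvol : volume S ≠ ⊤ := hSb.measure_lt_top.ne
  have hεw : Tendsto ε atTop (𝓝[>] 0) := tendsto_nhdsWithin_iff.2 ⟨hε0, Eventually.of_forall hε⟩
  have hint := ENNReal.tendsto_ofReal
    ((tendsto_slice_integral hd hSb hs hc ht ha hqm hG).comp hεw)
  have hb : ∀ n, ∀ᵐ x ∂(volume.restrict S),
      0 ≤ q ((ε n)⁻¹ • x) (d.lead t x + d.corr t x ((ε n)⁻¹ • x)) ∧
      q ((ε n)⁻¹ • x) (d.lead t x + d.corr t x ((ε n)⁻¹ • x)) ≤ 9 * c * a ^ 2 := fun n => by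
    filter_upwards [ae_restrict_of_ae (ae_comp_inv_smul (hs.ae_bound hc a) (hε n)),
      ae_restrict_mem hSm] with x hx hxS
    exact ⟨(hx _).1, (hx _).2 (hG x hxS _)⟩
  have hlint : ∀ n, ENNReal.ofReal (∫ x in S, q ((ε n)⁻¹ • x)
      (d.lead t x + d.corr t x ((ε n)⁻¹ • x))) =
      ∫⁻ x in S, ENNReal.ofReal (q ((ε n)⁻¹ • x) (d.lead t x + d.corr t x ((ε n)⁻¹ • x))) :=
      fun n => by
    refine ofReal_integral_eq_lintegral_ofReal ?_ ((hb n).mono fun x hx => hx.1)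
    refine Measure.integrableOn_of_bounded hvol ?_ (M := 9 * c * a ^ 2) ?_
    · exact (hqm.comp (measurable_id.prodMk (measurable_const_smul (ε n)⁻¹))).aestronglyMeasurable
    · filter_upwards [hb n] with x hx
      rw [Real.norm_eq_abs, abs_of_nonneg hx.1]
      exact hx.2
  refine tendsto_of_close ENNReal.ofReal_ne_top hvol hint fun η hη => ?_
  -- For large n the rescaled density lies within η of the quadratic one at almost every x.
  -- Integrating over S of finite measure leaves an error η|S|, as `tendsto_of_close` requires.
  obtain ⟨τ, hτ, hclose⟩ := hs.ae_close hc ha.le hη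
  have hsz : Tendsto (fun n => a * (Fields.size (h n) (ε n) / h n)) atTop (𝓝 0) := by
    simpa using hsize.const_mul a
  filter_upwards [hh0.eventually_le_const hτ, hsz.eventually_le_const hτ, hdec] with n h1 h2 h3
  have hhn := hh n
  have hkey : ∀ᵐ x ∂(volume.restrict S),
      w ((ε n)⁻¹ • x) (d.grad (h n) (ε n) (x, t)) ≠ ⊤ ∧
      |(w ((ε n)⁻¹ • x) (d.grad (h n) (ε n) (x, t))).toReal / h n ^ 2 -
        q ((ε n)⁻¹ • x) (d.lead t x + d.corr t x ((ε n)⁻¹ • x))| ≤ η := by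
    filter_upwards [ae_restrict_of_ae (ae_comp_inv_smul hclose (hε n)), ae_restrict_mem hSm, h3]
      with x hx hxS hx3
    rw [hd.grad_eq (h n) (ε n) (p := (x, t)) hxS]
    refine hx (h n) _ _ _ _ hhn h1 (hd.R_mem hxS) (Fields.skew_transpose _ _) (hG x hxS _)
      (hx3.trans ?_)
    rw [← mul_div_assoc, div_le_iff₀ hhn] at h2
    exact h2
  simp only [Function.comp_apply]
  rw [hlint, ← Measure.restrict_apply_univ S]
  have hsq : 0 < h n ^ 2 := by positivity
  refine lintegral_close ?_ ?_
  · filter_upwards [hkey, hb n] with x ⟨k1, k2⟩ k3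
    rw [← ENNReal.ofReal_toReal k1, ← ENNReal.ofReal_div_of_pos hsq,
      ← ENNReal.ofReal_add k3.1 hη.le]
    refine ENNReal.ofReal_le_ofReal ?_
    linarith [(abs_le.1 k2).2]
  · filter_upwards [hkey, hb n] with x ⟨k1, k2⟩ k3
    rw [← ENNReal.ofReal_toReal k1, ← ENNReal.ofReal_div_of_pos hsq,
      ← ENNReal.ofReal_add (by positivity) hη.le]
    refine ENNReal.ofReal_le_ofReal ?_
    linarith [(abs_le.1 k2).1]

end SliceLimit

end BendingPlate

/-! ### Identification of the strain and integration over the thickness -/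

namespace BendingPlate

variable {S : Set R2} {d : Fields} {u V : R2 → R3}

theorem Fields.lead_apply (t : ℝ) (x : R2) (k l : Fin 3) :
    d.lead t x k l = ∑ i, d.R x i k * (![fun i => t * d.DN 0 x i + d.PV 0 x i,
      fun i => t * d.DN 1 x i + d.PV 1 x i, d.MU x] : Fin 3 → R3) l i := rfl

/-- The strain of the recovery sequence has the symmetric part of the limiting strain. -/
theorem Fields.Admissible.ae_symm (hd : d.Admissible S u V) :
    ∀ᵐ x ∂(volume.restrict S), ∀ (t : ℝ) (y : R2),
      (d.lead t x + d.corr t x y) + (d.lead t x + d.corr t x y)ᵀ =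
        (iota (t • secondFF S u x + qV S u V x) +
          relaxField (d.ζ x) (d.φ x) (halfShear d.g x) t y) +
        (iota (t • secondFF S u x + qV S u V x) +
          relaxField (d.ζ x) (d.φ x) (halfShear d.g x) t y)ᵀ := by
  filter_upwards [hd.ae_N_DN, hd.ae_identify, ae_restrict_mem hd.isOpen.measurableSet]
    with x hN hid hxS t y
  obtain ⟨-, -, -, -, -, hP, hPV, hDN⟩ := hid
  obtain ⟨hM, hM2⟩ := hd.MU_relations hxS
  have hζ : ∀ α β, fderiv ℝ (d.ζ x) y (e α) β = dY α (fun x y => d.ζ x y β) x y := fun α β => by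
    have h1 : DifferentiableAt ℝ (d.ζ x) y :=
      ((hd.ζ_corr.1.comp (contDiff_const.prodMk contDiff_id)).differentiable
        (by simp)).differentiableAt (f := fun w => d.ζ x w)
    have h2 : HasFDerivAt (fun w => d.ζ x w β) _ y := (hasFDerivAt_pi'.1 h1.hasFDerivAt) β
    rw [dY, h2.fderiv]
    rfl
  have hφ : ∀ α β, hess (d.φ x) y α β = dY α (dY β d.φ) x y := fun α β => rfl
  have hN0 := hN 0
  have hN1 := hN 1
  have hM0 := hM 0
  have hM1 := hM 1
  simp only [Fin.sum_univ_three] at hN0 hN1 hM0 hM1 hM2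
  have hII : ∀ α β, secondFF S u x α β = ∑ i, d.P α x i * d.DN β x i := fun α β => by
    simp only [secondFF, Matrix.of_apply, dotProduct, hP, hDN]
  have hq : ∀ α β, qV S u V x α β =
      1 / 2 * (∑ i, d.P α x i * d.PV β x i + ∑ i, d.P β x i * d.PV α x i) := fun α β => by
    simp only [qV, symPart, planeGrad, Matrix.smul_apply, Matrix.add_apply, Matrix.transpose_apply,
      Matrix.mul_apply, Matrix.of_apply, hP, hPV, smul_eq_mul]
  ext k l
  simp only [Matrix.add_apply, Matrix.transpose_apply, Fields.lead_apply]
  -- In the in-plane block only symmetrisation is needed. In the mixed entries n·∂n = 0 and n·∂V +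
  -- ∂u·μ = 0 remove `lead`, and the factor ½ in `halfShear` compensates for ḡ occupying only the
  -- last column of `corr`. The corner uses n·μ = 0.
  fin_cases k <;> fin_cases l <;>
    simp [Fields.corr, iota, relaxField, halfShear, symPart, jac, hII, hq, hφ, hζ,
      Fin.sum_univ_three, Fields.R_apply_zero, Fields.R_apply_one, Fields.R_apply_two] <;>
    first
      | ring1
      | linear_combination t * hN0 + hM0
      | linear_combination t * hN1 + hM1
      | linear_combination 2 * hM2

/-- Existence of Lipschitz representatives of the data. -/
theorem exists_admissible (hS : IsOpen S) (hu : IsometryH2 S u) (hu' : MemWVec ⊤ S 2 u)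
    (hV : MemWVec ⊤ S 2 V) {ζ : R2 → R2 → R2} (hζ : IsCorrector S ζ) {φ : R2 → R2 → ℝ}
    (hφ : IsCorrector S φ) {g : R2 → ℝ → R2 → R3} (hg : IsThickCorrector S g) :
    ∃ d : Fields, d.Admissible S u V ∧ d.ζ = ζ ∧ d.φ = φ ∧ d.g = g := by
  obtain ⟨U, P, hU⟩ := exists_isRep hS hu'
  obtain ⟨U', P', hU'⟩ := exists_isRep hS hV
  refine ⟨⟨U, P, U', P', ζ, φ, g⟩, ⟨hS, hU, hU', fun x hx α β => ?_, hζ, hφ, hg⟩, rfl, rfl, rfl⟩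
  have hae : (fun x => P α x ⬝ᵥ P β x) =ᵐ[volume.restrict S]
      fun _ => if α = β then (1 : ℝ) else 0 := by
    filter_upwards [hu.2, hU.pd_ae_eq] with x h1 h2
    rw [← h2, ← h2, h1]
  have hc : ContinuousOn (fun x => P α x ⬝ᵥ P β x) S := by
    simp only [dotProduct]
    exact continuousOn_finsetSum _ fun i _ =>
      (hU.blip_deriv α i).continuousOn.mul (hU.blip_deriv β i).continuousOn
  -- The isometry relation holds almost everywhere between continuous functions on an open set,
  -- hence at every point of S.
  exact Measure.eqOn_open_of_ae_eq hae hS hc continuousOn_const hx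

theorem Fields.Admissible.ae_scaledGrad_eq (hd : d.Admissible S u V) {h ε : ℝ} (hε : 0 < ε) :
    ∀ᵐ p ∂(volume.restrict (openPlate S)),
      scaledGrad S h (recovery S u V d.ζ d.φ d.g h ε) p = d.grad h ε p := by
  have hO := isOpen_openPlate hd.isOpen
  have : (volume : Measure (R2 × ℝ)).IsAddHaarMeasure := isAddHaarMeasure_volume_plate
  have hw : ∀ v : R2 × ℝ, ∀ᵐ p ∂(volume.restrict (openPlate S)), ∀ i,
      weakDerivVec (openPlate S) v (recovery S u V d.ζ d.φ d.g h ε) p i =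
        fderiv ℝ (d.rep h ε i) p v := fun v => ae_all_iff.2 fun i => by
    refine (hd.blip_rep hε h i).weakDeriv_ae_eq hO ?_ v
    filter_upwards [hd.ae_recovery_eq h ε] with p hp
    rw [hp]
  filter_upwards [hw (e 0, 0), hw (e 1, 0), hw (0, 1)] with p h0 h1 h2
  ext i j
  fin_cases j
  · exact h0 i
  · exact h1 i
  · exact congrArg (h⁻¹ * ·) (h2 i)

theorem measurable_grad (d : Fields) (h ε : ℝ) (i j : Fin 3) :
    Measurable fun p => d.grad h ε p i j := by
  have hm : ∀ v : R2 × ℝ, Measurable fun p => fderiv ℝ (d.rep h ε i) p v := fun v =>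
    measurable_fderiv_apply_const ℝ _ _
  fin_cases j
  · exact hm _
  · exact hm _
  · exact (hm _).const_mul _

theorem restrict_plate_eq :
    (volume : Measure (R2 × ℝ)).restrict (plate S) = (volume.restrict S).prod (volume.restrict I) := by
  rw [plate, Measure.volume_eq_prod, ← Measure.prod_restrict]

theorem restrict_openPlate_eq :
    (volume : Measure (R2 × ℝ)).restrict (openPlate S) = volume.restrict (plate S) := by
  rw [openPlate, plate, I, Measure.volume_eq_prod, ← Measure.prod_restrict,
    ← Measure.prod_restrict, Measure.restrict_congr_set Ioo_ae_eq_Icc]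

theorem ae_slices_of_openPlate {P : R2 × ℝ → Prop}
    (h : ∀ᵐ p ∂(volume.restrict (openPlate S)), P p) :
    ∀ᵐ t ∂((volume : Measure ℝ).restrict I), ∀ᵐ x ∂((volume : Measure R2).restrict S), P (x, t) := by
  rw [restrict_openPlate_eq, restrict_plate_eq] at h
  exact Measure.ae_ae_of_ae_prod (Measure.measurePreserving_swap.quasiMeasurePreserving.ae h)

variable {c₁ c₂ ρ : ℝ} {W : ℝ → R2 → M3 → ENNReal} {Q : ℝ → R2 → QuadraticForm ℝ M3}

/-- The energy as an integral over the energies of the slices. -/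
theorem Fields.Admissible.energy_eq (hd : d.Admissible S u V) (hW : IsEnergyDensity c₁ c₂ ρ W Q)
    {h ε : ℝ} (hε : 0 < ε) (hh : 0 < h) :
    energy W S h ε (recovery S u V d.ζ d.φ d.g h ε) / ENNReal.ofReal (h ^ 2) =
      ∫⁻ t in I, ∫⁻ x in S, W (clampI t) (ε⁻¹ • x) (d.grad h ε (x, t)) / ENNReal.ofReal (h ^ 2) := by
  have hmeas : Measurable fun p : R2 × ℝ => W (clampI p.2) (ε⁻¹ • p.1) (d.grad h ε p) :=
    hW.measurable_comp measurable_snd ((measurable_const_smul ε⁻¹).comp measurable_fst)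
      (measurable_grad d h ε)
  have e1 : energy W S h ε (recovery S u V d.ζ d.φ d.g h ε) =
      ∫⁻ p in plate S, W (clampI p.2) (ε⁻¹ • p.1) (d.grad h ε p) := by
    refine lintegral_congr_ae ?_
    filter_upwards [ae_plate_of_openPlate (hd.ae_scaledGrad_eq (h := h) hε),
      ae_restrict_mem (hd.isOpen.measurableSet.prod measurableSet_Icc)] with p hp hpS
    rw [hp, clampI_of_mem hpS.2]
  rw [e1, div_eq_mul_inv, ← lintegral_mul_const' _ _ (by simpa using hh.ne'), restrict_plate_eq,
    lintegral_prod_symm' _ (hmeas.mul_const _)]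
  rfl

/-- The limit energy at a fixed height. -/
noncomputable def sliceLimit (W : ℝ → R2 → M3 → ENNReal) (S : Set R2) (d : Fields) (t : ℝ) : ℝ :=
  ∫ x in S, ∫ y in Y, scaledLimit W t y (d.lead (clampI t) x + d.corr (clampI t) x y)

theorem Fields.Admissible.measurable_density (hd : d.Admissible S u V)
    (hW : IsEnergyDensity c₁ c₂ ρ W Q) :
    Measurable fun p : R2 × ℝ × R2 => scaledLimit W p.2.1 p.2.2
      (d.lead (clampI p.2.1) p.1 + d.corr (clampI p.2.1) p.1 p.2.2) :=
  hW.measurable_scaledLimit measurable_snd.fst measurable_snd.snd hd.measurable_strain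

attribute [local instance] Matrix.normedAddCommGroup Matrix.normedSpace

/-- Convergence of the energies along sequences. -/
theorem Fields.Admissible.tendsto_energy_seq (hd : d.Admissible S u V)
    (hSb : Bornology.IsBounded S) (hW : IsEnergyDensity c₁ c₂ ρ W Q) {h ε : ℕ → ℝ}
    (hh : ∀ n, 0 < h n) (hh0 : Tendsto h atTop (𝓝 0)) (hε : ∀ n, 0 < ε n)
    (hε0 : Tendsto ε atTop (𝓝 0))
    (hsize : Tendsto (fun n => Fields.size (h n) (ε n) / h n) atTop (𝓝 0)) :
    Tendsto (fun n => energy W S (h n) (ε n) (recovery S u V d.ζ d.φ d.g (h n) (ε n)) /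
      ENNReal.ofReal (h n ^ 2)) atTop (𝓝 (∫⁻ t in I, ENNReal.ofReal (sliceLimit W S d t))) := by
  obtain ⟨a, ha0, hG, hdec⟩ := hd.exists_strain_bound
  have hvol : volume S ≠ ⊤ := hSb.measure_lt_top.ne
  have hSm := hd.isOpen.measurableSet
  simp only [fun n => hd.energy_eq hW (hε n) (hh n)]
  -- The exceptional set of heights depends on h and ε; along a sequence countably many such sets
  -- combine into one null set.
  have hdec' : ∀ᵐ t ∂((volume : Measure ℝ).restrict I), ∀ n, ε n ≤ 1 →
      ∀ᵐ x ∂((volume : Measure R2).restrict S), 9 * (‖d.skew (ε n) x‖ ^ 2 +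
        h n * (‖d.skew (ε n) x‖ * ‖d.lead t x + d.corr t x ((ε n)⁻¹ • x)‖) +
        (1 + ‖d.skew (ε n) x‖) * ‖(d.R x)ᵀ * d.err (h n) (ε n) (x, t)‖) ≤
          a * Fields.size (h n) (ε n) := by
    refine ae_all_iff.2 fun n => ?_
    by_cases hn : ε n ≤ 1
    · filter_upwards [ae_slices_of_openPlate (hdec (h n) (ε n) (hh n) (hε n) hn)] with t ht _
      filter_upwards [ht] with x hx using hx.1
    · exact ae_of_all _ fun t ht => absurd ht hn
  have hsz : Tendsto (fun n => a * (Fields.size (h n) (ε n) / h n)) atTop (𝓝 0) := by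
    simpa using hsize.const_mul a
  have hρ : Tendsto (fun n => h n ^ 2 * (9 * (a + 1) ^ 2)) atTop (𝓝 0) := by
    simpa using (hh0.pow 2).mul_const (9 * (a + 1) ^ 2)
  have hε1 := hε0.eventually_le_const zero_lt_one
  have hIfin : (volume : Measure ℝ) I ≠ ⊤ := measure_Icc_lt_top.ne
  -- The dominating function is constant in the height: `SliceDensity.ae_le` bounds each slice
  -- energy divided by h² by the same multiple of |S|.
  refine tendsto_lintegral_filter_of_dominated_convergence
    (fun _ => ENNReal.ofReal (c₂ * (9 * (a + 1) ^ 2)) * volume S) ?_ ?_ ?_ ?_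
  · refine Eventually.of_forall fun n => ?_
    have hmeas : Measurable fun p : R2 × ℝ => W (clampI p.2) ((ε n)⁻¹ • p.1)
        (d.grad (h n) (ε n) p) / ENNReal.ofReal (h n ^ 2) :=
      (hW.measurable_comp measurable_snd ((measurable_const_smul (ε n)⁻¹).comp measurable_fst)
        (measurable_grad d (h n) (ε n))).div_const _
    exact hmeas.lintegral_prod_left'
  · filter_upwards [hε1, hsz.eventually_le_const zero_lt_one, hρ.eventually_le_const hW.ρ_pos]
      with n n1 n2 n3
    filter_upwards [hW.ae_slice, hdec', ae_restrict_mem (μ := (volume : Measure ℝ)) (s := I)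
      measurableSet_Icc] with t ⟨hs, _⟩ ht htI
    have hb : ∀ᵐ x ∂((volume : Measure R2).restrict S),
        W (clampI t) ((ε n)⁻¹ • x) (d.grad (h n) (ε n) (x, t)) / ENNReal.ofReal (h n ^ 2) ≤
          ENNReal.ofReal (c₂ * (9 * (a + 1) ^ 2)) := by
      filter_upwards [ht n n1, ae_restrict_of_ae (ae_comp_inv_smul (hs.ae_le hW.c₂_pos.le a) (hε n)),
        ae_restrict_mem hSm] with x hx1 hx2 hxS
      rw [clampI_of_mem htI, hd.grad_eq (h n) (ε n) (p := (x, t)) hxS]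
      have hsq : 0 < h n ^ 2 := by have := hh n; positivity
      have := hx2 (h n) _ _ _ _ (hh n) n3 (hd.R_mem hxS) (Fields.skew_transpose (d := d) (ε n) x)
        (hG x hxS t htI _) (hx1.trans (by
          rwa [← mul_div_assoc, div_le_iff₀ (hh n)] at n2))
      refine (ENNReal.div_le_div_right this _).trans (le_of_eq ?_)
      rw [← ENNReal.ofReal_div_of_pos hsq]
      have hn0 := (hh n).ne'
      congr 1
      field_simp
    refine (lintegral_mono_ae hb).trans (le_of_eq ?_)
    rw [lintegral_const, Measure.restrict_apply_univ]
  · rw [lintegral_const, Measure.restrict_apply_univ]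
    exact ENNReal.mul_ne_top (ENNReal.mul_ne_top ENNReal.ofReal_ne_top hvol) hIfin
  · filter_upwards [hW.ae_slice, hdec', ae_restrict_mem (μ := (volume : Measure ℝ)) (s := I)
      measurableSet_Icc] with t ⟨hs, _⟩ ht htI
    have hqm : Measurable fun p : R2 × R2 => scaledLimit W t p.2
        (d.lead t p.1 + d.corr t p.1 p.2) := by
      have := (hd.measurable_density hW).comp
        (f := fun p : R2 × R2 => (p.1, t, p.2)) (by fun_prop)
      simpa only [Function.comp_def, clampI_of_mem htI] using this
    -- The bound a is only known to be nonnegative; a + 1 supplies the strict positivity required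
    -- here.
    have := tendsto_slice_energy hd hSb hs hW.c₂_pos.le htI (a := a + 1) (by positivity) hqm
      (fun x hx y => (hG x hx t htI y).trans (by linarith)) hh hh0 hε hε0 hsize (by
        filter_upwards [hε1] with n hn
        filter_upwards [ht n hn] with x hx
        refine hx.trans ?_
        have hsz0 : 0 ≤ Fields.size (h n) (ε n) := by
          have := hh n
          have := hε n
          unfold Fields.size
          positivity
        nlinarith)
    simpa only [sliceLimit, clampI_of_mem htI] using this

/-- Identification of the limit. -/
theorem Fields.Admissible.lintegral_sliceLimit (hd : d.Admissible S u V)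
    (hSb : Bornology.IsBounded S) (hW : IsEnergyDensity c₁ c₂ ρ W Q) :
    ∫⁻ t in I, ENNReal.ofReal (sliceLimit W S d t) =
      ENNReal.ofReal (∫ x in S, ∫ t in I, ∫ y in Y,
        Q t y (iota (t • secondFF S u x + qV S u V x) +
          relaxField (d.ζ x) (d.φ x) (halfShear d.g x) t y)) := by
  obtain ⟨a, ha0, hG, -⟩ := hd.exists_strain_bound
  have hvol : volume S ≠ ⊤ := hSb.measure_lt_top.ne
  have hIfin : (volume : Measure ℝ) I ≠ ⊤ := measure_Icc_lt_top.ne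
  have hSm := hd.isOpen.measurableSet
  set H : ℝ × R2 → ℝ := fun p => ∫ y in Y, scaledLimit W p.1 y
    (d.lead (clampI p.1) p.2 + d.corr (clampI p.1) p.2 y) with hH
  have hHm : StronglyMeasurable H := by
    have h1 : Measurable fun p : (ℝ × R2) × R2 => scaledLimit W p.1.1 p.2
        (d.lead (clampI p.1.1) p.1.2 + d.corr (clampI p.1.1) p.1.2 p.2) :=
      (hd.measurable_density hW).comp (f := fun p : (ℝ × R2) × R2 => (p.1.2, p.1.1, p.2))
        (by fun_prop)
    exact h1.stronglyMeasurable.integral_prod_right'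
  have hHb : ∀ᵐ t ∂((volume : Measure ℝ).restrict I), ∀ x ∈ S,
      0 ≤ H (t, x) ∧ ‖H (t, x)‖ ≤ 9 * c₂ * a ^ 2 := by
    filter_upwards [hW.ae_slice, ae_restrict_mem (μ := (volume : Measure ℝ)) (s := I)
      measurableSet_Icc] with t ⟨hs, _⟩ htI x hx
    have hb := ae_restrict_of_ae (s := Y) (hs.ae_bound hW.c₂_pos.le a)
    constructor
    · refine integral_nonneg_of_ae ?_
      filter_upwards [hb] with y hy using (hy _).1
    · have := norm_setIntegral_le_of_norm_le_const_ae' (μ := (volume : Measure R2)) (s := Y)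
        (f := fun y => scaledLimit W t y (d.lead (clampI t) x + d.corr (clampI t) x y))
        (C := 9 * c₂ * a ^ 2) (by rw [volume_Y]; simp) (by
          refine (ae_restrict_iff' measurableSet_Y).1 ?_
          filter_upwards [hb] with y hy
          rw [Real.norm_eq_abs, abs_of_nonneg (hy _).1]
          exact (hy _).2 (hG x hx _ (clampI t).2 y))
      simpa [measureReal_def, volume_Y] using this
  have hfin1 : IsFiniteMeasure ((volume : Measure R2).restrict S) :=
    isFiniteMeasure_restrict.2 hvol
  have hfin2 : IsFiniteMeasure ((volume : Measure ℝ).restrict I) :=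
    isFiniteMeasure_restrict.2 hIfin
  have hHi : Integrable H ((volume.restrict I).prod (volume.restrict S)) := by
    refine Integrable.of_bound hHm.aestronglyMeasurable (9 * c₂ * a ^ 2) ?_
    filter_upwards [Measure.quasiMeasurePreserving_fst.ae hHb,
      Measure.quasiMeasurePreserving_snd.ae (ae_restrict_mem hSm)] with p hp hpS
    exact (hp p.2 hpS).2
  have e1 : ∫⁻ t in I, ENNReal.ofReal (sliceLimit W S d t) =
      ENNReal.ofReal (∫ t in I, ∫ x in S, H (t, x)) := by
    refine (ofReal_integral_eq_lintegral_ofReal hHi.integral_prod_left ?_).symm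
    filter_upwards [hHb] with t ht
    refine integral_nonneg_of_ae ?_
    filter_upwards [ae_restrict_mem hSm] with x hx using (ht x hx).1
  -- The slices were integrated over S first, while the claim integrates over S last.
  rw [e1, integral_integral_swap (f := fun t x => H (t, x)) hHi]
  congr 1
  refine integral_congr_ae ?_
  filter_upwards [hd.ae_symm] with x hx
  refine integral_congr_ae ?_
  filter_upwards [hW.ae_slice, ae_restrict_mem (μ := (volume : Measure ℝ)) (s := I)
    measurableSet_Icc] with t ⟨hs, hQ⟩ htI
  refine integral_congr_ae ?_
  filter_upwards [hQ, ae_restrict_of_ae (hs.ae_eq_of_symm hW.c₂_pos.le)] with y h1 h2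
  -- Only the symmetric part of the strain matters, so it may be replaced by the strain of the
  -- claim; on the cell `scaledLimit` is then Q.
  rw [clampI_of_mem htI, h2 _ _ (hx t y), h1]

end BendingPlate

/-! ### Uniform convergence and the limit h → 0 -/

namespace BendingPlate

variable {S : Set R2} {d : Fields} {u V : R2 → R3}

theorem tendsto_eLpNorm_top_of_ae_le {α : Type*} [MeasurableSpace α] {μ : Measure α}
    {f : ℝ → α → ℝ} {b : ℝ → ℝ} (hb : Tendsto b (𝓝[>] 0) (𝓝 0))
    (h : ∀ᶠ h in 𝓝[>] 0, ∀ᵐ x ∂μ, |f h x| ≤ b h) :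
    Tendsto (fun h => eLpNorm (f h) ⊤ μ) (𝓝[>] 0) (𝓝 0) := by
  have hb' : Tendsto (fun h => ENNReal.ofReal (b h)) (𝓝[>] 0) (𝓝 0) := by
    simpa using ENNReal.tendsto_ofReal hb
  refine tendsto_of_tendsto_of_tendsto_of_le_of_le' tendsto_const_nhds hb'
    (Eventually.of_forall fun _ => zero_le) ?_
  filter_upwards [h] with h hh
  rw [eLpNorm_exponent_top]
  exact eLpNormEssSup_le_of_ae_bound hh

theorem IsScaling.eventually {ε : ℝ → ℝ} (hε : IsScaling ε) :
    ∀ᶠ h in 𝓝[>] (0 : ℝ), 0 < h ∧ h ≤ 1 ∧ 0 < ε h ∧ ε h ≤ 1 := by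
  have h1 : Tendsto (fun h : ℝ => h) (𝓝[>] 0) (𝓝 0) := tendsto_nhdsWithin_of_tendsto_nhds tendsto_id
  filter_upwards [self_mem_nhdsWithin, h1.eventually_le_const zero_lt_one,
    hε.tendsto_zero.eventually_le_const zero_lt_one] with h hh hh1 hε1
  exact ⟨hh, hh1, hε.pos h hh, hε1⟩

namespace Fields

theorem Admissible.tendsto_recovery (hd : d.Admissible S u V) {ε : ℝ → ℝ} (hε : IsScaling ε)
    (i : Fin 3) : Tendsto (fun h => eLpNorm (fun x : R2 × ℝ =>
      recovery S u V d.ζ d.φ d.g h (ε h) x i - u x.1 i) ⊤ (volume.restrict (plate S)))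
      (𝓝[>] 0) (𝓝 0) := by
  obtain ⟨K, hK⟩ := hd.exists_bounded
  have h1 : Tendsto (fun h : ℝ => h) (𝓝[>] 0) (𝓝 0) := tendsto_nhdsWithin_of_tendsto_nhds tendsto_id
  have hb : Tendsto (fun h => 13 * K ^ 2 * (h + ε h)) (𝓝[>] 0) (𝓝 0) := by
    simpa using (h1.add hε.tendsto_zero).const_mul (13 * K ^ 2)
  refine tendsto_eLpNorm_top_of_ae_le hb ?_
  filter_upwards [hε.eventually] with h ⟨hh, hh1, hε0, hε1⟩
  refine ae_plate_of_openPlate ?_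
  filter_upwards [hd.ae_recovery_eq h (ε h), ae_openPlate_fst hd.rep_u.ae_eq,
    ae_restrict_mem (isOpen_openPlate hd.isOpen).measurableSet] with p h1 h2 hp
  rw [h1, h2]
  exact hK.abs_rep_sub_le hε0 hε1 hh hh1 hp i

theorem Admissible.tendsto_scaledGrad (hd : d.Admissible S u V) {ε : ℝ → ℝ} (hε : IsScaling ε)
    (i j : Fin 3) : Tendsto (fun h => eLpNorm (fun x : R2 × ℝ =>
      scaledGrad S h (recovery S u V d.ζ d.φ d.g h (ε h)) x i j - frame S u x.1 i j) ⊤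
        (volume.restrict (plate S))) (𝓝[>] 0) (𝓝 0) := by
  obtain ⟨a, ha0, -, hdec⟩ := hd.exists_strain_bound
  have h1 : Tendsto (fun h : ℝ => h) (𝓝[>] 0) (𝓝 0) := tendsto_nhdsWithin_of_tendsto_nhds tendsto_id
  have hs : Tendsto (fun h => size h (ε h)) (𝓝[>] 0) (𝓝 0) := by
    have := hε.tendsto_size.mul h1
    rw [mul_zero] at this
    refine this.congr' ?_
    filter_upwards [self_mem_nhdsWithin] with h hh
    exact div_mul_cancel₀ _ (mem_Ioi.1 hh).ne'
  have hb : Tendsto (fun h => a * (ε h + h + size h (ε h))) (𝓝[>] 0) (𝓝 0) := by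
    simpa using ((hε.tendsto_zero.add h1).add hs).const_mul a
  refine tendsto_eLpNorm_top_of_ae_le hb ?_
  filter_upwards [hε.eventually] with h ⟨hh, hh1, hε0, hε1⟩
  refine ae_plate_of_openPlate ?_
  filter_upwards [hd.ae_scaledGrad_eq (h := h) hε0, hdec h (ε h) hh hε0 hε1,
    ae_openPlate_fst hd.ae_identify] with p h1 h2 h3
  rw [h1, h3.2.2.2.1]
  exact (abs_entry_le_norm (d.grad h (ε h) p - d.R p.1) i j).trans h2.2

theorem Admissible.memW_recovery (hd : d.Admissible S u V) (hSb : Bornology.IsBounded S) {h ε : ℝ}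
    (hε : 0 < ε) : MemWVec 2 (openPlate S) 1 (recovery S u V d.ζ d.φ d.g h ε) := by
  intro i
  have : (volume : Measure (R2 × ℝ)).IsAddHaarMeasure := isAddHaarMeasure_volume_plate
  refine BLip.memW (isOpen_openPlate hd.isOpen)
    (hSb.prod (Metric.isBounded_Ioo _ _)).measure_lt_top.ne (hd.blip_rep hε h i) ?_ 2
  filter_upwards [hd.ae_recovery_eq h ε] with p hp
  rw [hp]

theorem Admissible.tendsto_energy (hd : d.Admissible S u V) (hSb : Bornology.IsBounded S)
    {c₁ c₂ ρ : ℝ} {W : ℝ → R2 → M3 → ENNReal} {Q : ℝ → R2 → QuadraticForm ℝ M3}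
    (hW : IsEnergyDensity c₁ c₂ ρ W Q) {ε : ℝ → ℝ} (hε : IsScaling ε) :
    Tendsto (fun h => energy W S h (ε h) (recovery S u V d.ζ d.φ d.g h (ε h)) /
      ENNReal.ofReal (h ^ 2)) (𝓝[>] 0)
      (𝓝 (ENNReal.ofReal (∫ x in S, ∫ t in I, ∫ y in Y,
        Q t y (iota (t • secondFF S u x + qV S u V x) +
          relaxField (d.ζ x) (d.φ x) (halfShear d.g x) t y)))) := by
  rw [← hd.lintegral_sliceLimit hSb hW]
  -- Passing to sequences keeps the exceptional null sets countable in number. Finitely many terms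
  -- are dropped so that positivity holds for every index.
  refine tendsto_of_seq_tendsto fun h hh => ?_
  obtain ⟨N, hN⟩ := eventually_atTop.1 (hh.eventually hε.eventually)
  rw [← tendsto_add_atTop_iff_nat N]
  have hh' := hh.comp (tendsto_add_atTop_nat N)
  exact hd.tendsto_energy_seq hSb hW (h := fun n => h (n + N)) (ε := fun n => ε (h (n + N)))
    (fun n => (hN _ (Nat.le_add_left N n)).1) (tendsto_nhds_of_tendsto_nhdsWithin hh')
    (fun n => (hN _ (Nat.le_add_left N n)).2.2.1) (hε.tendsto_zero.comp hh')
    (hε.tendsto_size.comp hh')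

end Fields

end BendingPlate

open BendingPlate in
theorem mainTheorem4
    (S : Set R2) (hSopen : IsOpen S) (hSbdd : Bornology.IsBounded S)
    (c₁ c₂ ρ : ℝ) (W : ℝ → R2 → M3 → ENNReal) (Q : ℝ → R2 → QuadraticForm ℝ M3)
    (hW : IsEnergyDensity c₁ c₂ ρ W Q)
    (ε : ℝ → ℝ) (hε : IsScaling ε)
    (u V : R2 → R3) (hu : IsometryH2 S u) (hu' : MemWVec ⊤ S 2 u) (hV : MemWVec ⊤ S 2 V)
    (ζ : R2 → R2 → R2) (hζ : IsCorrector S ζ)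
    (φ : R2 → R2 → ℝ) (hφ : IsCorrector S φ)
    (gbar : R2 → ℝ → R2 → R3) (hg : IsThickCorrector S gbar) :
    ∃ uh : ℝ → R2 × ℝ → R3,
    -- the sequence is the explicit one
    (∀ h, 0 < h → uh h = recovery S u V ζ φ gbar h (ε h)) ∧
    -- the sequence lies in `H¹(Ω, ℝ³)`
    (∀ h, 0 < h → MemWVec 2 (openPlate S) 1 (uh h)) ∧
    -- `u^h → u` uniformly in `Ω`
    (∀ i, Tendsto
      (fun h => eLpNorm (fun x : R2 × ℝ => uh h x i - u x.1 i) ⊤ (volume.restrict (plate S)))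
      (𝓝[>] 0) (𝓝 0)) ∧
    -- `∇_h u^h → (∇'u, n)` uniformly in `Ω`
    (∀ i j, Tendsto
      (fun h => eLpNorm (fun x : R2 × ℝ => scaledGrad S h (uh h) x i j - frame S u x.1 i j) ⊤
        (volume.restrict (plate S)))
      (𝓝[>] 0) (𝓝 0)) ∧
    -- convergence of the rescaled energy
    Tendsto (fun h => energy W S h (ε h) (uh h) / ENNReal.ofReal (h ^ 2)) (𝓝[>] 0)
      (𝓝 (ENNReal.ofReal
        (∫ x' in S, ∫ x₃ in I, ∫ y in Y,
          Q x₃ y (iota (x₃ • secondFF S u x' + qV S u V x') +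
            relaxField (ζ x') (φ x') (halfShear gbar x') x₃ y)))) := by
  obtain ⟨d, hd, rfl, rfl, rfl⟩ := exists_admissible hSopen hu hu' hV hζ hφ hg
  exact ⟨fun h => recovery S u V d.ζ d.φ d.g h (ε h), fun _ _ => rfl,
    fun h hh => hd.memW_recovery hSbdd (hε.pos h hh), fun i => hd.tendsto_recovery hε i,
    fun i j => hd.tendsto_scaledGrad hε i j, hd.tendsto_energy hSbdd hW hε⟩
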